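/- A tropical curve $C$ is given by a connected finite graph $\Gamma$ (loops and multiple edges allowed) whose edges have positive lengths, infinite exactly for the edges ending at a $1$-valent vertex; $1$-valent vertices are the points at infinity, and subdividing edges by $2$-valent vertices does not change $C$. Let $g=b_1(\Gamma)$. A divisor is a finite formal sum $\sum a_p\,p$ with $p\in C$ and $a_p\in\mathbb Z$. A piecewise linear (PL) function $f$ with integral slopes (continuous at all points not at infinity, possibly tending to $\pm\infty$ at points at infinity) has the principal divisor $(f)=\sum_p\big(\sum_\xi \partial f(p)/\partial\xi\big)p$, where $\xi$ runs over the outward unit tangent directions at $p$. $\operatorname{Pic}(C)$ is the group of divisors modulo principal divisors, and $K=\sum_p(\operatorname{val}(p)-2)p$. A theta characteristic is a class $\mathcal K$ of degree $g-1$ with $2\mathcal K=[K]$; a class is effective if it contains a divisor with all coefficients $\ge 0$. Let $\Omega_{\mathbb Z}(C)$ be the lattice of integral $1$-forms (circuit lattice), $\Omega(C)^*=\operatorname{Hom}(\Omega_{\mathbb Z}(C),\mathbb R)$, $\Lambda=H_1(C,\mathbb Z)\subset\Omega(C)^*$ (by integration), $J(C)=\Omega(C)^*/\Lambda$, and for a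 base point $p_0$ let $\mu$ be the Abel–Jacobi map from divisors to $J(C)$, $\mu(\sum a_ip_i)=\sum a_i\int_{p_0}^{p_i}$. Let $Q$ be the symmetric bilinear form on $\Omega(C)^*$ with $Q(\ell,\ell)=\operatorname{length}(\ell)$ for simple cycles $\ell$, and $\Theta(x)=\max_{\lambda\in\Lambda}\{Q(\lambda,x)-\tfrac12Q(\lambda,\lambda)\}$. For $\lambda\in J(C)$ let $D_\lambda$ be the divisor on $C$ that is locally the divisor of $p\mapsto\Theta(\mu(p)-\lambda)$ (computed with local lifts to $\Omega(C)^*$). A Riemann constant is a $\kappa\in J(C)$ such that $\mu(D_\lambda)+\kappa=\lambda$ for all $\lambda\in J(C)$. For a finite non-empty set $S\subset C$ containing no point at infinity, let $d_S(x)=\operatorname{dist}(S,x)$, and orient $C$ by the gradient flow of $d_S$ (towards increasing $d_S$). Let $\operatorname{val}_+(p)$, resp. $\operatorname{val}_-(p)$, be the number of outgoing, resp. incoming, edges at $p$, and let $\mathcal K_S^{\pm}=\sum_p(\operatorname{val}_\pm(p)-1)p$. **Lemma.** There is a class $\mathcal K_0\in\operatorname{Pic}(C)$ of degree $g-1$ such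 that: 1. $\mathcal K_0$ is a theta characteristic, it is not effective, and it is the only non-effective theta characteristic; 2. for every base point $p_0$ there is exactly one Riemann constant $\kappa$, and $\mu(D)=-\kappa$ for every divisor $D$ in the class $\mathcal K_0$ (that is, $\mathcal K_0=-\kappa$); 3. for every finite non-empty $S\subset C$ without points at infinity, $\mathcal K_S^{+}$ and $\mathcal K_S^{-}$ are divisors (finite sums) of degree $g-1$ with $\mathcal K_S^++\mathcal K_S^-=K$, the function $d_S$ is PL with integral slopes, $\mathcal K_S^+-\mathcal K_S^-=(d_S)$, and both $\mathcal K_S^{+}$ and $\mathcal K_S^{-}$ represent $\mathcal K_0$. In particular all the divisors $\mathcal K_S^{\pm}$, for all such $S$, are linearly equivalent. -/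

import Mathlib

/-- A tropical curve, presented by one of its metric graphs. Loops and multiple edges are allowed.
The reference direction `src e → tgt e` of each edge is only used for coordinates. The edges that
end in a 1-valent vertex are exactly the edges of infinite length, and they are parametrized
towards the 1-valent vertex (a graph consisting of a single edge with two 1-valent ends is first
subdivided by an interior 2-valent vertex, so that no edge has two 1-valent ends). -/
structure TropicalCurve where
  V : Type
  E : Type
  [fintypeV : Fintype V]
  [fintypeE : Fintype E]
  src : E → V
  tgt : E → V
  len : E → ENNReal
  nonempty : Nonempty V
  connected : ∀ u v : V, Relation.EqvGen (fun a b => ∃ e, src e = a ∧ tgt e = b) u v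
  len_pos : ∀ e, 0 < len e
  len_eq_top_iff : ∀ e, len e = ⊤ ↔
    Nat.card {e' // src e' = tgt e} + Nat.card {e' // tgt e' = tgt e} = 1
  src_valence_ne_one : ∀ e,
    Nat.card {e' // src e' = src e} + Nat.card {e' // tgt e' = src e} ≠ 1

namespace TropicalCurve

noncomputable section

open Filter Topology
open scoped Classical

attribute [instance] TropicalCurve.fintypeV TropicalCurve.fintypeE

variable (C : TropicalCurve)

/-- Points of the compact curve: vertices, and interior points of edges, the latter given by their
distance `t` from the source of the edge. -/
inductive Pt (C : TropicalCurve) : Type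
  | vertex (v : C.V) : Pt C
  | inner (e : C.E) (t : ENNReal) (h0 : 0 < t) (h1 : t < C.len e) : Pt C

/-- The point of the edge `e` with coordinate `t ∈ [0, len e]`. -/
def pt (e : C.E) (t : ENNReal) : C.Pt :=
  if h0 : 0 < t then
    if h1 : t < C.len e then Pt.inner e t h0 h1 else Pt.vertex (C.tgt e)
  else Pt.vertex (C.src e)

/-! ### Tangent directions -/

/-- Outward tangent directions at a point: at a vertex, the edge ends there (a loop counts twice);
at an interior point of an edge, `true` (increasing coordinate) and `false` (decreasing). -/
def Dir : C.Pt → Type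
  | Pt.vertex v => {e : C.E // C.src e = v} ⊕ {e : C.E // C.tgt e = v}
  | Pt.inner _ _ _ _ => Bool

instance instFintypeDir : (p : C.Pt) → Fintype (C.Dir p)
  | Pt.vertex v =>
      (inferInstance : Fintype ({e : C.E // C.src e = v} ⊕ {e : C.E // C.tgt e = v}))
  | Pt.inner _ _ _ _ => (inferInstance : Fintype Bool)

variable {C}

/-- The edge along which a tangent direction points. -/
def Dir.edge : {p : C.Pt} → C.Dir p → C.E
  | Pt.vertex _, Sum.inl e => e.1
  | Pt.vertex _, Sum.inr e => e.1
  | Pt.inner e _ _ _, _ => e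

/-- The coordinate of the base point on that edge. -/
def Dir.coord : {p : C.Pt} → C.Dir p → ENNReal
  | Pt.vertex _, Sum.inl _ => 0
  | Pt.vertex _, Sum.inr e => C.len e.1
  | Pt.inner _ t _ _, _ => t

/-- Whether the coordinate of the edge increases along the direction. -/
def Dir.fwd : {p : C.Pt} → C.Dir p → Bool
  | Pt.vertex _, Sum.inl _ => true
  | Pt.vertex _, Sum.inr _ => false
  | Pt.inner _ _ _ _, b => b

/-- The sign `±1` of a direction relative to the coordinate of its edge. -/
def Dir.sgn {p : C.Pt} (ξ : C.Dir p) : ℝ := if ξ.fwd = true then 1 else -1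

/-- Coordinates of points of the edge that lie in direction `ξ` and tend to the base point. -/
def Dir.germ {p : C.Pt} (ξ : C.Dir p) : Filter ENNReal :=
  if ξ.fwd = true then 𝓝[>] ξ.coord else 𝓝[<] ξ.coord

variable (C)

/-- The valence of a point. -/
def valence (p : C.Pt) : ℕ := Fintype.card (C.Dir p)

/-- The points at infinity are the 1-valent vertices. -/
def AtInfinity (p : C.Pt) : Prop := C.valence p = 1

/-! ### Divisors and linear equivalence -/

/-- Divisors. -/
abbrev Div : Type := C.Pt →₀ ℤ

/-- The degree of a divisor. -/
def deg (D : C.Div) : ℤ := D.sum fun _ a => a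

/-- The canonical divisor `∑ (val p - 2) p`. -/
def canonical : C.Div :=
  Finsupp.ofSupportFinite (fun p => (C.valence p : ℤ) - 2) <| by
    refine (Set.finite_range (Pt.vertex : C.V → C.Pt)).subset ?_
    rintro (v | ⟨e, t, h0, h1⟩) hp
    · exact ⟨v, rfl⟩
    · exfalso
      apply hp
      have : C.valence (Pt.inner e t h0 h1) = 2 := Fintype.card_bool
      simp [this]

variable {C}

/-- Near the base point `p` in direction `ξ`, the function `f` is affine, and `m` is its derivative
along the unit vector `ξ` pointing away from `p`. It is continuous at `p` unless `p` is at infinity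
(coordinate `⊤`); there it may tend to `±∞`, and the value `f p` is irrelevant. -/
def HasSlope (f : C.Pt → ℝ) {p : C.Pt} (ξ : C.Dir p) (m : ℤ) : Prop :=
  ∃ c : ℝ, (∀ᶠ t in ξ.germ, f (C.pt ξ.edge t) = c + ξ.sgn * m * t.toReal) ∧
    (ξ.coord ≠ ⊤ → f p = c + ξ.sgn * m * ξ.coord.toReal)

/-- `f` is a piecewise linear function with integral slopes and `D` is its principal divisor
`(f) = ∑ₚ (∑_ξ ∂f(p)/∂ξ) p`. (As the curve is compact, one-sided affineness at all points forces
finitely many linear pieces.) -/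
def IsDivisorOf (f : C.Pt → ℝ) (D : C.Div) : Prop :=
  ∃ m : (p : C.Pt) → C.Dir p → ℤ,
    (∀ (p : C.Pt) (ξ : C.Dir p), HasSlope f ξ (m p ξ)) ∧ ∀ p, D p = ∑ ξ, m p ξ

theorem HasSlope.add {f g : C.Pt → ℝ} {p : C.Pt} {ξ : C.Dir p} {m n : ℤ}
    (hf : HasSlope f ξ m) (hg : HasSlope g ξ n) : HasSlope (f + g) ξ (m + n) := by
  obtain ⟨c, h1, h2⟩ := hf
  obtain ⟨d, h3, h4⟩ := hg
  refine ⟨c + d, ?_, fun h => ?_⟩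
  · filter_upwards [h1, h3] with t a b
    rw [Pi.add_apply, a, b]; push_cast; ring
  · rw [Pi.add_apply, h2 h, h4 h]; push_cast; ring

theorem HasSlope.neg {f : C.Pt → ℝ} {p : C.Pt} {ξ : C.Dir p} {m : ℤ}
    (hf : HasSlope f ξ m) : HasSlope (-f) ξ (-m) := by
  obtain ⟨c, h1, h2⟩ := hf
  refine ⟨-c, ?_, fun h => ?_⟩
  · filter_upwards [h1] with t a
    rw [Pi.neg_apply, a]; push_cast; ring
  · rw [Pi.neg_apply, h2 h]; push_cast; ring

variable (C)

/-- The group of principal divisors. -/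
def principal : AddSubgroup C.Div where
  carrier := {D | ∃ f, IsDivisorOf f D}
  zero_mem' := ⟨0, fun _ _ => 0, fun _ _ => ⟨0, by simp, by simp⟩, by simp⟩
  add_mem' := by
    rintro D D' ⟨f, m, h1, h2⟩ ⟨g, n, h3, h4⟩
    exact ⟨f + g, fun p ξ => m p ξ + n p ξ, fun p ξ => (h1 p ξ).add (h3 p ξ),
      fun p => by simp [h2, h4, Finset.sum_add_distrib]⟩
  neg_mem' := by
    rintro D ⟨f, m, h1, h2⟩
    exact ⟨-f, fun p ξ => -m p ξ, fun p ξ => (h1 p ξ).neg, fun p => by simp [h2]⟩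

/-- Divisors modulo linear equivalence. -/
abbrev Pic : Type := C.Div ⧸ C.principal

/-- The linear equivalence class of a divisor. -/
def cls (D : C.Div) : C.Pic := QuotientAddGroup.mk D

/-- A class that contains an effective divisor. -/
def IsEffective (a : C.Pic) : Prop := ∃ D : C.Div, (∀ p, 0 ≤ D p) ∧ C.cls D = a

/-! ### Cycles, 1-forms, Jacobian -/

/-- The boundary map on integral 1-chains. -/
def boundary : (C.E → ℤ) →ₗ[ℤ] (C.V → ℤ) :=
  Fintype.linearCombination ℤ fun e => Pi.single (C.tgt e) 1 - Pi.single (C.src e) 1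

/-- The circuit lattice. It plays two roles: it is the group `H₁(C, ℤ)` of integral cycles, and it
is the group of integral 1-forms, a form being given by its constant coefficient on each edge, with
the coefficients along the outward directions at each vertex summing to zero. -/
abbrev cycles : Submodule ℤ (C.E → ℤ) := LinearMap.ker C.boundary

/-- The genus is the first Betti number. -/
def genus : ℕ := Module.finrank ℤ C.cycles

/-- Linear functionals on integral 1-forms. -/
abbrev FormDual : Type := C.cycles →ₗ[ℤ] ℝ

/-- The functional that sends a 1-form to its coefficient on the edge `e`. -/
def coeff (e : C.E) : C.FormDual where
  toFun ω := (ω.1 e : ℝ)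
  map_add' := by intro a b; simp
  map_smul' := by intro n a; simp

/-- Integration of 1-forms over integral cycles. (Cycles and forms vanish on the edges of infinite
length, so the value of `toReal` at `⊤` does not matter.) -/
def period : C.cycles →+ C.FormDual where
  toFun c := ∑ e, ((c.1 e : ℝ) * (C.len e).toReal) • C.coeff e
  map_zero' := by simp
  map_add' := by intro a b; simp [add_mul, add_smul, Finset.sum_add_distrib]

/-- The Jacobian. -/
abbrev Jac : Type := C.FormDual ⧸ C.period.range

/-- The class of a functional in the Jacobian. -/
def toJac (x : C.FormDual) : C.Jac := QuotientAddGroup.mk x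

/-! ### Paths, distance, Abel-Jacobi map -/

/-- `IsPath p q φ L`: there is a path from `p` to `q`, a concatenation of segments of edges, along
which 1-forms have integral `φ`, and which has length `L`. -/
inductive IsPath : C.Pt → C.Pt → C.FormDual → ENNReal → Prop
  | nil (p : C.Pt) : IsPath p p 0 0
  | cons (e : C.E) (s t : ENNReal) (hs : s ≤ C.len e) (ht : t ≤ C.len e) {q : C.Pt}
      {φ : C.FormDual} {L : ENNReal} (h : IsPath (C.pt e t) q φ L) :
      IsPath (C.pt e s) q ((t.toReal - s.toReal) • C.coeff e + φ) ((t - s) + (s - t) + L)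

/-- The distance of two points: the infimum of the lengths of paths. -/
def dist (p q : C.Pt) : ENNReal := sInf {L | ∃ φ, C.IsPath p q φ L}

/-- The distance function `d_S` of a set of points. -/
def distSet (S : Set C.Pt) (q : C.Pt) : ENNReal := ⨅ p ∈ S, C.dist p q

theorem pt_zero (e : C.E) : C.pt e 0 = Pt.vertex (C.src e) := by simp [pt]

theorem pt_len (e : C.E) : C.pt e (C.len e) = Pt.vertex (C.tgt e) := by
  simp [pt, C.len_pos e]

theorem exists_path (p q : C.Pt) : ∃ φ L, C.IsPath p q φ L := by
  have trans : ∀ {a b c : C.Pt}, (∃ φ L, C.IsPath a b φ L) → (∃ φ L, C.IsPath b c φ L) →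
      ∃ φ L, C.IsPath a c φ L := by
    rintro a b c ⟨φ, L, h⟩ h'
    induction h with
    | nil p => exact h'
    | cons e s t hs ht h ih =>
      obtain ⟨ψ, M, hM⟩ := ih h'
      exact ⟨_, _, IsPath.cons e s t hs ht hM⟩
  have seg : ∀ (e : C.E) (s t : ENNReal), s ≤ C.len e → t ≤ C.len e →
      ∃ φ L, C.IsPath (C.pt e s) (C.pt e t) φ L := fun e s t hs ht =>
    ⟨_, _, IsPath.cons e s t hs ht (IsPath.nil _)⟩
  have vv : ∀ u v : C.V, (∃ φ L, C.IsPath (Pt.vertex u) (Pt.vertex v) φ L) ∧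
      ∃ φ L, C.IsPath (Pt.vertex v) (Pt.vertex u) φ L := by
    intro u v
    induction C.connected u v with
    | rel a b h =>
      obtain ⟨e, rfl, rfl⟩ := h
      rw [← pt_zero, ← pt_len]
      exact ⟨seg e _ _ zero_le le_rfl, seg e _ _ le_rfl zero_le⟩
    | refl a => exact ⟨⟨_, _, IsPath.nil _⟩, ⟨_, _, IsPath.nil _⟩⟩
    | symm a b _ ih => exact ih.symm
    | trans a b c _ _ h1 h2 => exact ⟨trans h1.1 h2.1, trans h2.2 h1.2⟩
  have pv : ∀ p : C.Pt, ∃ v, (∃ φ L, C.IsPath p (Pt.vertex v) φ L) ∧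
      ∃ φ L, C.IsPath (Pt.vertex v) p φ L := by
    rintro (v | ⟨e, t, h0, h1⟩)
    · exact ⟨v, vv v v⟩
    · have : Pt.inner e t h0 h1 = C.pt e t := by simp [pt, h0, h1]
      refine ⟨C.src e, ?_⟩
      rw [this, ← pt_zero]
      exact ⟨seg e _ _ h1.le zero_le, seg e _ _ zero_le h1.le⟩
  obtain ⟨u, hu, -⟩ := pv p
  obtain ⟨v, -, hv⟩ := pv q
  exact trans (trans hu (vv u v).1) hv

/-- Integration of 1-forms along a chosen path from `p₀` to `p`. -/
def lift (p₀ p : C.Pt) : C.FormDual := Classical.choose (C.exists_path p₀ p)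

/-- The Abel-Jacobi map on divisors, with base point `p₀`. -/
def abelJacobi (p₀ : C.Pt) (D : C.Div) : C.Jac := D.sum fun p a => a • C.toJac (C.lift p₀ p)

/-! ### Theta function and theta characteristics -/

/-- The theta function `Θ(x) = max_λ (Q(λ, x) - Q(λ, λ) / 2)`. The form `Q` is the one for which
`Q(λ, λ)` is the length of every simple cycle `λ`; for the cycle `c` and any functional `x` one has
`Q(c, x) = x c`, with `c` regarded as a 1-form. -/
def theta (x : C.FormDual) : ℝ := ⨆ c : C.cycles, (x c - 1 / 2 * C.period c c)

/-- `D` is the pull-back to the curve, under the Abel-Jacobi map with base point `p₀`, of the theta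
divisor translated by the class of `l`: locally it is the divisor of `p ↦ Θ (μ p - l)`, where `μ p`
is lifted from the Jacobian to functionals. -/
def IsThetaPullback (p₀ : C.Pt) (l : C.FormDual) (D : C.Div) : Prop :=
  ∃ m : (p : C.Pt) → C.Dir p → ℤ,
    (∀ (p : C.Pt) (ξ : C.Dir p), HasDerivWithinAt
      (fun t : ℝ => C.theta (C.lift p₀ p - l + (t * ξ.sgn) • C.coeff ξ.edge))
      (m p ξ : ℝ) (Set.Ici 0) 0) ∧
    ∀ p, D p = ∑ ξ, m p ξ

/-- `κ` is a constant for which Jacobi inversion `μ(D_λ) + κ = λ` holds for all `λ`, where `D_λ` is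
the pull-back of the theta divisor translated by `λ`. -/
def IsRiemannConstant (p₀ : C.Pt) (κ : C.Jac) : Prop :=
  ∀ l : C.FormDual, ∃ D : C.Div, C.IsThetaPullback p₀ l D ∧ C.abelJacobi p₀ D + κ = C.toJac l

/-- Theta characteristics: classes of degree `g - 1` whose double is the canonical class. -/
def IsThetaChar (a : C.Pic) : Prop :=
  (∃ D : C.Div, C.deg D = (C.genus : ℤ) - 1 ∧ C.cls D = a) ∧ 2 • a = C.cls C.canonical

/-! ### Gradient orientation of a distance function -/

variable {C}

/-- The direction `ξ` points along the gradient flow of `d_S` (outgoing at its base point). -/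
def Outgoing (S : Set C.Pt) {p : C.Pt} (ξ : C.Dir p) : Prop :=
  ∀ᶠ t in ξ.germ, C.distSet S p < C.distSet S (C.pt ξ.edge t)

/-- The direction `ξ` points against the gradient flow of `d_S` (incoming at its base point). -/
def Incoming (S : Set C.Pt) {p : C.Pt} (ξ : C.Dir p) : Prop :=
  ∀ᶠ t in ξ.germ, C.distSet S (C.pt ξ.edge t) < C.distSet S p

variable (C)

/-- The number of outgoing edges at `p`. -/
def valPlus (S : Set C.Pt) (p : C.Pt) : ℕ := Nat.card {ξ : C.Dir p // Outgoing S ξ}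

/-- The number of incoming edges at `p`. -/
def valMinus (S : Set C.Pt) (p : C.Pt) : ℕ := Nat.card {ξ : C.Dir p // Incoming S ξ}

end

end TropicalCurve

/-! Everything rests on one fact: `d_S` has slope `1` or `-1` in every tangent direction, since
along an edge it is a minimum of finitely many functions of slope `±1`. Summing `2·[incoming] = 1 -
slope` and `2·[outgoing] = 1 + slope` over the directions at a point gives `2 K_S^∓ = K ∓ (d_S)`.
For two sets `S`, `S'` all slopes of `d_S - d_{S'}` are even, so half of this function is PL with
integral slopes and joins the divisors of `S` and `S'`. Thus there is one class `K₀`, and `2 K₀ =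
[K]` (`cls_Kminus_eq`, `two_smul_cls`).

`K₀` is not effective. If `D = K_S^+ + (f) ≥ 0`, take a point where `f` is maximal and, among those,
`d_S` is maximal. There `f` has slope at most `0` in each direction and at most `-1` in outgoing
ones, so `D ≤ -1` at that point.

`K₀` is the only such theta characteristic. If `2D - 2K_S^- = (f)`, the parity of the slope of `f`
is constant along each edge. If no edge is odd, `f / 2` shows `D ∼ K_S^-`. Otherwise let `S'` be the
set of ends of the odd edges; a correction of `f` by distance functions makes all slopes even, and
its half moves `D` to a divisor that is `K_{S'}^-` off the odd edges, zero inside them, and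
nonnegative on `S'`. So `D` is equivalent to an effective divisor (`unique_thetaChar`).

For the Riemann constant, `abelJacobi_eq` computes the Abel-Jacobi image of the divisor of a
multivalued PL function from its increments along the edges and its jumps of slope between branches.
It is used for principal divisors (no jumps), for `K_S^-`, and for the pull-back of `Θ`. In the last
case the jumps come from the quasi-periodicity `theta_add_period`, and the translation `l`
contributes exactly `l`, by `Frame.sum_coeff`. Hence `μ(D_l) - l` is a constant, `riemannLift`.
Completing squares identifies this constant modulo periods with `μ(K_S^-)`; so `κ = -μ(K₀)`. The
degree `g - 1 = |E| - |V|` is the Euler characteristic formula `genus_add_card`. -/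

namespace TropicalCurve

noncomputable section

open Filter Topology
open scoped Classical

section

/-! ### Piecewise linear functions of one real variable -/

/-- The function `φ` is affine near `x` in the direction `σ = ±1`, with slope `m` along it. -/
def Slope (φ : ℝ → ℝ) (x σ m : ℝ) : Prop :=
  ∀ᶠ h in 𝓝[>] (0 : ℝ), φ (x + σ * h) = φ x + m * h

theorem Slope.unique {φ : ℝ → ℝ} {x σ m n : ℝ} (h1 : Slope φ x σ m) (h2 : Slope φ x σ n) :
    m = n := by
  obtain ⟨h, ⟨a, b⟩, hpos⟩ := ((h1.and h2).and self_mem_nhdsWithin).exists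
  have hpos : 0 < h := hpos
  have : m * h = n * h := by linarith
  exact mul_right_cancel₀ hpos.ne' this

theorem Slope.sub {φ ψ : ℝ → ℝ} {x σ m n : ℝ} (h1 : Slope φ x σ m) (h2 : Slope ψ x σ n) :
    Slope (fun y => φ y - ψ y) x σ (m - n) := by
  filter_upwards [h1, h2] with h a b
  rw [a, b]; ring

theorem Slope.const_mul {φ : ℝ → ℝ} {x σ m : ℝ} (k : ℝ) (h1 : Slope φ x σ m) :
    Slope (fun y => k * φ y) x σ (k * m) := by
  filter_upwards [h1] with h a
  rw [a]; ring

theorem Slope.sum {ι : Type*} (T : Finset ι) {φ : ι → ℝ → ℝ} {x σ : ℝ} {m : ι → ℝ}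
    (h1 : ∀ i ∈ T, Slope (φ i) x σ (m i)) :
    Slope (fun y => ∑ i ∈ T, φ i y) x σ (∑ i ∈ T, m i) := by
  have : ∀ᶠ h in 𝓝[>] (0 : ℝ), ∀ i ∈ T, φ i (x + σ * h) = φ i x + m i * h :=
    (Filter.eventually_all_finset T).2 h1
  filter_upwards [this] with h a
  rw [Finset.sum_congr rfl a, Finset.sum_add_distrib, Finset.sum_mul]

theorem eventually_right_iff {x : ℝ} {P : ℝ → Prop} :
    (∀ᶠ h in 𝓝[>] (0 : ℝ), P (x + h)) ↔ ∀ᶠ y in 𝓝[>] x, P y := by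
  have : 𝓝[>] x = map (fun h => x + h) (𝓝[>] (0 : ℝ)) := by simp
  rw [this, eventually_map]

theorem eventually_left_iff {x : ℝ} {P : ℝ → Prop} :
    (∀ᶠ h in 𝓝[>] (0 : ℝ), P (x - h)) ↔ ∀ᶠ y in 𝓝[<] x, P y := by
  have : 𝓝[<] x = map (fun h => x - h) (𝓝[>] (0 : ℝ)) := by simp
  rw [this, eventually_map]

theorem slope_one_iff {φ : ℝ → ℝ} {x m : ℝ} :
    Slope φ x 1 m ↔ ∀ᶠ y in 𝓝[>] x, φ y = φ x + m * (y - x) := by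
  rw [← eventually_right_iff, Slope]; simp

theorem slope_neg_one_iff {φ : ℝ → ℝ} {x m : ℝ} :
    Slope φ x (-1) m ↔ ∀ᶠ y in 𝓝[<] x, φ y = φ x + m * (x - y) := by
  rw [← eventually_left_iff, Slope]; simp [sub_eq_add_neg]

theorem Slope.continuousWithinAt_right {φ : ℝ → ℝ} {x m : ℝ} (h : Slope φ x 1 m) :
    ContinuousWithinAt φ (Set.Ioi x) x := by
  have h1 := slope_one_iff.1 h
  have : ContinuousWithinAt (fun y => φ x + m * (y - x)) (Set.Ioi x) x := by fun_prop
  exact this.congr_of_eventuallyEq h1 (by simp)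

theorem Slope.continuousWithinAt_left {φ : ℝ → ℝ} {x m : ℝ} (h : Slope φ x (-1) m) :
    ContinuousWithinAt φ (Set.Iio x) x := by
  have h1 := slope_neg_one_iff.1 h
  have : ContinuousWithinAt (fun y => φ x + m * (x - y)) (Set.Iio x) x := by fun_prop
  exact this.congr_of_eventuallyEq h1 (by simp)

theorem continuousOn_of_slope {φ : ℝ → ℝ} {a b : ℝ}
    (hp : ∀ x ∈ Set.Ico a b, ∃ m, Slope φ x 1 m) (hm : ∀ x ∈ Set.Ioc a b, ∃ m, Slope φ x (-1) m) :
    ContinuousOn φ (Set.Icc a b) := by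
  intro x hx
  have h1 : ContinuousWithinAt φ (Set.Ioi x ∩ Set.Icc a b) x := by
    by_cases h : x < b
    · obtain ⟨m, hm⟩ := hp x ⟨hx.1, h⟩
      exact hm.continuousWithinAt_right.mono Set.inter_subset_left
    · have : Set.Ioi x ∩ Set.Icc a b = ∅ := by
        ext y; simp only [Set.mem_inter_iff, Set.mem_Ioi, Set.mem_Icc, Set.mem_empty_iff_false,
          iff_false]
        rintro ⟨h1, h2, h3⟩; linarith
      rw [this]; simp [ContinuousWithinAt]
  have h2 : ContinuousWithinAt φ (Set.Iio x ∩ Set.Icc a b) x := by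
    by_cases h : a < x
    · obtain ⟨m, hm⟩ := hm x ⟨h, hx.2⟩
      exact hm.continuousWithinAt_left.mono Set.inter_subset_left
    · have : Set.Iio x ∩ Set.Icc a b = ∅ := by
        ext y; simp only [Set.mem_inter_iff, Set.mem_Iio, Set.mem_Icc, Set.mem_empty_iff_false,
          iff_false]
        rintro ⟨h1, h2, h3⟩; linarith
      rw [this]; simp [ContinuousWithinAt]
  have h3 := (h1.union h2).insert
  refine h3.mono fun y hy => ?_
  rcases lt_trichotomy y x with h | h | h
  · exact Or.inr (Or.inr ⟨h, hy⟩)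
  · exact Or.inl h
  · exact Or.inr (Or.inl ⟨h, hy⟩)

/-- Two affine functions that agree on a left germ are equal. -/
theorem affine_eq_of_eventually_left {x c d m n : ℝ}
    (h : ∀ᶠ y in 𝓝[<] x, c + m * (x - y) = d + n * (x - y)) : c = d ∧ m = n := by
  obtain ⟨l, hl, hl'⟩ := mem_nhdsLT_iff_exists_Ioo_subset.1 h
  have hl : l < x := hl
  have h1 := hl' (show (l + 2 * x) / 3 ∈ Set.Ioo l x from ⟨by linarith, by linarith⟩)
  have h2 := hl' (show (l + x) / 2 ∈ Set.Ioo l x from ⟨by linarith, by linarith⟩)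
  simp only [Set.mem_ofPred_eq] at h1 h2
  have h3 : (m - n) * (x - l) = 0 := by nlinarith
  have h4 : m = n := by
    rcases mul_eq_zero.1 h3 with h | h <;> linarith
  subst h4
  exact ⟨by linarith, rfl⟩

/-- A function whose slopes in opposite directions cancel is affine. -/
theorem affine_of_slopes_cancel {φ : ℝ → ℝ} {a b : ℝ} (hab : a < b) {mp mm : ℝ → ℝ}
    (hp : ∀ x ∈ Set.Ico a b, Slope φ x 1 (mp x)) (hm : ∀ x ∈ Set.Ioc a b, Slope φ x (-1) (mm x))
    (h0 : ∀ x ∈ Set.Ioo a b, mp x + mm x = 0) :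
    φ b = φ a + mp a * (b - a) ∧ mm b = -mp a := by
  -- Once `φ` is affine strictly before `x`, comparison of left germs recovers both the value and
  -- the left slope at `x`.
  have key : ∀ x ∈ Set.Ioc a b, (∀ y, a ≤ y → y < x → φ y = φ a + mp a * (y - a)) →
      φ x = φ a + mp a * (x - a) ∧ mm x = -mp a := by
    intro x hx h
    have h1 := slope_neg_one_iff.1 (hm x hx)
    have h2 : ∀ᶠ y in 𝓝[<] x, a < y := by
      have := Ioo_mem_nhdsLT hx.1
      filter_upwards [this] with y hy using hy.1
    have h3 : ∀ᶠ y in 𝓝[<] x,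
        φ x + mm x * (x - y) = (φ a + mp a * (x - a)) + (-mp a) * (x - y) := by
      filter_upwards [h1, h2, self_mem_nhdsWithin] with y h1 h2 h4
      rw [← h1, h y h2.le h4]; ring
    exact affine_eq_of_eventually_left h3
  -- Real induction on `[a, b]`. Because of the strict inequality `y < x`, the set `s` is closed
  -- without any continuity of `φ`.
  let s : Set ℝ := {x | ∀ y, a ≤ y → y < x → φ y = φ a + mp a * (y - a)}
  have hs : IsClosed s := by
    have : s = ⋂ y : ℝ, {x | a ≤ y → y < x → φ y = φ a + mp a * (y - a)} := by
      ext x; simp [s]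
    rw [this]
    refine isClosed_iInter fun y => ?_
    by_cases h : a ≤ y ∧ φ y ≠ φ a + mp a * (y - a)
    · have : {x | a ≤ y → y < x → φ y = φ a + mp a * (y - a)} = Set.Iic y := by
        ext x; simp [h.1, h.2]
      rw [this]; exact isClosed_Iic
    · have : {x | a ≤ y → y < x → φ y = φ a + mp a * (y - a)} = Set.univ := by
        ext x; simp only [Set.mem_ofPred_eq, Set.mem_univ, iff_true]
        intro h1 _; by_contra h2; exact h ⟨h1, h2⟩
      rw [this]; exact isClosed_univ
  have hsub : Set.Icc a b ⊆ s := by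
    refine IsClosed.Icc_subset_of_forall_mem_nhdsWithin (hs.inter isClosed_Icc) ?_ ?_
    · intro y h1 h2; exact absurd h1 (not_le.2 h2)
    · rintro x ⟨hx, hx'⟩
      have hval : φ x = φ a + mp a * (x - a) ∧ mp x = mp a := by
        rcases eq_or_lt_of_le hx'.1 with h | h
        · subst h; simp
        · obtain ⟨h1, h2⟩ := key x ⟨h, hx'.2.le⟩ hx
          have := h0 x ⟨h, hx'.2⟩
          exact ⟨h1, by linarith⟩
      obtain ⟨u, hu, hu'⟩ := mem_nhdsGT_iff_exists_Ioo_subset.1 (slope_one_iff.1 (hp x hx'))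
      filter_upwards [Ioo_mem_nhdsGT (show x < u from hu)] with z hz y h1 h2
      rcases lt_trichotomy y x with h | h | h
      · exact hx y h1 h
      · rw [h]; exact hval.1
      · have := hu' (show y ∈ Set.Ioo x u from ⟨h, h2.trans hz.2⟩)
        simp only [Set.mem_ofPred_eq] at this
        rw [this, hval.1, hval.2]; ring
  exact key b ⟨hab, le_rfl⟩ (hsub ⟨hab.le, le_rfl⟩)

/-! ### Break points and summation by parts -/

theorem slope_hinge_right (s x : ℝ) :
    Slope (fun y => max (y - s) 0) x 1 (if s ≤ x then 1 else 0) := by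
  rw [slope_one_iff]
  split_ifs with h
  · filter_upwards [self_mem_nhdsWithin] with y hy
    have hy : x < y := hy
    rw [max_eq_left (by linarith), max_eq_left (by linarith)]; ring
  · filter_upwards [Ioo_mem_nhdsGT (not_le.1 h)] with y hy
    rw [max_eq_right (by linarith [hy.2]), max_eq_right (by linarith)]; ring

theorem slope_hinge_left (s x : ℝ) :
    Slope (fun y => max (y - s) 0) x (-1) (if s < x then -1 else 0) := by
  rw [slope_neg_one_iff]
  split_ifs with h
  · filter_upwards [Ioo_mem_nhdsLT h] with y hy
    rw [max_eq_left (by linarith [hy.1]), max_eq_left (by linarith)]; ring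
  · filter_upwards [self_mem_nhdsWithin] with y hy
    have hy : y < x := hy
    rw [max_eq_right (by linarith), max_eq_right (by linarith)]; ring

/-- Summation by parts for a piecewise linear function on an interval. -/
theorem sum_slopes {φ : ℝ → ℝ} {a b : ℝ} (hab : a < b) {mp mm : ℝ → ℝ}
    (hp : ∀ x ∈ Set.Ico a b, Slope φ x 1 (mp x)) (hm : ∀ x ∈ Set.Ioc a b, Slope φ x (-1) (mm x))
    (T : Finset ℝ) (hT : ∀ x ∈ T, x ∈ Set.Ioo a b)
    (h0 : ∀ x ∈ Set.Ioo a b, x ∉ T → mp x + mm x = 0) :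
    ∑ x ∈ T, (mp x + mm x) = -mm b - mp a ∧
    ∑ x ∈ T, x * (mp x + mm x) = -(b * mm b) - a * mp a - (φ b - φ a) := by
  let j : ℝ → ℝ := fun s => mp s + mm s
  -- Subtracting at each break point a hinge with the same jump of slope leaves an affine function,
  -- for which both identities are immediate.
  let ψ : ℝ → ℝ := fun y => φ y - ∑ s ∈ T, j s * max (y - s) 0
  have hp' : ∀ x ∈ Set.Ico a b,
      Slope ψ x 1 (mp x - ∑ s ∈ T, j s * (if s ≤ x then 1 else 0)) := fun x hx =>
    (hp x hx).sub (Slope.sum T fun s _ => (slope_hinge_right s x).const_mul (j s))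
  have hm' : ∀ x ∈ Set.Ioc a b,
      Slope ψ x (-1) (mm x - ∑ s ∈ T, j s * (if s < x then -1 else 0)) := fun x hx =>
    (hm x hx).sub (Slope.sum T fun s _ => (slope_hinge_left s x).const_mul (j s))
  have h0' : ∀ x ∈ Set.Ioo a b, (mp x - ∑ s ∈ T, j s * (if s ≤ x then 1 else 0)) +
      (mm x - ∑ s ∈ T, j s * (if s < x then -1 else 0)) = 0 := by
    intro x hx
    have h1 : ∑ s ∈ T, j s * (if s ≤ x then (1 : ℝ) else 0) +
        ∑ s ∈ T, j s * (if s < x then (-1 : ℝ) else 0) = if x ∈ T then j x else 0 := by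
      rw [← Finset.sum_add_distrib, ← Finset.sum_ite_eq T x j]
      refine Finset.sum_congr rfl fun s _ => ?_
      rcases lt_trichotomy s x with h | h | h
      · simp [h, h.le, h.ne']
      · simp [h]
      · simp [h.not_ge, h.not_gt, h.ne]
    by_cases hx' : x ∈ T
    · rw [if_pos hx'] at h1
      simp only [j] at h1 ⊢; linarith
    · rw [if_neg hx'] at h1
      have := h0 x hx hx'
      linarith
  obtain ⟨h1, h2⟩ := affine_of_slopes_cancel hab hp' hm' h0'
  have e1 : ∑ s ∈ T, j s * (if s ≤ a then (1 : ℝ) else 0) = 0 :=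
    Finset.sum_eq_zero fun s hs => by simp [(hT s hs).1.not_ge]
  have e2 : ∑ s ∈ T, j s * (if s < b then (-1 : ℝ) else 0) = -∑ s ∈ T, j s := by
    rw [← Finset.sum_neg_distrib]
    exact Finset.sum_congr rfl fun s hs => by simp [(hT s hs).2]
  have e3 : ∑ s ∈ T, j s * max (a - s) 0 = 0 :=
    Finset.sum_eq_zero fun s hs => by
      rw [max_eq_right (by linarith [(hT s hs).1]), mul_zero]
  have e4 : ∑ s ∈ T, j s * max (b - s) 0 = b * ∑ s ∈ T, j s - ∑ s ∈ T, s * j s := by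
    rw [Finset.mul_sum, ← Finset.sum_sub_distrib]
    exact Finset.sum_congr rfl fun s hs => by
      rw [max_eq_left (by linarith [(hT s hs).2])]; ring
  simp only [ψ] at h1
  rw [e1] at h1 h2
  rw [e2] at h2
  rw [e3, e4] at h1
  have h3 : ∑ s ∈ T, j s = -mm b - mp a := by linarith
  refine ⟨h3, ?_⟩
  change ∑ s ∈ T, s * j s = _
  rw [h3] at h1
  linarith

/-- A piecewise linear function on a compact interval has finitely many break points. -/
theorem finite_breaks {φ : ℝ → ℝ} {a b : ℝ} {mp mm : ℝ → ℝ}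
    (hp : ∀ x ∈ Set.Ico a b, Slope φ x 1 (mp x)) (hm : ∀ x ∈ Set.Ioc a b, Slope φ x (-1) (mm x)) :
    {x ∈ Set.Ioo a b | mp x + mm x ≠ 0}.Finite := by
  by_contra hinf
  -- Infinitely many breaks would accumulate at some `x`, but `φ` is affine on a one-sided
  -- neighbourhood of `x` on each side.
  obtain ⟨x, hx, hacc⟩ := Set.Infinite.exists_accPt_of_subset_isCompact hinf
    (isCompact_Icc (a := a) (b := b)) (fun y hy => Set.Ioo_subset_Icc_self hy.1)
  have aff : ∀ y ∈ Set.Ioo a b, ∀ c m : ℝ, (∀ᶠ z in 𝓝 y, φ z = c + m * z) → mp y + mm y = 0 := by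
    intro y hy c m h
    have hy0 := h.self_of_nhds
    have h1 : Slope φ y 1 m := by
      rw [slope_one_iff]
      filter_upwards [h.filter_mono nhdsWithin_le_nhds] with z hz
      rw [hz, hy0]; ring
    have h2 : Slope φ y (-1) (-m) := by
      rw [slope_neg_one_iff]
      filter_upwards [h.filter_mono nhdsWithin_le_nhds] with z hz
      rw [hz, hy0]; ring
    rw [(hp y ⟨hy.1.le, hy.2⟩).unique h1, (hm y ⟨hy.1, hy.2.le⟩).unique h2]; ring
  have h1 : ∀ᶠ y in 𝓝[>] x, ¬ (y ∈ Set.Ioo a b ∧ mp y + mm y ≠ 0) := by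
    by_cases hxb : x < b
    · have := slope_one_iff.1 (hp x ⟨hx.1, hxb⟩)
      filter_upwards [eventually_eventually_nhdsWithin.2 this, self_mem_nhdsWithin]
        with y hy hy' ⟨h2, h3⟩
      rw [(isOpen_Ioi.nhdsWithin_eq (show y ∈ Set.Ioi x from hy'))] at hy
      refine h3 (aff y h2 (φ x - mp x * x) (mp x) ?_)
      filter_upwards [hy] with z hz
      rw [hz]; ring
    · filter_upwards [self_mem_nhdsWithin] with y hy h
      have hy : x < y := hy
      linarith [h.1.2]
  have h2 : ∀ᶠ y in 𝓝[<] x, ¬ (y ∈ Set.Ioo a b ∧ mp y + mm y ≠ 0) := by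
    by_cases hxa : a < x
    · have := slope_neg_one_iff.1 (hm x ⟨hxa, hx.2⟩)
      filter_upwards [eventually_eventually_nhdsWithin.2 this, self_mem_nhdsWithin]
        with y hy hy' ⟨h2, h3⟩
      rw [(isOpen_Iio.nhdsWithin_eq (show y ∈ Set.Iio x from hy'))] at hy
      refine h3 (aff y h2 (φ x + mm x * x) (-mm x) ?_)
      filter_upwards [hy] with z hz
      rw [hz]; ring
    · filter_upwards [self_mem_nhdsWithin] with y hy h
      have hy : y < x := hy
      linarith [h.1.1]
  have h3 : ∀ᶠ y in 𝓝[≠] x, ¬ (y ∈ Set.Ioo a b ∧ mp y + mm y ≠ 0) := by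
    rw [← nhdsLT_sup_nhdsGT]; exact eventually_sup.2 ⟨h2, h1⟩
  rw [accPt_iff_frequently_nhdsNE] at hacc
  exact hacc h3

/-- Among finitely many germs that are pairwise comparable there is a smallest one. -/
theorem exists_eventually_le {ι α : Type*} {F : Filter α} (G : Finset ι) (hG : G.Nonempty)
    (f : ι → α → ℝ)
    (h : ∀ i ∈ G, ∀ j ∈ G, (∀ᶠ x in F, f i x ≤ f j x) ∨ ∀ᶠ x in F, f j x ≤ f i x) :
    ∃ i ∈ G, ∀ᶠ x in F, ∀ j ∈ G, f i x ≤ f j x := by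
  induction hG using Finset.Nonempty.cons_induction with
  | singleton a => exact ⟨a, by simp, by simp⟩
  | cons a s ha hs ih =>
    obtain ⟨i, hi, hi'⟩ := ih fun i hi j hj => h i (by simp [hi]) j (by simp [hj])
    rcases h i (by simp [hi]) a (by simp) with h1 | h1
    · refine ⟨i, by simp [hi], ?_⟩
      filter_upwards [hi', h1] with x h2 h3 j hj
      rcases Finset.mem_cons.1 hj with rfl | hj
      · exact h3
      · exact h2 j hj
    · refine ⟨a, by simp, ?_⟩
      filter_upwards [hi', h1] with x h2 h3 j hj
      rcases Finset.mem_cons.1 hj with rfl | hj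
      · exact le_rfl
      · exact h3.trans (h2 j hj)

/-- If the values at `x` differ, they decide the comparison of the germs by continuity; if they
agree, the slopes decide. -/
theorem Slope.eventually_le_or {φ ψ : ℝ → ℝ} {x σ m n : ℝ} (h1 : Slope φ x σ m)
    (h2 : Slope ψ x σ n) : (∀ᶠ h in 𝓝[>] (0 : ℝ), φ (x + σ * h) ≤ ψ (x + σ * h)) ∨
      ∀ᶠ h in 𝓝[>] (0 : ℝ), ψ (x + σ * h) ≤ φ (x + σ * h) := by
  have key : ∀ c d m n : ℝ, c < d → ∀ᶠ h in 𝓝[>] (0 : ℝ), c + m * h ≤ d + n * h := by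
    intro c d m n hcd
    have : ∀ᶠ h in 𝓝 (0 : ℝ), c + m * h < d + n * h :=
      ContinuousAt.eventually_lt (by fun_prop) (by fun_prop) (by simpa using hcd)
    filter_upwards [this.filter_mono nhdsWithin_le_nhds] with h hh using hh.le
  rcases lt_trichotomy (φ x) (ψ x) with h | h | h
  · left
    filter_upwards [h1, h2, key _ _ m n h] with t a b c
    rw [a, b]; exact c
  · rcases le_total m n with hmn | hmn
    · left
      filter_upwards [h1, h2, self_mem_nhdsWithin] with t a b c
      rw [a, b, h]
      have : m * t ≤ n * t := mul_le_mul_of_nonneg_right hmn (le_of_lt c)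
      linarith
    · right
      filter_upwards [h1, h2, self_mem_nhdsWithin] with t a b c
      rw [a, b, h]
      have : n * t ≤ m * t := mul_le_mul_of_nonneg_right hmn (le_of_lt c)
      linarith
  · right
    filter_upwards [h1, h2, key _ _ n m h] with t a b c
    rw [a, b]; exact c

/-- A minimum of finitely many functions with slopes has one of these slopes. -/
theorem exists_slope_of_min {ι : Type*} (G : Finset ι) (hG : G.Nonempty) {f : ι → ℝ → ℝ}
    {φ : ℝ → ℝ} {x σ : ℝ} {m : ι → ℝ} (hf : ∀ i ∈ G, Slope (f i) x σ (m i))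
    (hle : ∀ᶠ h in 𝓝[≥] (0 : ℝ), ∀ i ∈ G, φ (x + σ * h) ≤ f i (x + σ * h))
    (hex : ∀ᶠ h in 𝓝[≥] (0 : ℝ), ∃ i ∈ G, φ (x + σ * h) = f i (x + σ * h)) :
    ∃ i ∈ G, Slope φ x σ (m i) := by
  have hmono : 𝓝[>] (0 : ℝ) ≤ 𝓝[≥] (0 : ℝ) := nhdsWithin_mono _ Set.Ioi_subset_Ici_self
  obtain ⟨i, hi, hmin⟩ := exists_eventually_le (F := 𝓝[>] (0 : ℝ)) G hG
    (fun i h => f i (x + σ * h)) fun i hi j hj => (hf i hi).eventually_le_or (hf j hj)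
  have h1 : ∀ᶠ h in 𝓝[>] (0 : ℝ), φ (x + σ * h) = f i (x + σ * h) := by
    filter_upwards [hle.filter_mono hmono, hex.filter_mono hmono, hmin] with h a ⟨j, hj, b⟩ c
    exact le_antisymm (a i hi) (b ▸ c j hj)
  -- The filter `𝓝[≥] 0` includes `h = 0`. This pins the value at `x`, so that the function minimal
  -- on the open germ also attains `φ x`.
  have hle0 : ∀ i ∈ G, φ x ≤ f i x := by
    simpa using hle.self_of_nhdsWithin (by simp)
  have hex0 : ∃ i ∈ G, φ x = f i x := by
    simpa using hex.self_of_nhdsWithin (by simp)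
  have h2 : φ x = f i x := by
    refine le_antisymm (hle0 i hi) ?_
    obtain ⟨j, hj, hj'⟩ := hex0
    rw [hj']
    have t : ∀ k ∈ G, Tendsto (fun h => f k (x + σ * h)) (𝓝[>] (0 : ℝ)) (𝓝 (f k x)) := by
      intro k hk
      have : Tendsto (fun h : ℝ => f k x + m k * h) (𝓝[>] (0 : ℝ)) (𝓝 (f k x + m k * 0)) :=
        (Continuous.tendsto (by fun_prop) 0).mono_left nhdsWithin_le_nhds
      rw [mul_zero, add_zero] at this
      refine this.congr' ?_
      filter_upwards [hf k hk] with h hh using hh.symm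
    exact le_of_tendsto_of_tendsto (t i hi) (t j hj) (hmin.mono fun h hh => hh j hj)
  refine ⟨i, hi, ?_⟩
  filter_upwards [h1, hf i hi] with h a b
  rw [a, b, h2]

end

section

/-! ### Germs of directions in real coordinates -/

theorem eventually_nhdsGT_ofReal {x : ℝ} (hx : 0 ≤ x) {P : ENNReal → Prop} :
    (∀ᶠ t in 𝓝[>] (ENNReal.ofReal x), P t) ↔ ∀ᶠ y in 𝓝[>] x, P (ENNReal.ofReal y) := by
  constructor
  · intro h
    have : Tendsto ENNReal.ofReal (𝓝[>] x) (𝓝[>] (ENNReal.ofReal x)) := by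
      refine tendsto_nhdsWithin_iff.2
        ⟨(ENNReal.continuous_ofReal.tendsto x).mono_left nhdsWithin_le_nhds, ?_⟩
      filter_upwards [self_mem_nhdsWithin] with y hy
      exact (ENNReal.ofReal_lt_ofReal_iff (lt_of_le_of_lt hx hy)).2 hy
    exact this.eventually h
  · intro h
    have h1 : ∀ᶠ t in 𝓝[>] (ENNReal.ofReal x), t < ⊤ :=
      nhdsWithin_le_nhds (Iio_mem_nhds ENNReal.ofReal_lt_top)
    have : Tendsto ENNReal.toReal (𝓝[>] (ENNReal.ofReal x)) (𝓝[>] x) := by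
      refine tendsto_nhdsWithin_iff.2 ⟨?_, ?_⟩
      · have := ENNReal.tendsto_toReal (ENNReal.ofReal_ne_top (r := x))
        rw [ENNReal.toReal_ofReal hx] at this
        exact this.mono_left nhdsWithin_le_nhds
      · filter_upwards [self_mem_nhdsWithin, h1] with t ht ht'
        exact (ENNReal.ofReal_lt_iff_lt_toReal hx ht'.ne).1 ht
    filter_upwards [this.eventually h, h1] with t ht ht'
    rwa [ENNReal.ofReal_toReal ht'.ne] at ht

theorem eventually_nhdsLT_ofReal {x : ℝ} (hx : 0 < x) {P : ENNReal → Prop} :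
    (∀ᶠ t in 𝓝[<] (ENNReal.ofReal x), P t) ↔ ∀ᶠ y in 𝓝[<] x, P (ENNReal.ofReal y) := by
  constructor
  · intro h
    have : Tendsto ENNReal.ofReal (𝓝[<] x) (𝓝[<] (ENNReal.ofReal x)) := by
      refine tendsto_nhdsWithin_iff.2
        ⟨(ENNReal.continuous_ofReal.tendsto x).mono_left nhdsWithin_le_nhds, ?_⟩
      filter_upwards [self_mem_nhdsWithin] with y hy
      exact (ENNReal.ofReal_lt_ofReal_iff hx).2 hy
    exact this.eventually h
  · intro h
    have : Tendsto ENNReal.toReal (𝓝[<] (ENNReal.ofReal x)) (𝓝[<] x) := by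
      refine tendsto_nhdsWithin_iff.2 ⟨?_, ?_⟩
      · have := ENNReal.tendsto_toReal (ENNReal.ofReal_ne_top (r := x))
        rw [ENNReal.toReal_ofReal hx.le] at this
        exact this.mono_left nhdsWithin_le_nhds
      · filter_upwards [self_mem_nhdsWithin] with t ht
        have ht : t < ENNReal.ofReal x := ht
        exact (ENNReal.lt_ofReal_iff_toReal_lt (ht.trans ENNReal.ofReal_lt_top).ne).1 ht
    filter_upwards [this.eventually h, self_mem_nhdsWithin] with t ht ht'
    have ht' : t < ENNReal.ofReal x := ht'
    rwa [ENNReal.ofReal_toReal (ht'.trans ENNReal.ofReal_lt_top).ne] at ht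

theorem eventually_nhdsLT_top {P : ENNReal → Prop} :
    (∀ᶠ t in 𝓝[<] (⊤ : ENNReal), P t) ↔ ∀ᶠ y in atTop, P (ENNReal.ofReal y) := by
  constructor
  · intro h
    have : Tendsto ENNReal.ofReal atTop (𝓝[<] (⊤ : ENNReal)) :=
      tendsto_nhdsWithin_iff.2 ⟨ENNReal.tendsto_ofReal_atTop,
        Eventually.of_forall fun y => ENNReal.ofReal_lt_top⟩
    exact this.eventually h
  · intro h
    obtain ⟨a, ha⟩ := eventually_atTop.1 h
    have : ∀ᶠ t in 𝓝[<] (⊤ : ENNReal), ENNReal.ofReal (max a 0) < t :=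
      nhdsWithin_le_nhds (Ioi_mem_nhds ENNReal.ofReal_lt_top)
    filter_upwards [this, self_mem_nhdsWithin] with t ht ht'
    have ht' : t < ⊤ := ht'
    have := ha t.toReal
      ((le_max_left _ _).trans
        ((ENNReal.ofReal_lt_iff_lt_toReal (le_max_right _ _) ht'.ne).1 ht).le)
    rwa [ENNReal.ofReal_toReal ht'.ne] at this

variable {C : TropicalCurve}

variable (C) in
/-- The point of the edge `e` with real coordinate `x`. -/
def rpt (e : C.E) (x : ℝ) : C.Pt := C.pt e (ENNReal.ofReal x)

variable (C) in
/-- `x` is the coordinate of an interior point of the edge `e`. -/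
def IsInner (e : C.E) (x : ℝ) : Prop := 0 < x ∧ ENNReal.ofReal x < C.len e

theorem rpt_zero (e : C.E) : C.rpt e 0 = Pt.vertex (C.src e) := by
  simp [rpt, pt_zero]

theorem rpt_len {e : C.E} (h : C.len e ≠ ⊤) : C.rpt e (C.len e).toReal = Pt.vertex (C.tgt e) := by
  rw [rpt, ENNReal.ofReal_toReal h, pt_len]

theorem len_toReal_pos {e : C.E} (h : C.len e ≠ ⊤) : 0 < (C.len e).toReal :=
  ENNReal.toReal_pos (C.len_pos e).ne' h

theorem isInner_iff {e : C.E} (h : C.len e ≠ ⊤) {x : ℝ} :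
    C.IsInner e x ↔ x ∈ Set.Ioo 0 (C.len e).toReal := by
  unfold IsInner
  constructor
  · rintro ⟨h1, h2⟩
    exact ⟨h1, (ENNReal.ofReal_lt_iff_lt_toReal h1.le h).1 h2⟩
  · rintro ⟨h1, h2⟩
    exact ⟨h1, (ENNReal.ofReal_lt_iff_lt_toReal h1.le h).2 h2⟩

theorem pt_inner {e : C.E} {t : ENNReal} (h0 : 0 < t) (h1 : t < C.len e) :
    C.pt e t = Pt.inner e t h0 h1 := by simp [pt, h0, h1]

theorem IsInner.rpt {e : C.E} {x : ℝ} (h : C.IsInner e x) :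
    C.rpt e x = Pt.inner e (ENNReal.ofReal x) (ENNReal.ofReal_pos.2 h.1) h.2 :=
  pt_inner _ _

theorem inner_eq_rpt {e : C.E} {t : ENNReal} (h0 : 0 < t) (h1 : t < C.len e) :
    C.IsInner e t.toReal ∧ Pt.inner e t h0 h1 = C.rpt e t.toReal := by
  have ht : t ≠ ⊤ := (h1.trans_le le_top).ne
  refine ⟨⟨ENNReal.toReal_pos h0.ne' ht, by rwa [ENNReal.ofReal_toReal ht]⟩, ?_⟩
  rw [TropicalCurve.rpt, ENNReal.ofReal_toReal ht, pt_inner h0 h1]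

theorem IsInner.rpt_inj {e e' : C.E} {x x' : ℝ} (h : C.IsInner e x) (h' : C.IsInner e' x')
    (heq : C.rpt e x = C.rpt e' x') : e = e' ∧ x = x' := by
  rw [h.rpt, h'.rpt] at heq
  injection heq with h1 h2
  exact ⟨h1, (ENNReal.ofReal_eq_ofReal_iff h.1.le h'.1.le).1 h2⟩

theorem Dir.pt_coord : ∀ {p : C.Pt} (ξ : C.Dir p), C.pt ξ.edge ξ.coord = p
  | Pt.vertex _, Sum.inl ⟨_, rfl⟩ => C.pt_zero _
  | Pt.vertex _, Sum.inr ⟨_, rfl⟩ => C.pt_len _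
  | Pt.inner _ _ h0 h1, _ => pt_inner h0 h1

theorem Dir.coord_ne_top_of_fwd : ∀ {p : C.Pt} (ξ : C.Dir p), ξ.fwd = true → ξ.coord ≠ ⊤
  | Pt.vertex _, Sum.inl _, _ => ENNReal.zero_ne_top
  | Pt.inner _ _ _ h1, _, _ => (h1.trans_le le_top).ne

theorem Dir.coord_pos_of_not_fwd : ∀ {p : C.Pt} (ξ : C.Dir p), ξ.fwd ≠ true → 0 < ξ.coord
  | Pt.vertex _, Sum.inl _, h => absurd rfl h
  | Pt.vertex _, Sum.inr e, _ => C.len_pos e.1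
  | Pt.inner _ _ h0 _, _, _ => h0

theorem Dir.coord_lt_of_fwd : ∀ {p : C.Pt} (ξ : C.Dir p), ξ.fwd = true → ξ.coord < C.len ξ.edge
  | Pt.vertex _, Sum.inl e, _ => C.len_pos e.1
  | Pt.inner _ _ _ h1, _, _ => h1

theorem Dir.coord_eq_top : ∀ {p : C.Pt} (ξ : C.Dir p), ξ.coord = ⊤ →
    C.len ξ.edge = ⊤ ∧ ξ.sgn = -1 ∧ p = Pt.vertex (C.tgt ξ.edge)
  | Pt.vertex _, Sum.inl _, h => absurd h ENNReal.zero_ne_top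
  | Pt.vertex _, Sum.inr e, h => ⟨h, by simp [Dir.sgn, Dir.fwd], by rw [Dir.edge, e.2]⟩
  | Pt.inner _ _ _ h1, _, h => absurd h (h1.trans_le le_top).ne

theorem Dir.sgn_eq {p : C.Pt} (ξ : C.Dir p) : ξ.sgn = 1 ∨ ξ.sgn = -1 := by
  unfold Dir.sgn; split_ifs <;> simp

theorem Dir.coord_le : ∀ {p : C.Pt} (ξ : C.Dir p), ξ.coord ≤ C.len ξ.edge
  | Pt.vertex _, Sum.inl _ => zero_le
  | Pt.vertex _, Sum.inr _ => le_rfl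
  | Pt.inner _ _ _ h1, _ => h1.le

theorem Dir.rpt_coord {p : C.Pt} (ξ : C.Dir p) (h : ξ.coord ≠ ⊤) :
    C.rpt ξ.edge ξ.coord.toReal = p := by
  rw [rpt, ENNReal.ofReal_toReal h, ξ.pt_coord]

theorem Dir.eventually_germ {p : C.Pt} (ξ : C.Dir p) (h : ξ.coord ≠ ⊤) {P : ENNReal → Prop} :
    (∀ᶠ t in ξ.germ, P t) ↔
      ∀ᶠ h in 𝓝[>] (0 : ℝ), P (ENNReal.ofReal (ξ.coord.toReal + ξ.sgn * h)) := by
  unfold Dir.germ Dir.sgn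
  split_ifs with hf
  · conv_lhs => rw [← ENNReal.ofReal_toReal h]
    rw [eventually_nhdsGT_ofReal ENNReal.toReal_nonneg, ← eventually_right_iff]
    simp
  · conv_lhs => rw [← ENNReal.ofReal_toReal h]
    rw [eventually_nhdsLT_ofReal (ENNReal.toReal_pos (ξ.coord_pos_of_not_fwd hf).ne' h),
      ← eventually_left_iff]
    simp [sub_eq_add_neg]

theorem Dir.eventually_germ_top {p : C.Pt} (ξ : C.Dir p) (h : ξ.coord = ⊤) {P : ENNReal → Prop} :
    (∀ᶠ t in ξ.germ, P t) ↔ ∀ᶠ y in atTop, P (ENNReal.ofReal y) := by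
  have hf : ¬ ξ.fwd = true := fun hf => ξ.coord_ne_top_of_fwd hf h
  unfold Dir.germ
  rw [if_neg hf, h, eventually_nhdsLT_top]

theorem Dir.eventually_coord_nonneg {p : C.Pt} (ξ : C.Dir p) (h : ξ.coord ≠ ⊤) :
    ∀ᶠ h in 𝓝[>] (0 : ℝ), 0 ≤ ξ.coord.toReal + ξ.sgn * h := by
  by_cases hf : ξ.fwd = true
  · filter_upwards [self_mem_nhdsWithin] with y hy
    have hy : 0 < y := hy
    have := ENNReal.toReal_nonneg (a := ξ.coord)
    simp only [Dir.sgn, hf, if_true]; linarith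
  · have := ENNReal.toReal_pos (ξ.coord_pos_of_not_fwd hf).ne' h
    filter_upwards [Ioo_mem_nhdsGT this] with y hy
    rw [Dir.sgn, if_neg hf]; linarith [hy.2]

/-- At a finite coordinate the intercept in `HasSlope` is determined by the value at the base point,
so the condition is one about germs on the real line. The two signs cancel because `sgn * sgn = 1`.
-/
theorem hasSlope_iff {f : C.Pt → ℝ} {p : C.Pt} (ξ : C.Dir p) (h : ξ.coord ≠ ⊤) (m : ℤ) :
    HasSlope f ξ m ↔ Slope (fun x => f (C.rpt ξ.edge x)) ξ.coord.toReal ξ.sgn m := by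
  have hs : ξ.sgn * ξ.sgn = 1 := by rcases ξ.sgn_eq with h | h <;> rw [h] <;> norm_num
  unfold HasSlope Slope
  simp only [ξ.eventually_germ h, ξ.rpt_coord h]
  constructor
  · rintro ⟨c, h1, h2⟩
    filter_upwards [h1, ξ.eventually_coord_nonneg h] with y hy hy'
    rw [rpt, hy, h2 h, ENNReal.toReal_ofReal hy']
    linear_combination (m : ℝ) * y * hs
  · intro h1
    refine ⟨f p - ξ.sgn * m * ξ.coord.toReal, ?_, fun _ => by ring⟩
    filter_upwards [h1, ξ.eventually_coord_nonneg h] with y hy hy'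
    rw [rpt] at hy
    rw [hy, ENNReal.toReal_ofReal hy']
    linear_combination -(m : ℝ) * y * hs

/-- A direction with coordinate `⊤` points from the end of an infinite edge back along it, whence
the minus sign; the value at the end plays no role. -/
theorem hasSlope_iff_top {f : C.Pt → ℝ} {p : C.Pt} (ξ : C.Dir p) (h : ξ.coord = ⊤) (m : ℤ) :
    HasSlope f ξ m ↔ ∃ c : ℝ, ∀ᶠ y in atTop, f (C.rpt ξ.edge y) = c - m * y := by
  unfold HasSlope
  simp only [ξ.eventually_germ_top h, h, (ξ.coord_eq_top h).2.1]
  refine exists_congr fun c => ⟨fun h1 => ?_, fun h1 => ⟨?_, fun h => absurd rfl h⟩⟩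
  · filter_upwards [h1.1, eventually_ge_atTop 0] with y hy hy'
    rw [rpt, hy, ENNReal.toReal_ofReal hy']; ring
  · filter_upwards [h1, eventually_ge_atTop 0] with y hy hy'
    rw [rpt] at hy
    rw [hy, ENNReal.toReal_ofReal hy']; ring

variable (C) in
/-- The direction at the source of the edge `e`. -/
def dirSrc (e : C.E) : C.Dir (Pt.vertex (C.src e)) := Sum.inl ⟨e, rfl⟩

variable (C) in
/-- The direction at the target of the edge `e`. -/
def dirTgt (e : C.E) : C.Dir (Pt.vertex (C.tgt e)) := Sum.inr ⟨e, rfl⟩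

theorem hasSlope_src {f : C.Pt → ℝ} {e : C.E} {m : ℤ} :
    HasSlope f (C.dirSrc e) m ↔ Slope (fun x => f (C.rpt e x)) 0 1 m := by
  rw [hasSlope_iff (C.dirSrc e) ENNReal.zero_ne_top m]
  simp [dirSrc, Dir.edge, Dir.coord, Dir.sgn, Dir.fwd]

theorem hasSlope_tgt {f : C.Pt → ℝ} {e : C.E} (h : C.len e ≠ ⊤) {m : ℤ} :
    HasSlope f (C.dirTgt e) m ↔ Slope (fun x => f (C.rpt e x)) (C.len e).toReal (-1) m := by
  rw [hasSlope_iff (C.dirTgt e) h m]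
  simp [dirTgt, Dir.edge, Dir.coord, Dir.sgn, Dir.fwd]

theorem hasSlope_tgt_top {f : C.Pt → ℝ} {e : C.E} (h : C.len e = ⊤) {m : ℤ} :
    HasSlope f (C.dirTgt e) m ↔ ∃ c : ℝ, ∀ᶠ y in atTop, f (C.rpt e y) = c - m * y :=
  hasSlope_iff_top (C.dirTgt e) h m

theorem hasSlope_inner {f : C.Pt → ℝ} {e : C.E} {x : ℝ} (h : C.IsInner e x) (b : Bool) {m : ℤ} :
    HasSlope f (p := Pt.inner e (ENNReal.ofReal x) (ENNReal.ofReal_pos.2 h.1) h.2) b m ↔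
      Slope (fun x => f (C.rpt e x)) x (if b = true then 1 else -1) m := by
  rw [hasSlope_iff (p := Pt.inner e (ENNReal.ofReal x) (ENNReal.ofReal_pos.2 h.1) h.2) b
    ENNReal.ofReal_ne_top m]
  simp only [Dir.edge, Dir.coord, Dir.sgn, Dir.fwd, ENNReal.toReal_ofReal h.1.le]
  rfl

/-- Induction over directions. -/
theorem Dir.cases {P : (p : C.Pt) → C.Dir p → Prop} (h1 : ∀ e, P _ (C.dirSrc e))
    (h2 : ∀ e, P _ (C.dirTgt e))
    (h3 : ∀ (e : C.E) (x : ℝ) (h : C.IsInner e x) (b : Bool),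
      P (Pt.inner e (ENNReal.ofReal x) (ENNReal.ofReal_pos.2 h.1) h.2) b) :
    ∀ (p : C.Pt) (ξ : C.Dir p), P p ξ
  | Pt.vertex _, Sum.inl ⟨e, rfl⟩ => h1 e
  | Pt.vertex _, Sum.inr ⟨e, rfl⟩ => h2 e
  | Pt.inner e t h0 ht, b => by
    obtain ⟨x, rfl⟩ : ∃ x, t = ENNReal.ofReal x :=
      ⟨t.toReal, (ENNReal.ofReal_toReal (ht.trans_le le_top).ne).symm⟩
    exact h3 e x ⟨ENNReal.ofReal_pos.1 h0, ht⟩ b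

theorem Pt.cases {P : C.Pt → Prop} (h1 : ∀ v, P (Pt.vertex v))
    (h3 : ∀ (e : C.E) (x : ℝ) (_ : C.IsInner e x), P (C.rpt e x)) : ∀ p : C.Pt, P p
  | Pt.vertex v => h1 v
  | Pt.inner e t h0 ht => by
    obtain ⟨h4, h5⟩ := inner_eq_rpt h0 ht
    rw [h5]; exact h3 e _ h4

theorem sum_dir_vertex {A : Type*} [AddCommMonoid A] (v : C.V)
    (m : (p : C.Pt) → C.Dir p → A) :
    ∑ ξ, m (Pt.vertex v) ξ = ∑ e with C.src e = v, m _ (C.dirSrc e) +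
      ∑ e with C.tgt e = v, m _ (C.dirTgt e) := by
  have : ∑ ξ, m (Pt.vertex v) ξ = ∑ e : {e : C.E // C.src e = v}, m (Pt.vertex v) (Sum.inl e) +
    ∑ e : {e : C.E // C.tgt e = v}, m (Pt.vertex v) (Sum.inr e) := Fintype.sum_sum_type _
  rw [this]
  congr 1
  · rw [Finset.sum_filter, ← Finset.sum_filter, ← Finset.sum_subtype_eq_sum_filter]
    refine Finset.sum_bij (fun e _ => ⟨e.1, e.2⟩) ?_ ?_ ?_ ?_
    · simp
    · rintro ⟨a, rfl⟩ _ ⟨b, hb⟩ _ h; simpa using h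
    · rintro ⟨a, ha⟩ _; exact ⟨⟨a, ha⟩, by simp, rfl⟩
    · rintro ⟨a, rfl⟩ _; rfl
  · rw [Finset.sum_filter, ← Finset.sum_filter, ← Finset.sum_subtype_eq_sum_filter]
    refine Finset.sum_bij (fun e _ => ⟨e.1, e.2⟩) ?_ ?_ ?_ ?_
    · simp
    · rintro ⟨a, rfl⟩ _ ⟨b, hb⟩ _ h; simpa using h
    · rintro ⟨a, ha⟩ _; exact ⟨⟨a, ha⟩, by simp, rfl⟩
    · rintro ⟨a, rfl⟩ _; rfl

theorem sum_dir_inner {A : Type*} [AddCommMonoid A] {e : C.E} {t : ENNReal} (h0 : 0 < t)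
    (h1 : t < C.len e) (m : C.Dir (Pt.inner e t h0 h1) → A) :
    ∑ ξ, m ξ = m (true : Bool) + m (false : Bool) :=
  Fintype.sum_bool m

end

section

variable {C : TropicalCurve}

/-! ### Divisors on the edges -/

theorem finite_edgeSupp (D : C.Div) (e : C.E) :
    {x | C.IsInner e x ∧ D (C.rpt e x) ≠ 0}.Finite := by
  refine Set.Finite.of_finite_image (f := C.rpt e) ?_ ?_
  · refine D.support.finite_toSet.subset ?_
    rintro _ ⟨x, hx, rfl⟩
    simpa using hx.2
  · intro x hx y hy h
    exact (hx.1.rpt_inj hy.1 h).2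

/-- The coordinates of the points of the support of a divisor inside the edge `e`. -/
def edgeSupp (D : C.Div) (e : C.E) : Finset ℝ := (finite_edgeSupp D e).toFinset

theorem mem_edgeSupp {D : C.Div} {e : C.E} {x : ℝ} :
    x ∈ edgeSupp D e ↔ C.IsInner e x ∧ D (C.rpt e x) ≠ 0 := by
  simp [edgeSupp]

theorem sum_div {A : Type*} [AddCommGroup A] (D : C.Div) (g : C.Pt → A) :
    (D.sum fun p a => a • g p) = ∑ v, D (Pt.vertex v) • g (Pt.vertex v) +
      ∑ e, ∑ x ∈ edgeSupp D e, D (C.rpt e x) • g (C.rpt e x) := by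
  have hinj : ∀ e, Set.InjOn (C.rpt e) (edgeSupp D e) := fun e x hx y hy h =>
    ((mem_edgeSupp.1 hx).1.rpt_inj (mem_edgeSupp.1 hy).1 h).2
  let U : Finset C.Pt := Finset.univ.image (Pt.vertex : C.V → C.Pt)
  let W : Finset C.Pt := Finset.univ.biUnion fun e => (edgeSupp D e).image (C.rpt e)
  have hd : Disjoint U W := by
    rw [Finset.disjoint_left]
    intro p hp hp'
    simp only [U, Finset.mem_image, Finset.mem_univ, true_and] at hp
    simp only [W, Finset.mem_biUnion, Finset.mem_image, Finset.mem_univ, true_and] at hp'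
    obtain ⟨v, rfl⟩ := hp
    obtain ⟨e, x, hx, h⟩ := hp'
    rw [(mem_edgeSupp.1 hx).1.rpt] at h
    cases h
  have hsub : D.support ⊆ U ∪ W := by
    intro p hp
    revert hp
    refine Pt.cases (P := fun p => p ∈ D.support → p ∈ U ∪ W) (fun v _ => ?_)
      (fun e x hx hp => ?_) p
    · simp [U]
    · refine Finset.mem_union_right _ (Finset.mem_biUnion.2 ⟨e, Finset.mem_univ _, ?_⟩)
      exact Finset.mem_image_of_mem _ (mem_edgeSupp.2 ⟨hx, by simpa using hp⟩)
  rw [Finsupp.sum_of_support_subset D hsub _ (by simp), Finset.sum_union hd]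
  congr 1
  · rw [Finset.sum_image]
    intro u _ v _ h
    injection h
  · rw [Finset.sum_biUnion]
    · exact Finset.sum_congr rfl fun e _ => Finset.sum_image (hinj e)
    · intro e _ e' _ hee
      rw [Function.onFun, Finset.disjoint_left]
      intro p hp hp'
      simp only [Finset.mem_image] at hp hp'
      obtain ⟨x, hx, rfl⟩ := hp
      obtain ⟨y, hy, h⟩ := hp'
      exact hee ((mem_edgeSupp.1 hy).1.rpt_inj (mem_edgeSupp.1 hx).1 h).1.symm

theorem deg_eq (D : C.Div) : C.deg D = ∑ v, D (Pt.vertex v) +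
    ∑ e, ∑ x ∈ edgeSupp D e, D (C.rpt e x) := by
  have := sum_div D (fun _ => (1 : ℤ))
  simp only [smul_eq_mul, mul_one] at this
  exact this

theorem deg_add (D D' : C.Div) : C.deg (D + D') = C.deg D + C.deg D' :=
  Finsupp.sum_add_index' (fun _ => rfl) (fun _ _ _ => rfl)

theorem abelJacobi_add (p₀ : C.Pt) (D D' : C.Div) :
    C.abelJacobi p₀ (D + D') = C.abelJacobi p₀ D + C.abelJacobi p₀ D' :=
  Finsupp.sum_add_index' (fun _ => zero_smul _ _) (fun _ _ _ => add_smul _ _ _)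

/-! ### Summation by parts along an edge -/

/-- Reindexes the slopes by real coordinates, so that the results on functions of one real variable
apply to each edge. -/
theorem edge_slopes {f : C.Pt → ℝ} {m : (p : C.Pt) → C.Dir p → ℤ}
    (hm : ∀ (p : C.Pt) (ξ : C.Dir p), HasSlope f ξ (m p ξ)) (e : C.E) :
    ∃ mp mm : ℝ → ℤ,
      (∀ x, 0 ≤ x → ENNReal.ofReal x < C.len e →
        Slope (fun y => f (C.rpt e y)) x 1 (mp x)) ∧
      (∀ x, 0 < x → ENNReal.ofReal x ≤ C.len e →
        Slope (fun y => f (C.rpt e y)) x (-1) (mm x)) ∧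
      mp 0 = m _ (C.dirSrc e) ∧ (C.len e ≠ ⊤ → mm (C.len e).toReal = m _ (C.dirTgt e)) ∧
      ∀ (x : ℝ) (h : C.IsInner e x),
        mp x = m (Pt.inner e (ENNReal.ofReal x) (ENNReal.ofReal_pos.2 h.1) h.2) (true : Bool) ∧
        mm x = m (Pt.inner e (ENNReal.ofReal x) (ENNReal.ofReal_pos.2 h.1) h.2) (false : Bool) := by
  -- The `else` branches are meant for `x = 0` and `x = len e`, the ends of the edge; elsewhere
  -- outside the edge they are junk.
  refine ⟨fun x => if h : C.IsInner e x then
      m (Pt.inner e (ENNReal.ofReal x) (ENNReal.ofReal_pos.2 h.1) h.2) (true : Bool)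
      else m _ (C.dirSrc e),
    fun x => if h : C.IsInner e x then
      m (Pt.inner e (ENNReal.ofReal x) (ENNReal.ofReal_pos.2 h.1) h.2) (false : Bool)
      else m _ (C.dirTgt e), ?_, ?_, ?_, ?_, ?_⟩
  · intro x hx hx'
    by_cases h : C.IsInner e x
    · simp only [h, dif_pos]
      simpa using (hasSlope_inner h true).1 (hm _ _)
    · have : x = 0 := by
        by_contra h0
        exact h ⟨lt_of_le_of_ne hx (Ne.symm h0), hx'⟩
      subst this
      simp only [h, dif_neg, not_false_eq_true]
      exact hasSlope_src.1 (hm _ _)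
  · intro x hx hx'
    by_cases h : C.IsInner e x
    · simp only [h, dif_pos]
      simpa using (hasSlope_inner h false).1 (hm _ _)
    · have : ENNReal.ofReal x = C.len e := by
        by_contra h0
        exact h ⟨hx, lt_of_le_of_ne hx' h0⟩
      have hl : C.len e ≠ ⊤ := this ▸ ENNReal.ofReal_ne_top
      have hx2 : x = (C.len e).toReal := by rw [← this, ENNReal.toReal_ofReal hx.le]
      simp only [h, dif_neg, not_false_eq_true]
      rw [hx2]
      exact (hasSlope_tgt hl).1 (hm _ _)
  · have : ¬ C.IsInner e 0 := fun h => lt_irrefl _ h.1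
    simp only [this, dif_neg, not_false_eq_true]
  · intro hl
    have : ¬ C.IsInner e (C.len e).toReal := fun h => by
      have := h.2
      rw [ENNReal.ofReal_toReal hl] at this
      exact lt_irrefl _ this
    simp only [this, dif_neg, not_false_eq_true]
  · intro x h
    simp only [h, dif_pos]
    exact ⟨trivial, trivial⟩

theorem eventually_slope_top {f : ℝ → ℝ} {c n : ℝ}
    (h : ∀ᶠ y in atTop, f y = c - n * y) : ∀ᶠ y in atTop, Slope f y (-1) n ∧ Slope f y 1 (-n) := by
  obtain ⟨a, ha⟩ := eventually_atTop.1 h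
  filter_upwards [eventually_gt_atTop a] with b hb
  constructor
  · rw [slope_neg_one_iff]
    filter_upwards [Ioo_mem_nhdsLT hb] with y hy
    rw [ha y hy.1.le, ha b hb.le]; ring
  · rw [slope_one_iff]
    filter_upwards [self_mem_nhdsWithin] with y hy
    have hy : b < y := hy
    rw [ha y (hb.trans hy).le, ha b hb.le]; ring

/-- Summation by parts along the initial segment of an edge. -/
theorem sum_edge_initial {f : C.Pt → ℝ} {e : C.E} {mp mm : ℝ → ℤ}
    (hp : ∀ x, 0 ≤ x → ENNReal.ofReal x < C.len e → Slope (fun y => f (C.rpt e y)) x 1 (mp x))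
    (hmm : ∀ x, 0 < x → ENNReal.ofReal x ≤ C.len e →
      Slope (fun y => f (C.rpt e y)) x (-1) (mm x))
    {D : C.Div} (hD : ∀ x, C.IsInner e x → D (C.rpt e x) = mp x + mm x)
    {b : ℝ} (hb : 0 < b) (hb' : ENNReal.ofReal b ≤ C.len e) :
    ∑ x ∈ edgeSupp D e with x < b, D (C.rpt e x) = -mm b - mp 0 ∧
    ∑ x ∈ edgeSupp D e with x < b, x * (D (C.rpt e x) : ℝ) =
      -(b * mm b) - (f (C.rpt e b) - f (C.rpt e 0)) := by
  have hin : ∀ x ∈ Set.Ioo 0 b, C.IsInner e x := fun x hx =>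
    ⟨hx.1, lt_of_lt_of_le ((ENNReal.ofReal_lt_ofReal_iff hb).2 hx.2) hb'⟩
  have hmem : ∀ x ∈ (edgeSupp D e).filter (· < b), x ∈ Set.Ioo 0 b := fun x hx => by
    rw [Finset.mem_filter, mem_edgeSupp] at hx
    exact ⟨hx.1.1.1, hx.2⟩
  obtain ⟨h1, h2⟩ := sum_slopes (φ := fun y => f (C.rpt e y)) hb
    (mp := fun x => (mp x : ℝ)) (mm := fun x => (mm x : ℝ))
    (fun x hx => hp x hx.1 (lt_of_lt_of_le ((ENNReal.ofReal_lt_ofReal_iff hb).2 hx.2) hb'))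
    (fun x hx => hmm x hx.1 ((ENNReal.ofReal_le_ofReal hx.2).trans hb'))
    ((edgeSupp D e).filter (· < b)) hmem (by
      intro x hx hx'
      have h1 : D (C.rpt e x) = 0 := by
        by_contra h
        exact hx' (Finset.mem_filter.2 ⟨mem_edgeSupp.2 ⟨hin x hx, h⟩, hx.2⟩)
      have := hD x (hin x hx)
      rw [h1] at this
      exact_mod_cast this.symm)
  have hc : ∀ x ∈ (edgeSupp D e).filter (· < b), (D (C.rpt e x) : ℝ) = mp x + mm x :=
    fun x hx => by rw [hD x (hin x (hmem x hx))]; push_cast; ring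
  constructor
  · rw [← Finset.sum_congr rfl hc] at h1
    exact_mod_cast h1
  · rw [Finset.sum_congr rfl fun x hx => by rw [hc x hx], h2]
    ring

variable {f : C.Pt → ℝ} {m : (p : C.Pt) → C.Dir p → ℤ} {D : C.Div}

theorem sum_edge (hm : ∀ (p : C.Pt) (ξ : C.Dir p), HasSlope f ξ (m p ξ))
    (hD : ∀ (e : C.E) (x : ℝ), C.IsInner e x → D (C.rpt e x) = ∑ ξ, m (C.rpt e x) ξ) (e : C.E) :
    ∑ x ∈ edgeSupp D e, D (C.rpt e x) = -m _ (C.dirTgt e) - m _ (C.dirSrc e) ∧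
    (C.len e ≠ ⊤ → ∑ x ∈ edgeSupp D e, x * (D (C.rpt e x) : ℝ) =
      -((C.len e).toReal * m _ (C.dirTgt e)) -
        (f (Pt.vertex (C.tgt e)) - f (Pt.vertex (C.src e)))) := by
  obtain ⟨mp, mm, h1, h2, h3, h4, h5⟩ := edge_slopes hm e
  have hD' : ∀ x, C.IsInner e x → D (C.rpt e x) = mp x + mm x := by
    intro x hx
    rw [hD e x hx, (h5 x hx).1, (h5 x hx).2, hx.rpt, sum_dir_inner]
  by_cases hl : C.len e = ⊤
  · refine ⟨?_, fun h => absurd hl h⟩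
    obtain ⟨c, hc⟩ := (hasSlope_tgt_top hl).1 (hm _ (C.dirTgt e))
    -- On an infinite edge, cut at a point `b` beyond the support of `D`, where `f` is already
    -- affine with its slope at infinity.
    have hT : ∀ᶠ y in atTop, ∀ x ∈ edgeSupp D e, x < y :=
      (eventually_all_finset _).2 fun x _ => eventually_gt_atTop x
    obtain ⟨b, ⟨h6, h7⟩, h8⟩ :=
      (((eventually_slope_top hc).and hT).and (eventually_gt_atTop 0)).exists
    have h9 := (sum_edge_initial h1 h2 hD' h8 (by rw [hl]; exact le_top)).1
    rw [Finset.filter_true_of_mem h7] at h9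
    have h10 := (h2 b h8 (by rw [hl]; exact le_top)).unique h6.1
    have h10 : mm b = m _ (C.dirTgt e) := by exact_mod_cast h10
    rw [h9, h10, h3]
  · have hb := len_toReal_pos hl
    obtain ⟨h6, h7⟩ := sum_edge_initial h1 h2 hD' hb (by rw [ENNReal.ofReal_toReal hl])
    have hT : ∀ x ∈ edgeSupp D e, x < (C.len e).toReal := fun x hx =>
      ((isInner_iff hl).1 (mem_edgeSupp.1 hx).1).2
    rw [Finset.filter_true_of_mem hT, h4 hl] at h6 h7
    rw [rpt_zero, rpt_len hl] at h7
    exact ⟨by rw [h6, h3], fun _ => h7⟩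

/-- If all coefficients of a principal divisor are even, then the parity of the slope is constant
along each edge. -/
theorem slope_parity (hm : ∀ (p : C.Pt) (ξ : C.Dir p), HasSlope f ξ (m p ξ))
    (hD : ∀ p, D p = ∑ ξ, m p ξ) (heven : ∀ p, Even (D p)) :
    ∀ (p : C.Pt) (ξ : C.Dir p), Even (m p ξ) ↔ Even (m _ (C.dirSrc ξ.edge)) := by
  refine Dir.cases (fun e => Iff.rfl) (fun e => ?_) (fun e x hx b => ?_)
  · have h := (sum_edge hm (fun e x _ => hD (C.rpt e x)) e).1
    have h1 : Even (∑ x ∈ edgeSupp D e, D (C.rpt e x)) :=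
      Finset.even_sum _ fun x _ => heven _
    rw [h, Int.even_sub, even_neg] at h1
    exact h1
  · obtain ⟨mp, mm, h1, h2, h3, h4, h5⟩ := edge_slopes hm e
    have hD' : ∀ x, C.IsInner e x → D (C.rpt e x) = mp x + mm x := by
      intro x hx
      rw [hD, (h5 x hx).1, (h5 x hx).2, hx.rpt, sum_dir_inner]
    -- Up to sign, the slopes at `x` and at the source differ by the sum of the coefficients between
    -- them, which is even.
    have h := (sum_edge_initial h1 h2 hD' hx.1 hx.2.le).1
    have h6 : Even (∑ x ∈ (edgeSupp D e).filter (· < x), D (C.rpt e x)) :=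
      Finset.even_sum _ fun x _ => heven _
    rw [h, Int.even_sub, even_neg, h3] at h6
    have h7 := heven (C.rpt e x)
    rw [hD' x hx, Int.even_add] at h7
    change Even (m _ _) ↔ Even (m _ (C.dirSrc e))
    cases b
    · rw [← h6, (h5 x hx).2]
    · rw [← h6, ← h7, (h5 x hx).1]

theorem finite_of_finite_edges {n : C.Pt → ℤ}
    (h : ∀ e, {x | C.IsInner e x ∧ n (C.rpt e x) ≠ 0}.Finite) : {p | n p ≠ 0}.Finite := by
  have h1 : (Set.range (Pt.vertex : C.V → C.Pt) ∪
      ⋃ e, C.rpt e '' {x | C.IsInner e x ∧ n (C.rpt e x) ≠ 0}).Finite :=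
    (Set.finite_range _).union (Set.finite_iUnion fun e => (h e).image _)
  refine h1.subset ?_
  intro p
  refine Pt.cases (P := fun p => n p ≠ 0 → p ∈ _) (fun v _ => ?_) (fun e x hx hp => ?_) p
  · exact Or.inl ⟨v, rfl⟩
  · exact Or.inr (Set.mem_iUnion.2 ⟨e, x, ⟨hx, hp⟩, rfl⟩)

/-- On a finite edge this is compactness; on an infinite edge `f` is affine near infinity, so the
breaks lie in a compact part. -/
theorem finite_sum_slopes (hm : ∀ (p : C.Pt) (ξ : C.Dir p), HasSlope f ξ (m p ξ)) :
    {p | ∑ ξ, m p ξ ≠ 0}.Finite := by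
  refine finite_of_finite_edges (n := fun p => ∑ ξ, m p ξ) fun e => ?_
  obtain ⟨mp, mm, h1, h2, h3, h4, h5⟩ := edge_slopes hm e
  have hD : ∀ x, C.IsInner e x → ∑ ξ, m (C.rpt e x) ξ = mp x + mm x := by
    intro x hx
    rw [(h5 x hx).1, (h5 x hx).2, hx.rpt, sum_dir_inner]
  have key : ∀ b : ℝ, ENNReal.ofReal b ≤ C.len e →
      {x ∈ Set.Ioo 0 b | (mp x : ℝ) + mm x ≠ 0}.Finite := fun b hb =>
    finite_breaks (φ := fun y => f (C.rpt e y)) (mp := fun x => (mp x : ℝ))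
      (mm := fun x => (mm x : ℝ))
      (fun x hx => h1 x hx.1
        (lt_of_lt_of_le ((ENNReal.ofReal_lt_ofReal_iff (hx.1.trans_lt hx.2)).2 hx.2) hb))
      (fun x hx => h2 x hx.1 ((ENNReal.ofReal_le_ofReal hx.2).trans hb))
  by_cases hl : C.len e = ⊤
  · obtain ⟨c, hc⟩ := (hasSlope_tgt_top hl).1 (hm _ (C.dirTgt e))
    obtain ⟨b, hb⟩ := eventually_atTop.1 (eventually_slope_top hc)
    refine (key b (by rw [hl]; exact le_top)).subset ?_
    rintro x ⟨hx, hx'⟩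
    rw [hD x hx] at hx'
    have hx' : (mp x : ℝ) + mm x ≠ 0 := by exact_mod_cast hx'
    refine ⟨⟨hx.1, ?_⟩, hx'⟩
    by_contra hbx
    have h6 := hb x (not_lt.1 hbx)
    apply hx'
    rw [(h1 x hx.1.le hx.2).unique h6.2, (h2 x hx.1 hx.2.le).unique h6.1]
    ring
  · refine (key _ (ENNReal.ofReal_toReal hl).le).subset ?_
    rintro x ⟨hx, hx'⟩
    rw [hD x hx] at hx'
    exact ⟨(isInner_iff hl).1 hx, by exact_mod_cast hx'⟩

end

section

variable {C : TropicalCurve}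

/-! ### Chains -/

theorem boundary_apply (γ : C.E → ℤ) (v : C.V) :
    C.boundary γ v = ∑ e with C.tgt e = v, γ e - ∑ e with C.src e = v, γ e := by
  rw [boundary, Fintype.linearCombination_apply, Finset.sum_apply, Finset.sum_filter,
    Finset.sum_filter, ← Finset.sum_sub_distrib]
  refine Finset.sum_congr rfl fun e _ => ?_
  simp only [Pi.smul_apply, Pi.sub_apply, Pi.single_apply, smul_eq_mul, mul_sub, mul_ite, mul_one,
    mul_zero, eq_comm (a := v)]

theorem boundary_single (e : C.E) :
    C.boundary (Pi.single e 1) = Pi.single (C.tgt e) 1 - Pi.single (C.src e) 1 := by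
  simp [boundary, Fintype.linearCombination_apply, Pi.single_apply]

theorem sum_boundary_mul {A : Type*} [AddCommGroup A] (γ : C.E → ℤ) (g : C.V → A) :
    ∑ v, C.boundary γ v • g v = ∑ e, γ e • (g (C.tgt e) - g (C.src e)) := by
  simp only [boundary_apply, sub_smul, Finset.sum_sub_distrib, Finset.sum_smul, smul_sub]
  congr 1
  · rw [← Finset.sum_fiberwise Finset.univ C.tgt]
    exact Finset.sum_congr rfl fun v _ => Finset.sum_congr rfl fun e he => by
      rw [(Finset.mem_filter.1 he).2]
  · rw [← Finset.sum_fiberwise Finset.univ C.src]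
    exact Finset.sum_congr rfl fun v _ => Finset.sum_congr rfl fun e he => by
      rw [(Finset.mem_filter.1 he).2]

/-- The differential of a function on the vertices integrates to zero. -/
theorem sum_differential (g : C.V → ℝ) :
    ∑ e, (g (C.tgt e) - g (C.src e)) • C.coeff e = 0 := by
  ext ω
  have h := sum_boundary_mul ω.1 g
  rw [LinearMap.mem_ker.1 ω.2] at h
  simp only [Pi.zero_apply, zero_smul, Finset.sum_const_zero, zsmul_eq_mul] at h
  simp only [LinearMap.coe_sum, Finset.sum_apply, LinearMap.smul_apply, coeff, LinearMap.coe_mk,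
    AddHom.coe_mk, smul_eq_mul, LinearMap.zero_apply]
  rw [h]
  exact Finset.sum_congr rfl fun e _ => mul_comm _ _

theorem leaf_edges {e : C.E} (h : C.len e = ⊤) :
    (∀ e', C.src e' ≠ C.tgt e) ∧ ∀ e', C.tgt e' = C.tgt e → e' = e := by
  have h1 := (C.len_eq_top_iff e).1 h
  have h2 : 0 < Nat.card {e' // C.tgt e' = C.tgt e} := by
    have : Nonempty {e' // C.tgt e' = C.tgt e} := ⟨⟨e, rfl⟩⟩
    exact Nat.card_pos
  have h3 : Nat.card {e' // C.src e' = C.tgt e} = 0 := by omega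
  have h4 : Nat.card {e' // C.tgt e' = C.tgt e} = 1 := by omega
  constructor
  · intro e' he'
    have : IsEmpty {e' // C.src e' = C.tgt e} := by
      rcases Nat.card_eq_zero.1 h3 with h | h
      · exact h
      · exact absurd h (not_infinite_iff_finite.2 inferInstance)
    exact this.elim ⟨e', he'⟩
  · intro e' he'
    obtain ⟨h5, -⟩ := Nat.card_eq_one_iff_unique.1 h4
    exact congrArg Subtype.val (Subsingleton.elim (⟨e', he'⟩ : {e' // C.tgt e' = C.tgt e}) ⟨e, rfl⟩)

/-- The 1-valent end of `e` meets no other edge, so the boundary condition there kills the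
coefficient. Hence the default `(⊤).toReal = 0` is harmless wherever it multiplies `coeff e`. -/
theorem coeff_eq_zero {e : C.E} (h : C.len e = ⊤) : C.coeff e = 0 := by
  ext ω
  have h1 := congrFun (LinearMap.mem_ker.1 ω.2) (C.tgt e)
  obtain ⟨h2, h3⟩ := leaf_edges h
  have h4 : (Finset.univ.filter fun e' => C.tgt e' = C.tgt e) = {e} := by
    ext e'; simp only [Finset.mem_filter, Finset.mem_univ, true_and, Finset.mem_singleton]
    exact ⟨h3 e', fun h => by rw [h]⟩
  have h5 : (Finset.univ.filter fun e' => C.src e' = C.tgt e) = ∅ := by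
    ext e'; simp [h2 e']
  rw [boundary_apply, h4, h5] at h1
  simp only [Finset.sum_singleton, Finset.sum_empty, sub_zero, Pi.zero_apply] at h1
  simp [coeff, h1]

theorem cycle_eq_zero {e : C.E} (h : C.len e = ⊤) (c : C.cycles) : c.1 e = 0 := by
  have := congrArg (fun x : C.FormDual => x c) (coeff_eq_zero h)
  simpa [coeff] using this

variable (C) in
/-- Integration of 1-forms over integral chains. -/
def chainInt : (C.E → ℤ) →+ C.FormDual where
  toFun γ := ∑ e, ((γ e : ℝ) * (C.len e).toReal) • C.coeff e
  map_zero' := by simp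
  map_add' := by intro a b; simp [add_mul, add_smul, Finset.sum_add_distrib]

theorem period_eq (c : C.cycles) : C.period c = C.chainInt c.1 := rfl

theorem chainInt_single (e : C.E) :
    C.chainInt (Pi.single e 1) = (C.len e).toReal • C.coeff e := by
  change ∑ e', (((Pi.single e 1 : C.E → ℤ) e' : ℝ) * (C.len e').toReal) • C.coeff e' = _
  rw [Finset.sum_eq_single e]
  · simp
  · intro e' _ h; simp [h]
  · simp

theorem chainInt_apply (γ : C.E → ℤ) (ω : C.cycles) :
    C.chainInt γ ω = ∑ e, (γ e : ℝ) * (C.len e).toReal * ω.1 e := by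
  change (∑ e, ((γ e : ℝ) * (C.len e).toReal) • C.coeff e) ω = _
  simp [coeff]

/-- A vertex close to the given point. -/
def anchor : C.Pt → C.V
  | Pt.vertex v => v
  | Pt.inner e _ _ _ => C.src e

/-- The integral from the anchor to the given point. -/
def offset : C.Pt → C.FormDual
  | Pt.vertex _ => 0
  | Pt.inner e t _ _ => t.toReal • C.coeff e

theorem offset_vertex (v : C.V) : offset (Pt.vertex v : C.Pt) = 0 := rfl

/-- The anchor of a point is the source of its edge, except at the far end of the edge, where it is
the target; there the whole edge has to enter the chain. -/
theorem exists_chain_segment (e : C.E) (s : ENNReal) (hs : s ≤ C.len e) : ∃ γ : C.E → ℤ,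
    C.boundary γ = Pi.single (anchor (C.pt e s)) 1 - Pi.single (C.src e) 1 ∧
    s.toReal • C.coeff e = C.chainInt γ + offset (C.pt e s) := by
  rcases eq_or_lt_of_le (zero_le : 0 ≤ s) with h | h
  · refine ⟨0, ?_, ?_⟩ <;> simp [← h, pt_zero, anchor, offset]
  rcases eq_or_lt_of_le hs with h' | h'
  · refine ⟨Pi.single e 1, ?_, ?_⟩
    · rw [boundary_single, h', pt_len]; rfl
    · rw [chainInt_single, h', pt_len]; simp [offset]
  · rw [pt_inner h h']
    exact ⟨0, by simp [anchor], by simp [offset]⟩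

/-- A path integral is the integral over an integral chain plus terms depending only on the end
points. Two paths with the same ends give chains with the same boundary, so their integrals differ
by a period. -/
theorem IsPath.exists_chain {p q : C.Pt} {φ : C.FormDual} {L : ENNReal} (h : C.IsPath p q φ L) :
    ∃ γ : C.E → ℤ, C.boundary γ = Pi.single (anchor q) 1 - Pi.single (anchor p) 1 ∧
      φ = C.chainInt γ + offset q - offset p := by
  induction h with
  | nil p => exact ⟨0, by simp, by simp⟩
  | cons e s t hs ht h ih =>
    obtain ⟨γ, h1, h2⟩ := ih
    obtain ⟨α, h3, h4⟩ := exists_chain_segment e s hs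
    obtain ⟨β, h5, h6⟩ := exists_chain_segment e t ht
    refine ⟨β - α + γ, ?_, ?_⟩
    · rw [map_add, map_sub, h1, h3, h5]; abel
    · rw [h2, sub_smul, h4, h6, map_add, map_sub]; abel

theorem exists_chain_lift (p₀ p : C.Pt) : ∃ γ : C.E → ℤ,
    C.boundary γ = Pi.single (anchor p) 1 - Pi.single (anchor p₀) 1 ∧
      C.lift p₀ p = C.chainInt γ + offset p - offset p₀ := by
  obtain ⟨L, hL⟩ := Classical.choose_spec (C.exists_path p₀ p)
  exact hL.exists_chain

/-- Rank-nullity for the boundary map: by connectedness its image is the kernel of the degree map,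
of rank `|V| - 1`. -/
theorem genus_add_card : C.genus + Fintype.card C.V = Fintype.card C.E + 1 := by
  let σ : (C.V → ℤ) →ₗ[ℤ] ℤ := ∑ v, LinearMap.proj v
  have hσ : ∀ x, σ x = ∑ v, x v := fun x => by simp [σ]
  obtain ⟨v₀⟩ := C.nonempty
  have hsurj : LinearMap.range σ = ⊤ := by
    rw [LinearMap.range_eq_top]
    intro n
    exact ⟨Pi.single v₀ n, by simp [hσ]⟩
  have hrange : LinearMap.range C.boundary = LinearMap.ker σ := by
    apply le_antisymm
    · rintro _ ⟨γ, rfl⟩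
      rw [LinearMap.mem_ker, hσ]
      have := sum_boundary_mul γ (fun _ => (1 : ℤ))
      simpa using this
    · intro x hx
      rw [LinearMap.mem_ker, hσ] at hx
      have h1 : x = ∑ v, x v • ((Pi.single v 1 : C.V → ℤ) - Pi.single v₀ 1) := by
        simp only [smul_sub, Finset.sum_sub_distrib, ← Finset.sum_smul, hx, zero_smul, sub_zero]
        ext w
        simp [Finset.sum_apply, Pi.single_apply]
      rw [h1]
      refine Submodule.sum_mem _ fun v _ => Submodule.smul_mem _ _ ?_
      obtain ⟨γ, h2, -⟩ := exists_chain_lift (Pt.vertex v₀ : C.Pt) (Pt.vertex v)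
      exact ⟨γ, h2⟩
  have h1 := (LinearMap.ker C.boundary).finrank_quotient_add_finrank
  have h2 := (LinearMap.ker σ).finrank_quotient_add_finrank
  rw [LinearEquiv.finrank_eq (LinearMap.quotKerEquivRange _)] at h1 h2
  rw [hsurj] at h2
  rw [hrange] at h1
  simp only [Module.finrank_fintype_fun_eq_card, finrank_top, Module.finrank_self] at h1 h2
  have h3 : C.genus = Module.finrank ℤ (LinearMap.ker C.boundary) := rfl
  omega

/-! ### The Abel-Jacobi map in terms of edges -/

variable (C) in
/-- The projection to the Jacobian. -/
def toJacHom : C.FormDual →+ C.Jac := QuotientAddGroup.mk' _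

theorem toJac_eq (x : C.FormDual) : C.toJac x = C.toJacHom x := rfl

theorem toJacHom_period (c : C.cycles) : C.toJacHom (C.period c) = 0 :=
  (QuotientAddGroup.eq_zero_iff _).2 ⟨c, rfl⟩

theorem toJacHom_chainInt {γ : C.E → ℤ} (h : C.boundary γ = 0) : C.toJacHom (C.chainInt γ) = 0 :=
  toJacHom_period ⟨γ, h⟩

theorem toJac_lift_inner (p₀ : C.Pt) {e : C.E} {x : ℝ} (h : C.IsInner e x) :
    C.toJacHom (C.lift p₀ (C.rpt e x)) =
      C.toJacHom (C.lift p₀ (Pt.vertex (C.src e)) + x • C.coeff e) := by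
  obtain ⟨α, h1, h2⟩ := exists_chain_lift p₀ (C.rpt e x)
  obtain ⟨β, h3, h4⟩ := exists_chain_lift p₀ (Pt.vertex (C.src e))
  have h5 : anchor (C.rpt e x) = C.src e := by rw [h.rpt]; rfl
  have h6 : offset (C.rpt e x) = x • C.coeff e := by
    rw [h.rpt]; simp [offset, ENNReal.toReal_ofReal h.1.le]
  have h7 : C.boundary (α - β) = 0 := by
    rw [map_sub, h1, h3, h5]; simp [anchor]
  rw [← sub_eq_zero, ← map_sub, ← toJacHom_chainInt h7]
  congr 1
  rw [h2, h4, h6, map_sub, offset_vertex]; abel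

theorem toJac_lift_tgt (p₀ : C.Pt) (e : C.E) :
    C.toJacHom (C.lift p₀ (Pt.vertex (C.src e)) + (C.len e).toReal • C.coeff e) =
      C.toJacHom (C.lift p₀ (Pt.vertex (C.tgt e))) := by
  obtain ⟨α, h1, h2⟩ := exists_chain_lift p₀ (Pt.vertex (C.tgt e))
  obtain ⟨β, h3, h4⟩ := exists_chain_lift p₀ (Pt.vertex (C.src e))
  have h7 : C.boundary (β + Pi.single e 1 - α) = 0 := by
    rw [map_sub, map_add, h1, h3, boundary_single]; simp [anchor]
  rw [← sub_eq_zero, ← map_sub, ← toJacHom_chainInt h7]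
  congr 1
  rw [h2, h4, map_sub, map_add, chainInt_single, offset_vertex, offset_vertex]; abel

theorem sum_fiber_smul {A B I J : Type*} [AddCommGroup A] [Ring B] [Module B A] [Fintype I]
    [Fintype J] (π : I → J) (a : I → B) (g : J → A) :
    ∑ v, (∑ e with π e = v, a e) • g v = ∑ e, a e • g (π e) := by
  rw [← Finset.sum_fiberwise Finset.univ π]
  refine Finset.sum_congr rfl fun v _ => ?_
  rw [Finset.sum_smul]
  exact Finset.sum_congr rfl fun e he => by rw [(Finset.mem_filter.1 he).2]

/-- The image under the Abel-Jacobi map and the degree of a divisor whose coefficients come from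
the slopes of a multivalued piecewise linear function. -/
theorem abelJacobi_eq (p₀ : C.Pt) {D : C.Div} {s₀ s₁ k : C.E → ℤ} {Δ : C.E → ℝ}
    (hv : ∀ v, D (Pt.vertex v) =
      ∑ e with C.src e = v, s₀ e - ∑ e with C.tgt e = v, (s₁ e - k e))
    (hdeg : ∀ e, ∑ x ∈ edgeSupp D e, D (C.rpt e x) = s₁ e - s₀ e)
    (hmom : ∀ e, C.len e ≠ ⊤ → ∑ x ∈ edgeSupp D e, x * (D (C.rpt e x) : ℝ) =
      (C.len e).toReal * s₁ e - Δ e) :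
    C.abelJacobi p₀ D =
      C.toJacHom (∑ e, (k e • C.lift p₀ (Pt.vertex (C.tgt e)) - Δ e • C.coeff e)) ∧
    C.deg D = ∑ e, k e := by
  constructor
  · let P : C.V → C.FormDual := fun v => C.lift p₀ (Pt.vertex v)
    have h1 : ∑ v, D (Pt.vertex v) • C.toJacHom (P v) =
        ∑ e, (s₀ e • C.toJacHom (P (C.src e)) -
          (s₁ e - k e) • C.toJacHom (P (C.tgt e))) := by
      rw [Finset.sum_sub_distrib, ← sum_fiber_smul C.src s₀ fun v => C.toJacHom (P v),
        ← sum_fiber_smul C.tgt (fun e => s₁ e - k e) fun v => C.toJacHom (P v),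
        ← Finset.sum_sub_distrib]
      exact Finset.sum_congr rfl fun v _ => by rw [hv, sub_smul]
    have h2 : ∀ e, ∑ x ∈ edgeSupp D e, D (C.rpt e x) • C.toJacHom (C.lift p₀ (C.rpt e x)) =
        (s₁ e - s₀ e) • C.toJacHom (P (C.src e)) +
          C.toJacHom (((C.len e).toReal * s₁ e - Δ e) • C.coeff e) := by
      intro e
      have h3 : ∀ x ∈ edgeSupp D e, D (C.rpt e x) • C.toJacHom (C.lift p₀ (C.rpt e x)) =
          D (C.rpt e x) • C.toJacHom (P (C.src e)) +
            C.toJacHom ((x * (D (C.rpt e x) : ℝ)) • C.coeff e) := by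
        intro x hx
        rw [toJac_lift_inner p₀ (mem_edgeSupp.1 hx).1, map_add, smul_add, ← map_zsmul C.toJacHom
          _ (x • C.coeff e), mul_comm, mul_smul, Int.cast_smul_eq_zsmul]
      rw [Finset.sum_congr rfl h3, Finset.sum_add_distrib, ← Finset.sum_smul, hdeg, ← map_sum,
        ← Finset.sum_smul]
      by_cases hl : C.len e = ⊤
      · simp [coeff_eq_zero hl]
      · rw [hmom e hl]
    have h4 := sum_div D (fun p => C.toJacHom (C.lift p₀ p))
    refine Eq.trans h4 ?_
    change ∑ v, D (Pt.vertex v) • C.toJacHom (P v) + _ = _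
    rw [h1, Finset.sum_congr rfl fun e _ => h2 e, ← Finset.sum_add_distrib, map_sum]
    refine Finset.sum_congr rfl fun e _ => ?_
    -- Modulo periods the whole edge is the difference of the lifts of its ends. This may be
    -- multiplied by `s₁` because `s₁` is an integer.
    have h5 : C.toJacHom ((s₁ e : ℝ) • ((C.len e).toReal • C.coeff e)) =
        s₁ e • (C.toJacHom (P (C.tgt e)) - C.toJacHom (P (C.src e))) := by
      rw [← toJac_lift_tgt, Int.cast_smul_eq_zsmul, map_zsmul, map_add, add_sub_cancel_left]
    rw [sub_smul ((C.len e).toReal * (s₁ e : ℝ)), map_sub, map_sub, mul_comm, mul_smul, h5,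
      map_zsmul]
    change _ = k e • C.toJacHom (P (C.tgt e)) - _
    module
  · rw [deg_eq, Finset.sum_congr rfl fun e _ => hdeg e]
    have h1 := sum_fiber_smul C.src s₀ (fun _ => (1 : ℤ))
    have h2 := sum_fiber_smul C.tgt (fun e => s₁ e - k e) (fun _ => (1 : ℤ))
    simp only [smul_eq_mul, mul_one] at h1 h2
    simp only [hv]
    rw [Finset.sum_sub_distrib, h1, h2, ← Finset.sum_sub_distrib, ← Finset.sum_add_distrib]
    exact Finset.sum_congr rfl fun e _ => by ring

/-- The easy half of Abel's theorem: a single-valued function has no jumps between branches, and its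
increments form a differential, which integrates to zero. -/
theorem IsDivisorOf.abelJacobi_eq_zero {f : C.Pt → ℝ} {D : C.Div} (h : IsDivisorOf f D)
    (p₀ : C.Pt) : C.abelJacobi p₀ D = 0 ∧ C.deg D = 0 := by
  obtain ⟨m, hm, hD⟩ := h
  have hs := sum_edge hm (fun e x _ => hD (C.rpt e x))
  obtain ⟨h1, h2⟩ := abelJacobi_eq p₀ (D := D) (s₀ := fun e => m _ (C.dirSrc e))
    (s₁ := fun e => -m _ (C.dirTgt e)) (k := 0)
    (Δ := fun e => f (Pt.vertex (C.tgt e)) - f (Pt.vertex (C.src e)))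
    (fun v => by rw [hD, sum_dir_vertex]; simp) (fun e => (hs e).1)
    (fun e he => by rw [(hs e).2 he]; push_cast; ring)
  refine ⟨?_, by rw [h2]; simp⟩
  rw [h1]
  simp only [Pi.zero_apply, zero_smul, zero_sub, Finset.sum_neg_distrib]
  rw [sum_differential (fun v => f (Pt.vertex v)), neg_zero, map_zero]

end

section

variable {C : TropicalCurve}

/-! ### Distances -/

theorem IsPath.trans {p q r : C.Pt} {φ ψ : C.FormDual} {L M : ENNReal} (h : C.IsPath p q φ L)
    (h' : C.IsPath q r ψ M) : C.IsPath p r (φ + ψ) (L + M) := by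
  induction h with
  | nil p => simpa using h'
  | cons e s t hs ht h ih =>
    rw [add_assoc, add_assoc]
    exact IsPath.cons e s t hs ht (ih h')

theorem isPath_segment (e : C.E) {s t : ENNReal} (hs : s ≤ C.len e) (ht : t ≤ C.len e) :
    ∃ φ, C.IsPath (C.pt e s) (C.pt e t) φ ((t - s) + (s - t)) := by
  have := IsPath.cons e s t hs ht (IsPath.nil _)
  rw [add_zero, add_zero] at this
  exact ⟨_, this⟩

theorem dist_le {p q : C.Pt} {φ : C.FormDual} {L : ENNReal} (h : C.IsPath p q φ L) :
    C.dist p q ≤ L := sInf_le ⟨φ, h⟩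

theorem dist_self (p : C.Pt) : C.dist p p = 0 :=
  le_antisymm (dist_le (IsPath.nil p)) zero_le

theorem dist_triangle (p q r : C.Pt) : C.dist p r ≤ C.dist p q + C.dist q r := by
  unfold dist
  rw [ENNReal.sInf_add]
  refine le_iInf₂ fun L hL => ?_
  rw [add_comm, ENNReal.sInf_add]
  refine le_iInf₂ fun M hM => ?_
  obtain ⟨φ, hφ⟩ := hL
  obtain ⟨ψ, hψ⟩ := hM
  rw [add_comm]
  exact sInf_le ⟨_, hφ.trans hψ⟩

theorem dist_segment (e : C.E) {s t : ENNReal} (hs : s ≤ C.len e) (ht : t ≤ C.len e) :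
    C.dist (C.pt e s) (C.pt e t) ≤ (t - s) + (s - t) := by
  obtain ⟨φ, h⟩ := isPath_segment e hs ht
  exact dist_le h

theorem distSet_segment (S : Set C.Pt) (e : C.E) {s t : ENNReal} (hs : s ≤ C.len e)
    (ht : t ≤ C.len e) : C.distSet S (C.pt e t) ≤ C.distSet S (C.pt e s) + ((t - s) + (s - t)) := by
  simp only [distSet, ENNReal.iInf_add]
  refine le_iInf₂ fun p hp => ?_
  exact (iInf₂_le p hp).trans ((dist_triangle _ _ _).trans (by gcongr; exact dist_segment e hs ht))

theorem distSet_of_mem {S : Set C.Pt} {p : C.Pt} (hp : p ∈ S) : C.distSet S p = 0 :=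
  le_antisymm ((iInf₂_le p hp).trans (dist_self p).le) zero_le

/-- A path that ends on the edge `e` starts on this edge or passes through one of its ends. -/
theorem IsPath.trichotomy {p q : C.Pt} {φ : C.FormDual} {L : ENNReal} (h : C.IsPath p q φ L)
    (e : C.E) (t : ENNReal) (hq : q = C.pt e t) (ht : t ≤ C.len e) :
    (∃ s ≤ C.len e, p = C.pt e s ∧ (t - s) + (s - t) ≤ L) ∨
      C.dist p (Pt.vertex (C.src e)) + t ≤ L ∨
      C.dist p (Pt.vertex (C.tgt e)) + (C.len e - t) ≤ L := by
  induction h with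
  | nil p => exact Or.inl ⟨t, ht, hq, by simp⟩
  | @cons e' s' t' hs' ht' q φ L h ih =>
    have step : ∀ r, C.dist (C.pt e' s') r ≤ (t' - s') + (s' - t') + C.dist (C.pt e' t') r :=
      fun r => (dist_triangle _ _ _).trans (by gcongr; exact dist_segment e' hs' ht')
    rcases ih hq with ⟨s, hs, h1, h2⟩ | h1 | h1
    · rcases eq_or_lt_of_le (zero_le : 0 ≤ s) with h3 | h3
      · right; left
        rw [← h3, pt_zero] at h1
        have h4 := step (Pt.vertex (C.src e))
        rw [h1, dist_self, add_zero] at h4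
        rw [← h3] at h2
        simp only [tsub_zero, zero_tsub, add_zero] at h2
        exact add_le_add h4 h2
      rcases eq_or_lt_of_le hs with h4 | h4
      · right; right
        rw [h4, pt_len] at h1
        have h5 := step (Pt.vertex (C.tgt e))
        rw [h1, dist_self, add_zero] at h5
        rw [h4, tsub_eq_zero_of_le ht, zero_add] at h2
        exact add_le_add h5 h2
      · left
        rw [pt_inner h3 h4] at h1
        -- An interior point lies on one edge only, so the preceding segment runs along `e` too and
        -- the two segments can be merged.
        have h5 : e' = e ∧ t' = s := by
          unfold pt at h1
          split_ifs at h1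
          injection h1 with h5 h6
          exact ⟨h5, h6⟩
        obtain ⟨rfl, rfl⟩ := h5
        refine ⟨s', hs', rfl, ?_⟩
        calc (t - s') + (s' - t) ≤ ((t - t') + (t' - s')) + ((s' - t') + (t' - t)) :=
              add_le_add tsub_le_tsub_add_tsub tsub_le_tsub_add_tsub
          _ = (t' - s') + (s' - t') + ((t - t') + (t' - t)) := by ring
          _ ≤ _ := by gcongr
    · right; left
      exact (add_le_add_left (step _) _).trans (by rw [add_assoc]; gcongr)
    · right; right
      exact (add_le_add_left (step _) _).trans (by rw [add_assoc]; gcongr)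

/-- By `IsPath.trichotomy`, a path from `S` to a point of `e` either starts on `e` or enters through
an end, so three lower bounds suffice. -/
theorem le_distSet {S : Set C.Pt} {e : C.E} {t B : ENNReal} (ht : t ≤ C.len e)
    (h1 : ∀ s ≤ C.len e, C.pt e s ∈ S → B ≤ (t - s) + (s - t))
    (h2 : B ≤ C.distSet S (Pt.vertex (C.src e)) + t)
    (h3 : B ≤ C.distSet S (Pt.vertex (C.tgt e)) + (C.len e - t)) :
    B ≤ C.distSet S (C.pt e t) := by
  refine le_iInf₂ fun p hp => le_sInf ?_
  rintro L ⟨φ, h⟩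
  rcases h.trichotomy e t rfl ht with ⟨s, hs, rfl, h4⟩ | h4 | h4
  · exact (h1 s hs hp).trans h4
  · exact (h2.trans (add_le_add_left (iInf₂_le p hp) _)).trans h4
  · exact (h3.trans (add_le_add_left (iInf₂_le p hp) _)).trans h4

/-! ### Points at infinity and finiteness of distances -/

theorem atInfinity_vertex {v : C.V} :
    C.AtInfinity (Pt.vertex v) ↔ ∃ e, C.len e = ⊤ ∧ C.tgt e = v := by
  have h : C.valence (Pt.vertex v) =
      Nat.card {e' // C.src e' = v} + Nat.card {e' // C.tgt e' = v} := by
    rw [Nat.card_eq_fintype_card, Nat.card_eq_fintype_card]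
    exact Fintype.card_sum
  unfold AtInfinity
  rw [h]
  constructor
  · intro h1
    have : 0 < Nat.card {e' // C.src e' = v} ∨ 0 < Nat.card {e' // C.tgt e' = v} := by omega
    rcases this with h2 | h2
    · obtain ⟨⟨e, rfl⟩, -⟩ := Nat.card_pos_iff.1 h2
      exact absurd h1 (C.src_valence_ne_one e)
    · obtain ⟨⟨e, rfl⟩, -⟩ := Nat.card_pos_iff.1 h2
      exact ⟨e, (C.len_eq_top_iff e).2 h1, rfl⟩
  · rintro ⟨e, he, rfl⟩
    exact (C.len_eq_top_iff e).1 he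

theorem not_atInfinity_src (e : C.E) : ¬ C.AtInfinity (Pt.vertex (C.src e)) := by
  rw [atInfinity_vertex]
  rintro ⟨e', h, h'⟩
  exact (leaf_edges h).1 e h'.symm

theorem not_atInfinity_tgt {e : C.E} (h : C.len e ≠ ⊤) : ¬ C.AtInfinity (Pt.vertex (C.tgt e)) := by
  rw [atInfinity_vertex]
  rintro ⟨e', h1, h2⟩
  exact h ((leaf_edges h1).2 e h2.symm ▸ h1)

theorem not_atInfinity_inner {e : C.E} {t : ENNReal} (h0 : 0 < t) (h1 : t < C.len e) :
    ¬ C.AtInfinity (Pt.inner e t h0 h1) := by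
  have : C.valence (Pt.inner e t h0 h1) = 2 := Fintype.card_bool
  simp [AtInfinity, this]

theorem not_atInfinity_rpt {e : C.E} {x : ℝ} (h : ENNReal.ofReal x ≤ C.len e) :
    ¬ C.AtInfinity (C.rpt e x) := by
  unfold rpt pt
  split_ifs with h1 h2
  · exact not_atInfinity_inner h1 h2
  · exact not_atInfinity_tgt ((le_antisymm (not_lt.1 h2) h) ▸ ENNReal.ofReal_ne_top)
  · exact not_atInfinity_src e

theorem exists_not_atInfinity : ∃ v : C.V, ¬ C.AtInfinity (Pt.vertex v) := by
  obtain ⟨v⟩ := C.nonempty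
  by_cases h : C.AtInfinity (Pt.vertex v)
  · obtain ⟨e, -⟩ := atInfinity_vertex.1 h
    exact ⟨_, not_atInfinity_src e⟩
  · exact ⟨v, h⟩

/-- The nearest vertex that is not at infinity. -/
def core (v : C.V) : C.V :=
  if h : ∃ e, C.len e = ⊤ ∧ C.tgt e = v then C.src h.choose else v

theorem core_of_not_atInfinity {v : C.V} (h : ¬ C.AtInfinity (Pt.vertex v)) : core v = v := by
  rw [atInfinity_vertex] at h
  rw [core, dif_neg h]

theorem core_tgt {e : C.E} (h : C.len e = ⊤) : core (C.tgt e) = C.src e := by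
  have h1 : ∃ e', C.len e' = ⊤ ∧ C.tgt e' = C.tgt e := ⟨e, h, rfl⟩
  rw [core, dif_pos h1, (leaf_edges h).2 _ h1.choose_spec.2]

/-- Pushing each vertex at infinity back along its edge turns a connecting chain of edges into one
of finite length: an infinite edge becomes a constant step. -/
theorem dist_core_ne_top (u v : C.V) : C.dist (Pt.vertex (core u)) (Pt.vertex (core v)) ≠ ⊤ := by
  suffices h : C.dist (Pt.vertex (core u)) (Pt.vertex (core v)) ≠ ⊤ ∧
      C.dist (Pt.vertex (core v)) (Pt.vertex (core u)) ≠ ⊤ from h.1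
  induction C.connected u v with
  | rel a b h =>
    obtain ⟨e, rfl, rfl⟩ := h
    rw [core_of_not_atInfinity (not_atInfinity_src e)]
    by_cases hl : C.len e = ⊤
    · rw [core_tgt hl, dist_self]; simp
    · rw [core_of_not_atInfinity (not_atInfinity_tgt hl), ← pt_zero, ← pt_len]
      constructor
      · exact ne_top_of_le_ne_top (by simp [hl]) (dist_segment e zero_le le_rfl)
      · exact ne_top_of_le_ne_top (by simp [hl]) (dist_segment e le_rfl zero_le)
  | refl a => rw [dist_self]; simp
  | symm a b _ ih => exact ih.symm
  | trans a b c _ _ h1 h2 =>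
    exact ⟨ne_top_of_le_ne_top (ENNReal.add_ne_top.2 ⟨h1.1, h2.1⟩) (dist_triangle _ _ _),
      ne_top_of_le_ne_top (ENNReal.add_ne_top.2 ⟨h2.2, h1.2⟩) (dist_triangle _ _ _)⟩

theorem dist_ne_top {p q : C.Pt} (hp : ¬ C.AtInfinity p) (hq : ¬ C.AtInfinity q) :
    C.dist p q ≠ ⊤ := by
  have key : ∀ p : C.Pt, ¬ C.AtInfinity p → ∃ v, ¬ C.AtInfinity (Pt.vertex v) ∧
      C.dist p (Pt.vertex v) ≠ ⊤ ∧ C.dist (Pt.vertex v) p ≠ ⊤ := by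
    rintro (v | ⟨e, t, h0, h1⟩) hp
    · exact ⟨v, hp, by simp [dist_self]⟩
    · have ht : t ≠ ⊤ := (h1.trans_le le_top).ne
      refine ⟨C.src e, not_atInfinity_src e, ?_⟩
      rw [← pt_inner h0 h1, ← pt_zero]
      constructor
      · exact ne_top_of_le_ne_top (by simp [ht]) (dist_segment e h1.le zero_le)
      · exact ne_top_of_le_ne_top (by simp [ht]) (dist_segment e zero_le h1.le)
  obtain ⟨u, hu, hu', -⟩ := key p hp
  obtain ⟨v, hv, -, hv'⟩ := key q hq
  have huv := dist_core_ne_top u v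
  rw [core_of_not_atInfinity hu, core_of_not_atInfinity hv] at huv
  exact ne_top_of_le_ne_top
    (ENNReal.add_ne_top.2 ⟨hu', ENNReal.add_ne_top.2 ⟨huv, hv'⟩⟩)
    ((dist_triangle _ _ _).trans (by gcongr; exact dist_triangle _ _ _))

/-- The segment that first reaches `q` starts at a finite coordinate of an infinite edge and so is
infinitely long. -/
theorem IsPath.length_eq_top {p q : C.Pt} {φ : C.FormDual} {L : ENNReal} (h : C.IsPath p q φ L)
    (hq : C.AtInfinity q) (hp : p ≠ q) : L = ⊤ := by
  induction h with
  | nil p => exact absurd rfl hp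
  | @cons e s t hs ht q φ L h ih =>
    by_cases h1 : C.pt e t = q
    · have h2 : C.len e = ⊤ ∧ t = ⊤ := by
        rw [← h1] at hq
        unfold pt at hq
        split_ifs at hq with h2 h3
        · exact absurd hq (not_atInfinity_inner h2 h3)
        · have hl : C.len e = ⊤ := by
            by_contra hl
            exact not_atInfinity_tgt hl hq
          exact ⟨hl, top_le_iff.1 (hl ▸ not_lt.1 h3)⟩
        · exact absurd hq (not_atInfinity_src e)
      have h3 : s ≠ ⊤ := by
        rintro rfl
        rw [h2.2] at h1
        exact hp h1
      simp [h2.2, ENNReal.top_sub h3]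
    · rw [ih hq h1, add_top]

variable {S : Set C.Pt}

theorem distSet_atInfinity (hS : ∀ p ∈ S, ¬ C.AtInfinity p) {q : C.Pt} (hq : C.AtInfinity q) :
    C.distSet S q = ⊤ := by
  refine top_le_iff.1 (le_iInf₂ fun p hp => le_sInf ?_)
  rintro L ⟨φ, h⟩
  rw [h.length_eq_top hq (fun h => hS p hp (h ▸ hq))]

theorem distSet_ne_top (hS : ∀ p ∈ S, ¬ C.AtInfinity p) (hne : S.Nonempty) {q : C.Pt}
    (hq : ¬ C.AtInfinity q) : C.distSet S q ≠ ⊤ := by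
  obtain ⟨p, hp⟩ := hne
  exact ne_top_of_le_ne_top (dist_ne_top (hS p hp) hq) (iInf₂_le p hp)

variable (S) in
/-- The distance to `S` as a real number. -/
def rdist (p : C.Pt) : ℝ := (C.distSet S p).toReal

theorem rdist_nonneg (p : C.Pt) : 0 ≤ rdist S p := ENNReal.toReal_nonneg

theorem rdist_of_mem {p : C.Pt} (hp : p ∈ S) : rdist S p = 0 := by
  simp [rdist, distSet_of_mem hp]

theorem ofReal_abs_sub {x y : ℝ} (hx : 0 ≤ x) (hy : 0 ≤ y) :
    (ENNReal.ofReal x - ENNReal.ofReal y) + (ENNReal.ofReal y - ENNReal.ofReal x) =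
      ENNReal.ofReal |x - y| := by
  rw [← ENNReal.ofReal_sub _ hy, ← ENNReal.ofReal_sub _ hx]
  rcases le_total x y with h | h
  · rw [ENNReal.ofReal_of_nonpos (by linarith : x - y ≤ 0), zero_add, abs_of_nonpos (by linarith)]
    ring_nf
  · rw [ENNReal.ofReal_of_nonpos (by linarith : y - x ≤ 0), add_zero, abs_of_nonneg (by linarith)]

theorem rdist_lipschitz (hS : ∀ p ∈ S, ¬ C.AtInfinity p) (hne : S.Nonempty) {e : C.E} {x y : ℝ}
    (hx : 0 ≤ x) (hx' : ENNReal.ofReal x ≤ C.len e) (hy : 0 ≤ y)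
    (hy' : ENNReal.ofReal y ≤ C.len e) :
    rdist S (C.rpt e x) ≤ rdist S (C.rpt e y) + |x - y| := by
  have h := distSet_segment S e hy' hx'
  rw [ofReal_abs_sub hx hy] at h
  have h1 := distSet_ne_top hS hne (not_atInfinity_rpt hy')
  have h2 := ENNReal.toReal_mono (ENNReal.add_ne_top.2 ⟨h1, ENNReal.ofReal_ne_top⟩) h
  rwa [ENNReal.toReal_add h1 ENNReal.ofReal_ne_top, ENNReal.toReal_ofReal (abs_nonneg _)] at h2

/-- On an edge, the distance to `S` is a minimum of finitely many simple functions. -/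
theorem exists_rdist_eq_min (hfin : S.Finite) (hS : ∀ p ∈ S, ¬ C.AtInfinity p) (hne : S.Nonempty)
    (e : C.E) : ∃ G : Finset (ℝ → ℝ), G.Nonempty ∧
      (∀ g ∈ G, (∃ s, C.rpt e s ∈ S ∧ g = fun y => |y - s|) ∨ (∃ c, g = fun y => c + y) ∨
        (C.len e ≠ ⊤ ∧ ∃ c, g = fun y => c - y)) ∧
      ∀ x : ℝ, 0 ≤ x → ENNReal.ofReal x ≤ C.len e →
        (∀ g ∈ G, rdist S (C.rpt e x) ≤ g x) ∧ ∃ g ∈ G, rdist S (C.rpt e x) = g x := by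
  have hA : {s : ℝ | (0 ≤ s ∧ ENNReal.ofReal s ≤ C.len e) ∧ C.rpt e s ∈ S}.Finite := by
    have h1 : {s : ℝ | C.IsInner e s ∧ C.rpt e s ∈ S}.Finite := by
      refine Set.Finite.of_finite_image (f := C.rpt e) (hfin.subset ?_) ?_
      · rintro _ ⟨x, hx, rfl⟩; exact hx.2
      · intro x hx y hy h
        exact (hx.1.rpt_inj hy.1 h).2
    refine (h1.union (Set.toFinite {0, (C.len e).toReal})).subset ?_
    rintro s ⟨⟨h2, h3⟩, h4⟩
    rcases eq_or_lt_of_le h2 with h5 | h5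
    · right; left; exact h5.symm
    rcases eq_or_lt_of_le h3 with h6 | h6
    · right; right
      rw [← h6, ENNReal.toReal_ofReal h2]; rfl
    · exact Or.inl ⟨⟨h5, h6⟩, h4⟩
  have hlip := fun {x y : ℝ} => rdist_lipschitz hS hne (e := e) (x := x) (y := y)
  -- The candidates are arrival through the source (`g0`), arrival through the target (`g1`, only on
  -- a finite edge), and direct arrival from a point of `S` on the edge.
  let g0 : ℝ → ℝ := fun y => rdist S (C.rpt e 0) + y
  let g1 : ℝ → ℝ := fun y => (rdist S (Pt.vertex (C.tgt e)) + (C.len e).toReal) - y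
  let G : Finset (ℝ → ℝ) := insert g0 (hA.toFinset.image (fun s y => |y - s|) ∪
    if C.len e = ⊤ then ∅ else {g1})
  refine ⟨G, ⟨g0, by simp [G]⟩, ?_, ?_⟩
  · intro g hg
    rcases Finset.mem_insert.1 hg with rfl | hg
    · exact Or.inr (Or.inl ⟨_, rfl⟩)
    rcases Finset.mem_union.1 hg with hg | hg
    · obtain ⟨s, hs, rfl⟩ := Finset.mem_image.1 hg
      exact Or.inl ⟨s, (hA.mem_toFinset.1 hs).2, rfl⟩
    · split_ifs at hg with hl
      · simp at hg
      · rw [Finset.mem_singleton] at hg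
        exact Or.inr (Or.inr ⟨hl, _, hg⟩)
  · intro x hx hx'
    have hle : ∀ g ∈ G, rdist S (C.rpt e x) ≤ g x := by
      intro g hg
      rcases Finset.mem_insert.1 hg with rfl | hg
      · have := hlip hx hx' le_rfl (by simp)
        rwa [sub_zero, abs_of_nonneg hx] at this
      rcases Finset.mem_union.1 hg with hg | hg
      · obtain ⟨s, hs, rfl⟩ := Finset.mem_image.1 hg
        obtain ⟨⟨h1, h2⟩, h3⟩ := hA.mem_toFinset.1 hs
        have := hlip hx hx' h1 h2
        rwa [rdist_of_mem h3, zero_add] at this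
      · split_ifs at hg with hl
        · simp at hg
        · rw [Finset.mem_singleton] at hg
          have h1 := hlip hx hx' ENNReal.toReal_nonneg (ENNReal.ofReal_toReal hl).le
          rw [rpt_len hl, abs_of_nonpos] at h1
          · rw [hg]; simp only [g1]; linarith
          · have := ENNReal.toReal_mono hl hx'
            rw [ENNReal.toReal_ofReal hx] at this
            linarith
    refine ⟨hle, ?_⟩
    obtain ⟨g, hg, hmin⟩ := G.exists_min_image (fun g => g x) ⟨g0, by simp [G]⟩
    refine ⟨g, hg, le_antisymm (hle g hg) ?_⟩
    have hpos : 0 ≤ g x := (rdist_nonneg _).trans (hle g hg)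
    rw [rdist, ← ENNReal.ofReal_le_iff_le_toReal
      (distSet_ne_top hS hne (not_atInfinity_rpt hx'))]
    refine le_distSet hx' ?_ ?_ ?_
    · intro s hs hsS
      by_cases hst : s = ⊤
      · subst hst
        simp
      obtain ⟨s, h0, rfl⟩ : ∃ r, 0 ≤ r ∧ s = ENNReal.ofReal r :=
        ⟨s.toReal, ENNReal.toReal_nonneg, (ENNReal.ofReal_toReal hst).symm⟩
      rw [ofReal_abs_sub hx h0]
      refine ENNReal.ofReal_le_ofReal (hmin (fun y => |y - s|) ?_)
      exact Finset.mem_insert_of_mem (Finset.mem_union_left _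
        (Finset.mem_image_of_mem _ (hA.mem_toFinset.2 ⟨⟨h0, hs⟩, hsS⟩)))
    · have h1 := hmin g0 (by simp [G])
      have h2 : C.distSet S (Pt.vertex (C.src e)) = ENNReal.ofReal (rdist S (C.rpt e 0)) := by
        rw [rdist, rpt_zero, ENNReal.ofReal_toReal (distSet_ne_top hS hne (not_atInfinity_src e))]
      rw [h2, ← ENNReal.ofReal_add (rdist_nonneg _) hx]
      exact ENNReal.ofReal_le_ofReal h1
    · by_cases hl : C.len e = ⊤
      · simp [hl]
      · have h1 := hmin g1 (by simp [G, hl])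
        have h2 : C.distSet S (Pt.vertex (C.tgt e)) =
            ENNReal.ofReal (rdist S (Pt.vertex (C.tgt e))) := by
          rw [rdist, ENNReal.ofReal_toReal (distSet_ne_top hS hne (not_atInfinity_tgt hl))]
        have h3 : x ≤ (C.len e).toReal := by
          have := ENNReal.toReal_mono hl hx'
          rwa [ENNReal.toReal_ofReal hx] at this
        have h4 : C.len e - ENNReal.ofReal x = ENNReal.ofReal ((C.len e).toReal - x) := by
          rw [ENNReal.ofReal_sub _ hx, ENNReal.ofReal_toReal hl]
        rw [h2, h4, ← ENNReal.ofReal_add (rdist_nonneg _) (by linarith)]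
        refine ENNReal.ofReal_le_ofReal (h1.trans ?_)
        simp only [g1]; linarith

end

section

variable {C : TropicalCurve} {S : Set C.Pt}

/-! ### Slopes of distance functions -/

theorem slope_abs (s x : ℝ) {σ : ℝ} (hσ : σ = 1 ∨ σ = -1) :
    ∃ m : ℤ, (m = 1 ∨ m = -1) ∧ Slope (fun y => |y - s|) x σ m := by
  rcases hσ with rfl | rfl
  · by_cases h : s ≤ x
    · refine ⟨1, by simp, slope_one_iff.2 ?_⟩
      filter_upwards [self_mem_nhdsWithin] with y hy
      have hy : x < y := hy
      rw [abs_of_nonneg (by linarith), abs_of_nonneg (by linarith)]; push_cast; ring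
    · refine ⟨-1, by simp, slope_one_iff.2 ?_⟩
      filter_upwards [Ioo_mem_nhdsGT (not_le.1 h)] with y hy
      rw [abs_of_nonpos (by linarith [hy.2]), abs_of_nonpos (by linarith [hy.1, hy.2])]
      push_cast; ring
  · by_cases h : x ≤ s
    · refine ⟨1, by simp, slope_neg_one_iff.2 ?_⟩
      filter_upwards [self_mem_nhdsWithin] with y hy
      have hy : y < x := hy
      rw [abs_of_nonpos (by linarith), abs_of_nonpos (by linarith)]; push_cast; ring
    · refine ⟨-1, by simp, slope_neg_one_iff.2 ?_⟩
      filter_upwards [Ioo_mem_nhdsLT (not_le.1 h)] with y hy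
      rw [abs_of_nonneg (by linarith [hy.1]), abs_of_nonneg (by linarith [hy.1, hy.2])]
      push_cast; ring

/-- A minimum of finitely many germs has the slope of one of them, and every candidate has slope
`±1`. -/
theorem rdist_slope (hfin : S.Finite) (hS : ∀ p ∈ S, ¬ C.AtInfinity p) (hne : S.Nonempty)
    (e : C.E) {x σ : ℝ} (hσ : σ = 1 ∨ σ = -1)
    (hv : ∀ᶠ h in 𝓝[≥] (0 : ℝ), 0 ≤ x + σ * h ∧ ENNReal.ofReal (x + σ * h) ≤ C.len e) :
    ∃ m : ℤ, (m = 1 ∨ m = -1) ∧ Slope (fun y => rdist S (C.rpt e y)) x σ m := by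
  obtain ⟨G, hG, h1, h2⟩ := exists_rdist_eq_min hfin hS hne e
  have h3 : ∀ g ∈ G, ∃ m : ℤ, (m = 1 ∨ m = -1) ∧ Slope g x σ m := by
    intro g hg
    rcases h1 g hg with ⟨s, -, rfl⟩ | ⟨c, rfl⟩ | ⟨-, c, rfl⟩
    · exact slope_abs s x hσ
    · rcases hσ with rfl | rfl
      · exact ⟨1, by simp, Eventually.of_forall fun h => by push_cast; ring⟩
      · exact ⟨-1, by simp, Eventually.of_forall fun h => by push_cast; ring⟩
    · rcases hσ with rfl | rfl
      · exact ⟨-1, by simp, Eventually.of_forall fun h => by push_cast; ring⟩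
      · exact ⟨1, by simp, Eventually.of_forall fun h => by push_cast; ring⟩
  choose! m hm hm' using h3
  obtain ⟨g, hg, hs⟩ := exists_slope_of_min G hG (f := fun g => g) (m := fun g => (m g : ℝ)) hm'
    (φ := fun y => rdist S (C.rpt e y))
    (hv.mono fun h hh => (h2 _ hh.1 hh.2).1) (hv.mono fun h hh => (h2 _ hh.1 hh.2).2)
  exact ⟨m g, hm g hg, hs⟩

/-- Far out on an infinite edge every candidate has the form `c + y`, and the one with the least
constant wins. -/
theorem rdist_eventually_top (hfin : S.Finite) (hS : ∀ p ∈ S, ¬ C.AtInfinity p)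
    (hne : S.Nonempty) {e : C.E} (hl : C.len e = ⊤) :
    ∃ c : ℝ, ∀ᶠ y in atTop, rdist S (C.rpt e y) = c + y := by
  obtain ⟨G, hG, h1, h2⟩ := exists_rdist_eq_min hfin hS hne e
  have h3 : ∀ g ∈ G, ∃ c : ℝ, ∀ᶠ y in atTop, g y = c + y := by
    intro g hg
    rcases h1 g hg with ⟨s, -, rfl⟩ | ⟨c, rfl⟩ | ⟨h, -⟩
    · refine ⟨-s, ?_⟩
      filter_upwards [eventually_ge_atTop s] with y hy
      rw [abs_of_nonneg (by linarith)]; ring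
    · exact ⟨c, Eventually.of_forall fun y => rfl⟩
    · exact absurd hl h
  choose! c hc using h3
  obtain ⟨g, hg, hmin⟩ := exists_eventually_le (F := atTop) G hG (fun g => g) (by
    intro i hi j hj
    rcases le_total (c i) (c j) with h | h
    · left
      filter_upwards [hc i hi, hc j hj] with y a b
      rw [a, b]; linarith
    · right
      filter_upwards [hc i hi, hc j hj] with y a b
      rw [a, b]; linarith)
  refine ⟨c g, ?_⟩
  filter_upwards [hmin, hc g hg, eventually_ge_atTop 0] with y a b hy
  obtain ⟨h4, j, hj, h5⟩ := h2 y hy (by rw [hl]; exact le_top)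
  rw [← b]
  exact le_antisymm (h4 g hg) (h5 ▸ a j hj)

theorem eventually_valid_pos {e : C.E} {x : ℝ} (h0 : 0 ≤ x) (h1 : ENNReal.ofReal x < C.len e) :
    ∀ᶠ h in 𝓝[≥] (0 : ℝ), 0 ≤ x + 1 * h ∧ ENNReal.ofReal (x + 1 * h) ≤ C.len e := by
  have h2 : ∀ᶠ h in 𝓝 (0 : ℝ), ENNReal.ofReal (x + 1 * h) < C.len e := by
    have : ContinuousAt (fun h : ℝ => ENNReal.ofReal (x + 1 * h)) 0 :=
      (ENNReal.continuous_ofReal.comp (by fun_prop)).continuousAt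
    exact this.eventually_lt continuousAt_const (by simpa using h1)
  filter_upwards [h2.filter_mono nhdsWithin_le_nhds, self_mem_nhdsWithin] with h a b
  have b : 0 ≤ h := b
  exact ⟨by linarith, a.le⟩

theorem eventually_valid_neg {e : C.E} {x : ℝ} (h0 : 0 < x) (h1 : ENNReal.ofReal x ≤ C.len e) :
    ∀ᶠ h in 𝓝[≥] (0 : ℝ), 0 ≤ x + -1 * h ∧ ENNReal.ofReal (x + -1 * h) ≤ C.len e := by
  filter_upwards [Ico_mem_nhdsGE h0] with h hh
  exact ⟨by linarith [hh.2],
    (ENNReal.ofReal_le_ofReal (by linarith [hh.1])).trans h1⟩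

theorem Dir.eventually_valid : ∀ (p : C.Pt) (ξ : C.Dir p), ξ.coord ≠ ⊤ →
    ∀ᶠ h in 𝓝[≥] (0 : ℝ), 0 ≤ ξ.coord.toReal + ξ.sgn * h ∧
      ENNReal.ofReal (ξ.coord.toReal + ξ.sgn * h) ≤ C.len ξ.edge := by
  intro p ξ h
  by_cases hf : ξ.fwd = true
  · have h1 := ξ.coord_lt_of_fwd hf
    rw [show ξ.sgn = 1 from if_pos hf]
    exact eventually_valid_pos ENNReal.toReal_nonneg (by rwa [ENNReal.ofReal_toReal h])
  · rw [show ξ.sgn = -1 from if_neg hf]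
    exact eventually_valid_neg (ENNReal.toReal_pos (ξ.coord_pos_of_not_fwd hf).ne' h)
      (by rw [ENNReal.ofReal_toReal h]; exact ξ.coord_le)

theorem Dir.not_atInfinity {p : C.Pt} (ξ : C.Dir p) (h : ξ.coord ≠ ⊤) : ¬ C.AtInfinity p := by
  rw [← ξ.rpt_coord h]
  exact not_atInfinity_rpt (by rw [ENNReal.ofReal_toReal h]; exact ξ.coord_le)

theorem Dir.atInfinity {p : C.Pt} (ξ : C.Dir p) (h : ξ.coord = ⊤) : C.AtInfinity p := by
  obtain ⟨h1, -, h2⟩ := ξ.coord_eq_top h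
  rw [h2, atInfinity_vertex]
  exact ⟨_, h1, rfl⟩

/-- The slopes of the distance function are `±1`, according to the gradient orientation. -/
theorem exists_rdist_slope (hfin : S.Finite) (hS : ∀ p ∈ S, ¬ C.AtInfinity p) (hne : S.Nonempty)
    (p : C.Pt) (ξ : C.Dir p) : ∃ m : ℤ, HasSlope (rdist S) ξ m ∧
      ((m = 1 ∧ Outgoing S ξ ∧ ¬ Incoming S ξ) ∨ (m = -1 ∧ ¬ Outgoing S ξ ∧ Incoming S ξ)) := by
  by_cases h : ξ.coord = ⊤
  · obtain ⟨hl, -, -⟩ := ξ.coord_eq_top h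
    obtain ⟨c, hc⟩ := rdist_eventually_top hfin hS hne hl
    have hp := distSet_atInfinity hS (ξ.atInfinity h)
    -- At an end at infinity `d_S` is `⊤`, so the only direction there is incoming, and the slope
    -- away from the end is `-1`.
    refine ⟨-1, (hasSlope_iff_top ξ h _).2 ⟨c, hc.mono fun y hy => by rw [hy]; push_cast; ring⟩,
      Or.inr ⟨rfl, ?_, ?_⟩⟩
    · intro h1
      rw [Outgoing, ξ.eventually_germ_top h] at h1
      obtain ⟨y, hy⟩ := h1.exists
      rw [hp] at hy
      exact not_top_lt hy
    · rw [Incoming, ξ.eventually_germ_top h]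
      refine Eventually.of_forall fun y => ?_
      rw [hp, lt_top_iff_ne_top]
      exact distSet_ne_top hS hne (not_atInfinity_rpt (by rw [hl]; exact le_top))
  · obtain ⟨m, hm, hs⟩ := rdist_slope hfin hS hne ξ.edge ξ.sgn_eq (Dir.eventually_valid p ξ h)
    have hp := distSet_ne_top hS hne (ξ.not_atInfinity h)
    have key : ∀ᶠ t in 𝓝[>] (0 : ℝ), 0 < t ∧ 0 ≤ rdist S p + m * t ∧
        C.distSet S (C.pt ξ.edge (ENNReal.ofReal (ξ.coord.toReal + ξ.sgn * t))) =
          ENNReal.ofReal (rdist S p + m * t) := by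
      filter_upwards [hs, self_mem_nhdsWithin, (Dir.eventually_valid p ξ h).filter_mono
        (nhdsWithin_mono _ Set.Ioi_subset_Ici_self)] with t ht ht0 htv
      refine ⟨ht0, ?_⟩
      have h1 : C.distSet S (C.rpt ξ.edge (ξ.coord.toReal + ξ.sgn * t)) =
          ENNReal.ofReal (rdist S (C.rpt ξ.edge (ξ.coord.toReal + ξ.sgn * t))) := by
        rw [rdist, ENNReal.ofReal_toReal (distSet_ne_top hS hne (not_atInfinity_rpt htv.2))]
      have h2 := rdist_nonneg (S := S) (C.rpt ξ.edge (ξ.coord.toReal + ξ.sgn * t))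
      rw [ht, ξ.rpt_coord h] at h1 h2
      exact ⟨h2, h1⟩
    have hp' : C.distSet S p = ENNReal.ofReal (rdist S p) := by
      rw [rdist, ENNReal.ofReal_toReal hp]
    have hnot : Outgoing S ξ → Incoming S ξ → False := by
      intro h1 h2
      rw [Outgoing, ξ.eventually_germ h] at h1
      rw [Incoming, ξ.eventually_germ h] at h2
      obtain ⟨t, h3, h4⟩ := (h1.and h2).exists
      exact lt_asymm h3 h4
    refine ⟨m, (hasSlope_iff ξ h m).2 hs, ?_⟩
    rcases hm with rfl | rfl
    · have : Outgoing S ξ := by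
        rw [Outgoing, ξ.eventually_germ h]
        filter_upwards [key] with t ⟨ht, h5, h1⟩
        rw [h1, hp', ENNReal.ofReal_lt_ofReal_iff_of_nonneg (rdist_nonneg _)]
        push_cast; linarith
      exact Or.inl ⟨rfl, this, hnot this⟩
    · have : Incoming S ξ := by
        rw [Incoming, ξ.eventually_germ h]
        filter_upwards [key] with t ⟨ht, h5, h1⟩
        rw [h1, hp']
        rw [ENNReal.ofReal_lt_ofReal_iff_of_nonneg h5]
        push_cast; linarith
      exact Or.inr ⟨rfl, fun h => hnot h this, this⟩

/-- A path to a vertex ends with a segment of an edge that begins at the starting point of the path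
or at the other end of the edge. -/
theorem IsPath.exists_last {p q : C.Pt} {φ : C.FormDual} {L : ENNReal} (h : C.IsPath p q φ L)
    {v : C.V} (hq : q = Pt.vertex v) (hp : p ≠ q) : ∃ e, ∃ s ≤ C.len e,
      (C.pt e s = p ∨ s = 0 ∨ s = C.len e) ∧ C.pt e s ≠ Pt.vertex v ∧
      ((C.src e = v ∧ C.dist p (C.pt e s) + s ≤ L) ∨
        (C.tgt e = v ∧ C.dist p (C.pt e s) + (C.len e - s) ≤ L)) := by
  induction h with
  | nil p => exact absurd rfl hp
  | @cons e s t hs ht q φ L h ih =>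
    have step : ∀ r, C.dist (C.pt e s) r ≤ (t - s) + (s - t) + C.dist (C.pt e t) r :=
      fun r => (dist_triangle _ _ _).trans (by gcongr; exact dist_segment e hs ht)
    by_cases h1 : C.pt e t = q
    · refine ⟨e, s, hs, Or.inl rfl, hq ▸ hp, ?_⟩
      rw [dist_self, zero_add, zero_add]
      rw [hq] at h1
      unfold pt at h1
      split_ifs at h1 with h2 h3
      · right
        injection h1 with h1
        rw [le_antisymm ht (not_lt.1 h3)]
        exact ⟨h1, le_add_right (le_add_right le_rfl)⟩
      · left
        injection h1 with h1
        have h2 : t = 0 := by simpa using h2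
        subst h2
        exact ⟨h1, by simp⟩
    · obtain ⟨e', s', hs', h2, h3, h4⟩ := ih hq h1
      by_cases h5 : s' = 0 ∨ s' = C.len e'
      · refine ⟨e', s', hs', Or.inr h5, h3, ?_⟩
        refine h4.imp (fun h4 => ⟨h4.1, ?_⟩) (fun h4 => ⟨h4.1, ?_⟩)
        · exact (add_le_add_left (step _) _).trans (by rw [add_assoc]; gcongr; exact h4.2)
        · exact (add_le_add_left (step _) _).trans (by rw [add_assoc]; gcongr; exact h4.2)
      -- The last segment starts at the interior point where the rest of the path begins. Hence the
      -- new first segment lies on the same edge and the two are merged.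
      · have h6 : C.pt e' s' = C.pt e t := h2.resolve_right h5
        push Not at h5
        have h7 : 0 < s' := pos_iff_ne_zero.2 h5.1
        have h8 : s' < C.len e' := lt_of_le_of_ne hs' h5.2
        rw [pt_inner h7 h8] at h6
        have h9 : e' = e ∧ s' = t := by
          unfold pt at h6
          split_ifs at h6
          injection h6 with h5 h6
          exact ⟨h5, h6⟩
        obtain ⟨rfl, rfl⟩ := h9
        refine ⟨e', s, hs, Or.inl rfl, hq ▸ hp, ?_⟩
        rw [dist_self] at h4 ⊢
        refine h4.imp (fun h4 => ⟨h4.1, ?_⟩) (fun h4 => ⟨h4.1, ?_⟩)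
        · have h10 := h4.2
          rw [zero_add] at h10 ⊢
          calc s ≤ (s - s') + s' := le_tsub_add
            _ ≤ (s' - s) + (s - s') + L := add_le_add le_add_self h10
        · have h10 := h4.2
          rw [zero_add] at h10 ⊢
          calc C.len e' - s ≤ (C.len e' - s') + (s' - s) := tsub_le_tsub_add_tsub
            _ ≤ L + ((s' - s) + (s - s')) := add_le_add h10 le_self_add
            _ = _ := add_comm _ _

/-- The infimum defining the distance need not be attained by definition, but a last segment starts
at a point of `S` or at an end of an edge. As there are finitely many such segments, one of them
realises the infimum. -/
theorem exists_last_segment (hfin : S.Finite) (hS : ∀ p ∈ S, ¬ C.AtInfinity p) (hne : S.Nonempty)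
    {v : C.V} (hv : ¬ C.AtInfinity (Pt.vertex v)) (hvS : Pt.vertex v ∉ S) : ∃ e, ∃ s ≤ C.len e,
      C.pt e s ≠ Pt.vertex v ∧
      ((C.src e = v ∧ C.distSet S (C.pt e s) + s ≤ C.distSet S (Pt.vertex v)) ∨
        (C.tgt e = v ∧ C.distSet S (C.pt e s) + (C.len e - s) ≤ C.distSet S (Pt.vertex v))) := by
  by_contra hcon
  push Not at hcon
  let K : Set (C.E × ENNReal) := {k | k.2 ≤ C.len k.1 ∧
    (C.pt k.1 k.2 ∈ S ∨ k.2 = 0 ∨ k.2 = C.len k.1) ∧ C.pt k.1 k.2 ≠ Pt.vertex v}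
  have hK : K.Finite := by
    have h1 : {k : C.E × ENNReal | (0 < k.2 ∧ k.2 < C.len k.1) ∧ C.pt k.1 k.2 ∈ S}.Finite := by
      refine Set.Finite.of_finite_image (f := fun k => C.pt k.1 k.2) (hfin.subset ?_) ?_
      · rintro _ ⟨k, hk, rfl⟩; exact hk.2
      · rintro ⟨e, s⟩ h ⟨e', s'⟩ h' heq
        simp only at heq
        rw [pt_inner h.1.1 h.1.2, pt_inner h'.1.1 h'.1.2] at heq
        injection heq with h2 h3
        exact Prod.ext h2 h3
    have h2 : (⋃ e : C.E, ({(e, 0), (e, C.len e)} : Set (C.E × ENNReal))).Finite :=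
      Set.finite_iUnion fun e => Set.toFinite _
    refine (h1.union h2).subset ?_
    rintro ⟨e, s⟩ ⟨h3, h4, -⟩
    by_cases h5 : s = 0 ∨ s = C.len e
    · right
      refine Set.mem_iUnion.2 ⟨e, ?_⟩
      rcases h5 with rfl | rfl <;> simp
    · left
      have h6 := h4.resolve_right h5
      push Not at h5
      exact ⟨⟨pos_iff_ne_zero.2 h5.1, lt_of_le_of_ne h3 h5.2⟩, h6⟩
  let c1 : C.E × ENNReal → ENNReal := fun k =>
    if C.src k.1 = v then C.distSet S (C.pt k.1 k.2) + k.2 else ⊤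
  let c2 : C.E × ENNReal → ENNReal := fun k =>
    if C.tgt k.1 = v then C.distSet S (C.pt k.1 k.2) + (C.len k.1 - k.2) else ⊤
  have hfinite := lt_top_iff_ne_top.2 (distSet_ne_top hS hne hv)
  -- If every candidate were strictly too long, so would be their finite minimum, although each path
  -- is at least as long as one of them.
  have hlt : C.distSet S (Pt.vertex v) < hK.toFinset.inf fun k => min (c1 k) (c2 k) := by
    rw [Finset.lt_inf_iff hfinite]
    intro k hk
    obtain ⟨h1, -, h2⟩ := hK.mem_toFinset.1 hk
    obtain ⟨h3, h4⟩ := hcon k.1 k.2 h1 h2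
    refine lt_min ?_ ?_
    · simp only [c1]; split_ifs with h
      · exact h3 h
      · exact hfinite
    · simp only [c2]; split_ifs with h
      · exact h4 h
      · exact hfinite
  refine absurd hlt (not_lt.2 (le_iInf₂ fun p hp => le_sInf ?_))
  rintro L ⟨φ, h⟩
  obtain ⟨e, s, hs, h1, h2, h3⟩ := h.exists_last rfl (fun h => hvS (h ▸ hp))
  have hmem : (e, s) ∈ hK.toFinset := hK.mem_toFinset.2
    ⟨hs, h1.imp_left (fun h => by rw [h]; exact hp), h2⟩
  refine (Finset.inf_le hmem).trans ?_
  rcases h3 with ⟨h3, h4⟩ | ⟨h3, h4⟩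
  · refine (min_le_left _ _).trans ?_
    simp only [c1, h3, if_true]
    exact (add_le_add_left (iInf₂_le p hp) _).trans h4
  · refine (min_le_right _ _).trans ?_
    simp only [c2, h3, if_true]
    exact (add_le_add_left (iInf₂_le p hp) _).trans h4

/-- The only possible slopes are `±1`, so it is enough to exclude `1`. -/
theorem incoming_of_eventually_lt (hfin : S.Finite) (hS : ∀ p ∈ S, ¬ C.AtInfinity p)
    (hne : S.Nonempty) {p : C.Pt} (ξ : C.Dir p) (h : ξ.coord ≠ ⊤)
    (hlt : ∀ᶠ h in 𝓝[>] (0 : ℝ),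
      rdist S (C.rpt ξ.edge (ξ.coord.toReal + ξ.sgn * h)) ≤ rdist S p - h) : Incoming S ξ := by
  obtain ⟨m, hm, ⟨rfl, -⟩ | ⟨-, -, h1⟩⟩ := exists_rdist_slope hfin hS hne p ξ
  · rw [hasSlope_iff ξ h] at hm
    obtain ⟨t, ⟨h1, h2⟩, h3⟩ := ((hm.and hlt).and self_mem_nhdsWithin).exists
    have h3 : 0 < t := h3
    simp only [ξ.rpt_coord h] at h1
    push_cast at h1
    linarith
  · exact h1

/-- A shortest path from `S` to a point outside `S` arrives along some direction. At a vertex this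
is the last segment; inside an edge it is read off from the candidate that realises the distance. -/
theorem exists_incoming (hfin : S.Finite) (hS : ∀ p ∈ S, ¬ C.AtInfinity p) (hne : S.Nonempty)
    (p : C.Pt) (hp : p ∉ S) : ∃ ξ : C.Dir p, Incoming S ξ := by
  revert hp
  refine Pt.cases (P := fun p => p ∉ S → ∃ ξ : C.Dir p, Incoming S ξ) (fun v hv => ?_)
    (fun e x hx hp => ?_) p
  · by_cases hinf : C.AtInfinity (Pt.vertex v)
    · obtain ⟨e, he, rfl⟩ := atInfinity_vertex.1 hinf
      refine ⟨C.dirTgt e, ?_⟩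
      rw [Incoming, Dir.eventually_germ_top _ (show (C.dirTgt e).coord = ⊤ from he)]
      refine Eventually.of_forall fun y => ?_
      rw [distSet_atInfinity hS hinf, lt_top_iff_ne_top]
      exact distSet_ne_top hS hne (not_atInfinity_rpt (e := e) (by rw [he]; exact le_top))
    · obtain ⟨e, s, hs, h1, ⟨rfl, h2⟩ | ⟨rfl, h2⟩⟩ := exists_last_segment hfin hS hne hinf hv
      · have hd := distSet_ne_top hS hne hinf
        have hst : s ≠ ⊤ := fun h => hd (top_le_iff.1 (by simpa [h] using h2))
        obtain ⟨x, h0, rfl⟩ : ∃ r, 0 ≤ r ∧ s = ENNReal.ofReal r :=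
          ⟨s.toReal, ENNReal.toReal_nonneg, (ENNReal.ofReal_toReal hst).symm⟩
        have hx0 : 0 < x := by
          refine lt_of_le_of_ne h0 fun h => h1 ?_
          rw [← h, ENNReal.ofReal_zero, pt_zero]
        have h3 := ENNReal.toReal_mono hd h2
        change (C.distSet S (C.rpt e x) + _).toReal ≤ _ at h3
        rw [ENNReal.toReal_add (distSet_ne_top hS hne (not_atInfinity_rpt hs)) hst,
          ENNReal.toReal_ofReal h0] at h3
        refine ⟨C.dirSrc e, incoming_of_eventually_lt hfin hS hne _ ENNReal.zero_ne_top ?_⟩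
        filter_upwards [Ioo_mem_nhdsGT hx0] with h hh
        have h4 := rdist_lipschitz hS hne (e := e) hh.1.le
          ((ENNReal.ofReal_le_ofReal hh.2.le).trans hs) h0 hs
        rw [abs_of_nonpos (by linarith [hh.2])] at h4
        change rdist S (C.rpt e x) + x ≤ rdist S _ at h3
        have h5 : (C.dirSrc e).coord.toReal + (C.dirSrc e).sgn * h = h := by
          simp [dirSrc, Dir.coord, Dir.sgn, Dir.fwd]
        rw [h5]
        change rdist S (C.rpt e h) ≤ _
        linarith
      · have hl : C.len e ≠ ⊤ := fun h => hinf (atInfinity_vertex.2 ⟨e, h, rfl⟩)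
        have hd := distSet_ne_top hS hne hinf
        have hst : s ≠ ⊤ := ne_top_of_le_ne_top hl hs
        obtain ⟨x, h0, rfl⟩ : ∃ r, 0 ≤ r ∧ s = ENNReal.ofReal r :=
          ⟨s.toReal, ENNReal.toReal_nonneg, (ENNReal.ofReal_toReal hst).symm⟩
        have hxl : x < (C.len e).toReal := by
          rw [← ENNReal.ofReal_lt_iff_lt_toReal h0 hl]
          refine lt_of_le_of_ne hs fun h => h1 ?_
          rw [h, pt_len]
        have h3 := ENNReal.toReal_mono hd h2
        change (C.distSet S (C.rpt e x) + _).toReal ≤ _ at h3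
        rw [ENNReal.toReal_add (distSet_ne_top hS hne (not_atInfinity_rpt hs))
          (ne_top_of_le_ne_top hl tsub_le_self), ENNReal.toReal_sub_of_le hs hl,
          ENNReal.toReal_ofReal h0] at h3
        refine ⟨C.dirTgt e, incoming_of_eventually_lt hfin hS hne _ hl ?_⟩
        filter_upwards [Ioo_mem_nhdsGT (sub_pos.2 hxl)] with h hh
        have h6 : ENNReal.ofReal ((C.len e).toReal - h) ≤ C.len e := by
          rw [ENNReal.ofReal_le_iff_le_toReal hl]; linarith [hh.1]
        have h4 := rdist_lipschitz hS hne (e := e) (by linarith [hh.2]) h6 h0 hs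
        rw [abs_of_nonneg (by linarith [hh.2])] at h4
        change rdist S (C.rpt e x) + _ ≤ rdist S _ at h3
        have h5 : (C.dirTgt e).coord.toReal + (C.dirTgt e).sgn * h = (C.len e).toReal - h := by
          simp [dirTgt, Dir.coord, Dir.sgn, Dir.fwd, sub_eq_add_neg]
        rw [h5]
        change rdist S (C.rpt e _) ≤ _
        linarith
  · obtain ⟨G, hG, h1, h2⟩ := exists_rdist_eq_min hfin hS hne e
    obtain ⟨h3, g, hg, h4⟩ := h2 x hx.1.le hx.2.le
    -- Each candidate decreases at unit speed in one of the two directions. The only exception, `|y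
    -- - s|` at `y = s`, is excluded by `x ∉ S`.
    have h5 : ∃ b : Bool, ∀ᶠ h in 𝓝[>] (0 : ℝ),
        g (x + (if b = true then 1 else -1) * h) = g x - h := by
      rcases h1 g hg with ⟨s, hs, rfl⟩ | ⟨c, rfl⟩ | ⟨-, c, rfl⟩
      · have hsx : s ≠ x := fun h => hp (h ▸ hs)
        rcases lt_or_gt_of_ne hsx with h | h
        · refine ⟨false, ?_⟩
          filter_upwards [Ioo_mem_nhdsGT (sub_pos.2 h)] with t ht
          simp only [Bool.false_eq_true, if_false]
          rw [abs_of_nonneg (by linarith [ht.2]), abs_of_nonneg (by linarith)]; ring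
        · refine ⟨true, ?_⟩
          filter_upwards [Ioo_mem_nhdsGT (sub_pos.2 h)] with t ht
          simp only [if_true]
          rw [abs_of_nonpos (by linarith [ht.2]), abs_of_nonpos (by linarith)]; ring
      · exact ⟨false, Eventually.of_forall fun h => by simp; ring⟩
      · exact ⟨true, Eventually.of_forall fun h => by simp; ring⟩
    obtain ⟨b, hb⟩ := h5
    rw [hx.rpt]
    let ξ : C.Dir (Pt.inner e (ENNReal.ofReal x) (ENNReal.ofReal_pos.2 hx.1) hx.2) := b
    have hc : ξ.coord ≠ ⊤ := ENNReal.ofReal_ne_top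
    refine ⟨ξ, incoming_of_eventually_lt hfin hS hne ξ hc ?_⟩
    filter_upwards [hb, (Dir.eventually_valid _ ξ hc).filter_mono
      (nhdsWithin_mono _ Set.Ioi_subset_Ici_self)] with h h6 h7
    have h8 := (h2 _ h7.1 h7.2).1 g hg
    have h9 : ξ.coord.toReal = x := ENNReal.toReal_ofReal hx.1.le
    have h10 : ξ.sgn = if b = true then 1 else -1 := rfl
    rw [h9, h10] at h8 ⊢
    have h11 : rdist S (Pt.inner e (ENNReal.ofReal x) (ENNReal.ofReal_pos.2 hx.1) hx.2) = g x := by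
      rw [← hx.rpt, h4]
    exact h8.trans (by rw [h6, h11])

end

section

variable {C : TropicalCurve}

/-! ### The divisors of the gradient orientation -/

theorem HasSlope.half {f : C.Pt → ℝ} {p : C.Pt} {ξ : C.Dir p} {n : ℤ}
    (h : HasSlope f ξ (2 * n)) : HasSlope (fun q => f q / 2) ξ n := by
  obtain ⟨c, h1, h2⟩ := h
  refine ⟨c / 2, ?_, fun h => ?_⟩
  · filter_upwards [h1] with t ht
    rw [ht]; push_cast; ring
  · change f p / 2 = _
    rw [h2 h]; push_cast; ring

theorem HasSlope.congr {f g : C.Pt → ℝ} {p : C.Pt} {ξ : C.Dir p} {n : ℤ} (h : HasSlope f ξ n)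
    (h1 : ∀ᶠ t in ξ.germ, g (C.pt ξ.edge t) = f (C.pt ξ.edge t)) (h2 : ξ.coord ≠ ⊤ → g p = f p) :
    HasSlope g ξ n := by
  obtain ⟨c, h3, h4⟩ := h
  refine ⟨c, ?_, fun h => by rw [h2 h, h4 h]⟩
  filter_upwards [h1, h3] with t a b
  rw [a, b]

theorem hasSlope_zero {p : C.Pt} (ξ : C.Dir p) : HasSlope (fun _ => 0) ξ 0 :=
  ⟨0, by simp, by simp⟩

/-- Turns congruences modulo 2 between slopes into linear equivalences. -/
theorem isDivisorOf_half {f : C.Pt → ℝ} {m : (p : C.Pt) → C.Dir p → ℤ} {D : C.Div}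
    (hm : ∀ (p : C.Pt) (ξ : C.Dir p), HasSlope f ξ (m p ξ))
    (heven : ∀ (p : C.Pt) (ξ : C.Dir p), Even (m p ξ))
    (hD : ∀ p, 2 * D p = ∑ ξ, m p ξ) : IsDivisorOf (fun p => f p / 2) D := by
  have h1 : ∀ (p : C.Pt) (ξ : C.Dir p), m p ξ = 2 * (m p ξ / 2) := fun p ξ =>
    (Int.mul_ediv_cancel' (heven p ξ).two_dvd).symm
  refine ⟨fun p ξ => m p ξ / 2, fun p ξ => HasSlope.half (h1 p ξ ▸ hm p ξ), fun p => ?_⟩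
  have h2 := hD p
  rw [Finset.sum_congr rfl fun ξ _ => h1 p ξ, ← Finset.mul_sum] at h2
  exact mul_left_cancel₀ two_ne_zero h2

theorem cls_eq_cls {D D' : C.Div} : C.cls D = C.cls D' ↔ ∃ f, IsDivisorOf f (D' - D) := by
  unfold cls
  rw [QuotientAddGroup.eq, neg_add_eq_sub]
  rfl

theorem canonical_apply (p : C.Pt) : C.canonical p = (C.valence p : ℤ) - 2 := rfl

theorem valence_eq_sum (p : C.Pt) : (C.valence p : ℤ) = ∑ _ξ : C.Dir p, 1 := by
  simp [valence]

/-- The slopes of the distance to `S` together with the divisors of the gradient orientation. -/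
structure GradientData (S : Set C.Pt) where
  slope : (p : C.Pt) → C.Dir p → ℤ
  Kplus : C.Div
  Kminus : C.Div
  hasSlope : ∀ (p : C.Pt) (ξ : C.Dir p), HasSlope (rdist S) ξ (slope p ξ)
  slope_eq : ∀ (p : C.Pt) (ξ : C.Dir p),
    (slope p ξ = 1 ∧ Outgoing S ξ ∧ ¬ Incoming S ξ) ∨
      (slope p ξ = -1 ∧ ¬ Outgoing S ξ ∧ Incoming S ξ)
  Kplus_apply : ∀ p, Kplus p = (∑ ξ : C.Dir p, if Outgoing S ξ then 1 else 0) - 1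
  Kminus_apply : ∀ p, Kminus p = (∑ ξ : C.Dir p, if Incoming S ξ then 1 else 0) - 1

theorem valPlus_eq (S : Set C.Pt) (p : C.Pt) :
    (C.valPlus S p : ℤ) = ∑ ξ : C.Dir p, if Outgoing S ξ then 1 else 0 := by
  rw [valPlus, Nat.card_eq_fintype_card, Fintype.card_subtype, Finset.sum_boole]

theorem valMinus_eq (S : Set C.Pt) (p : C.Pt) :
    (C.valMinus S p : ℤ) = ∑ ξ : C.Dir p, if Incoming S ξ then 1 else 0 := by
  rw [valMinus, Nat.card_eq_fintype_card, Fintype.card_subtype, Finset.sum_boole]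

theorem nonempty_gradientData {S : Set C.Pt} (hfin : S.Finite) (hS : ∀ p ∈ S, ¬ C.AtInfinity p)
    (hne : S.Nonempty) : Nonempty (GradientData S) := by
  choose m hm hm' using exists_rdist_slope hfin hS hne
  have h1 := finite_sum_slopes hm
  have hp : ∀ (p : C.Pt) (ξ : C.Dir p), 2 * (if Outgoing S ξ then 1 else 0) = 1 + m p ξ := by
    intro p ξ
    rcases hm' p ξ with ⟨h, h', -⟩ | ⟨h, h', -⟩ <;> simp [h, h']
  have hq : ∀ (p : C.Pt) (ξ : C.Dir p), 2 * (if Incoming S ξ then 1 else 0) = 1 - m p ξ := by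
    intro p ξ
    rcases hm' p ξ with ⟨h, -, h'⟩ | ⟨h, -, h'⟩ <;> simp [h, h']
  -- At an interior point where `d_S` does not break, one direction is incoming and one outgoing, so
  -- both coefficients vanish.
  have key : ∀ n : C.Pt → ℤ, (∀ (e : C.E) (x : ℝ), C.IsInner e x →
      ∑ ξ, m (C.rpt e x) ξ = 0 → n (C.rpt e x) = 0) → (Function.support n).Finite := by
    intro n hn
    refine (h1.union (Set.finite_range (Pt.vertex : C.V → C.Pt))).subset ?_
    intro p
    refine Pt.cases (P := fun p => n p ≠ 0 → p ∈ _) (fun v _ => Or.inr ⟨v, rfl⟩)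
      (fun e x hx h => ?_) p
    left
    exact fun h' => h (hn e x hx h')
  refine ⟨⟨m, Finsupp.ofSupportFinite
      (fun p => (∑ ξ : C.Dir p, if Outgoing S ξ then 1 else 0) - 1) (key _ ?_),
    Finsupp.ofSupportFinite
      (fun p => (∑ ξ : C.Dir p, if Incoming S ξ then 1 else 0) - 1) (key _ ?_), hm, hm',
    fun p => rfl, fun p => rfl⟩⟩
  · intro e x hx h
    have h2 : 2 * (∑ ξ : C.Dir (C.rpt e x), if Outgoing S ξ then (1 : ℤ) else 0) = 2 := by
      rw [Finset.mul_sum, Finset.sum_congr rfl fun ξ _ => hp _ ξ, Finset.sum_add_distrib, h,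
        hx.rpt, sum_dir_inner]
      rfl
    linarith
  · intro e x hx h
    have h2 : 2 * (∑ ξ : C.Dir (C.rpt e x), if Incoming S ξ then (1 : ℤ) else 0) = 2 := by
      rw [Finset.mul_sum, Finset.sum_congr rfl fun ξ _ => hq _ ξ, Finset.sum_sub_distrib, h,
        hx.rpt, sum_dir_inner]
      rfl
    linarith

namespace GradientData

variable {S : Set C.Pt} (G : GradientData S)

theorem slope_cases (p : C.Pt) (ξ : C.Dir p) : G.slope p ξ = 1 ∨ G.slope p ξ = -1 :=
  (G.slope_eq p ξ).imp And.left And.left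

theorem two_mul_incoming (p : C.Pt) (ξ : C.Dir p) :
    2 * (if Incoming S ξ then 1 else 0) = 1 - G.slope p ξ := by
  rcases G.slope_eq p ξ with ⟨h, -, h'⟩ | ⟨h, -, h'⟩ <;> simp [h, h']

theorem two_mul_outgoing (p : C.Pt) (ξ : C.Dir p) :
    2 * (if Outgoing S ξ then 1 else 0) = 1 + G.slope p ξ := by
  rcases G.slope_eq p ξ with ⟨h, h', -⟩ | ⟨h, h', -⟩ <;> simp [h, h']

theorem two_mul_Kplus (p : C.Pt) : 2 * G.Kplus p = C.canonical p + ∑ ξ, G.slope p ξ := by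
  rw [G.Kplus_apply, mul_sub, Finset.mul_sum,
    Finset.sum_congr rfl fun ξ _ => G.two_mul_outgoing p ξ,
    Finset.sum_add_distrib, ← valence_eq_sum, canonical_apply]
  ring

theorem two_mul_Kminus (p : C.Pt) : 2 * G.Kminus p = C.canonical p - ∑ ξ, G.slope p ξ := by
  rw [G.Kminus_apply, mul_sub, Finset.mul_sum,
    Finset.sum_congr rfl fun ξ _ => G.two_mul_incoming p ξ,
    Finset.sum_sub_distrib, ← valence_eq_sum, canonical_apply]
  ring

theorem Kplus_add_Kminus : G.Kplus + G.Kminus = C.canonical := by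
  ext p
  have h1 := G.two_mul_Kplus p
  have h2 := G.two_mul_Kminus p
  rw [Finsupp.add_apply]
  linarith

theorem isDivisorOf : IsDivisorOf (rdist S) (G.Kplus - G.Kminus) := by
  refine ⟨G.slope, G.hasSlope, fun p => ?_⟩
  have h1 := G.two_mul_Kplus p
  have h2 := G.two_mul_Kminus p
  rw [Finsupp.sub_apply]
  linarith

theorem cls_Kplus : C.cls G.Kplus = C.cls G.Kminus :=
  (cls_eq_cls.2 ⟨_, G.isDivisorOf⟩).symm

/-- All slopes of `d_S` and `d_{S'}` are odd, so their difference can be halved. -/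
theorem cls_Kminus_eq {S' : Set C.Pt} (G' : GradientData S') :
    C.cls G.Kminus = C.cls G'.Kminus := by
  refine cls_eq_cls.2 ⟨_, isDivisorOf_half (f := rdist S + -rdist S')
    (m := fun p ξ => G.slope p ξ + -G'.slope p ξ)
    (fun p ξ => (G.hasSlope p ξ).add (G'.hasSlope p ξ).neg) (fun p ξ => ?_) (fun p => ?_)⟩
  · rcases G.slope_cases p ξ with h | h <;> rcases G'.slope_cases p ξ with h' | h' <;>
      rw [h, h'] <;> decide
  · rw [Finsupp.sub_apply, mul_sub, G.two_mul_Kminus, G'.two_mul_Kminus, Finset.sum_add_distrib,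
      Finset.sum_neg_distrib]
    ring

theorem two_smul_cls : 2 • C.cls G.Kminus = C.cls C.canonical := by
  rw [two_nsmul]
  nth_rewrite 1 [← G.cls_Kplus]
  rw [← G.Kplus_add_Kminus]
  rfl

/-- The image of the gradient divisor under the Abel-Jacobi map, and its degree. -/
theorem abelJacobi_Kminus (p₀ : C.Pt) :
    C.abelJacobi p₀ G.Kminus =
      C.toJacHom (∑ e, (C.lift p₀ (Pt.vertex (C.tgt e)) - ((C.len e).toReal / 2) • C.coeff e) -
        ∑ v, C.lift p₀ (Pt.vertex v)) ∧
    C.deg G.Kminus = Fintype.card C.E - Fintype.card C.V := by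
  -- Adding all vertices cancels the `-1` in the coefficients there, so that `Kminus + Z` is `val_-`
  -- at the vertices.
  let Z : C.Div := ∑ v, Finsupp.single (Pt.vertex v) 1
  have hZ : C.abelJacobi p₀ Z = ∑ v, C.toJacHom (C.lift p₀ (Pt.vertex v)) ∧
      C.deg Z = Fintype.card C.V := by
    constructor
    · have h : C.abelJacobi p₀ Z = ∑ v, C.abelJacobi p₀ (Finsupp.single (Pt.vertex v) 1) :=
        Finsupp.sum_finsetSum_index
          (h := fun p (a : ℤ) => a • C.toJac (C.lift p₀ p)) (fun _ => zero_smul _ _)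
          (fun _ _ _ => add_smul _ _ _) |>.symm
      rw [h]
      refine Finset.sum_congr rfl fun v _ => ?_
      exact (Finsupp.sum_single_index (h := fun p (a : ℤ) => a • C.toJac (C.lift p₀ p))
        (zero_smul _ _)).trans (one_smul _ _)
    · have h : C.deg Z = ∑ v : C.V, C.deg (Finsupp.single (Pt.vertex v) 1) :=
        Finsupp.sum_finsetSum_index (fun _ => rfl) (fun _ _ _ => rfl) |>.symm
      rw [h]
      simp [deg]
  have hZv : ∀ v, Z (Pt.vertex v) = 1 := by
    intro v
    simp only [Z, Finsupp.finsetSum_apply, Finsupp.single_apply, Pt.vertex.injEq]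
    simp
  have hZe : ∀ e x, C.IsInner e x → Z (C.rpt e x) = 0 := by
    intro e x hx
    rw [hx.rpt]
    simp [Z, Finsupp.finsetSum_apply]
  -- Inside an edge `K = 0`, so the divisor of `d_S` is `-2 K_S^-` there.
  have hin : ∀ e x, C.IsInner e x →
      (G.Kplus - G.Kminus) (C.rpt e x) = -2 * (G.Kminus + Z) (C.rpt e x) := by
    intro e x hx
    have h1 := congrArg (fun D : C.Div => D (C.rpt e x)) G.Kplus_add_Kminus
    have h2 : C.canonical (C.rpt e x) = 0 := by
      rw [hx.rpt, canonical_apply, valence_eq_sum, sum_dir_inner]; rfl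
    simp only [Finsupp.add_apply] at h1
    rw [Finsupp.sub_apply, Finsupp.add_apply, hZe e x hx]
    linarith
  have hsupp : ∀ e, edgeSupp (G.Kplus - G.Kminus) e = edgeSupp (G.Kminus + Z) e := by
    intro e
    ext x
    rw [mem_edgeSupp, mem_edgeSupp]
    refine and_congr_right fun hx => ?_
    rw [hin e x hx]
    simp
  have hsum := sum_edge G.hasSlope (D := G.Kplus - G.Kminus) (fun e x _ => by
    have h1 := G.two_mul_Kplus (C.rpt e x)
    have h2 := G.two_mul_Kminus (C.rpt e x)
    rw [Finsupp.sub_apply]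
    linarith)
  have hin' : ∀ e, ∀ x ∈ edgeSupp (G.Kminus + Z) e,
      (G.Kplus - G.Kminus) (C.rpt e x) = -2 * (G.Kminus + Z) (C.rpt e x) := fun e x hx =>
    hin e x (mem_edgeSupp.1 hx).1
  -- On each edge `Kminus + Z` comes from `(x - d_S) / 2`, with `x` the coordinate. Its slopes are
  -- integers as those of `d_S` are odd, and the branches at the target differ in slope by `1`.
  obtain ⟨h1, h2⟩ := abelJacobi_eq p₀ (D := G.Kminus + Z) (k := fun _ => 1)
    (s₀ := fun e => if Incoming S (C.dirSrc e) then 1 else 0)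
    (s₁ := fun e => 1 - if Incoming S (C.dirTgt e) then 1 else 0)
    (Δ := fun e => (C.len e).toReal / 2 -
      (rdist S (Pt.vertex (C.tgt e)) - rdist S (Pt.vertex (C.src e))) / 2)
    (by
      intro v
      rw [Finsupp.add_apply, hZv, G.Kminus_apply,
        sum_dir_vertex v (fun p ξ => if Incoming S ξ then (1 : ℤ) else 0)]
      simp only [Finset.sum_sub_distrib]
      ring)
    (by
      intro e
      have h3 := (hsum e).1
      rw [hsupp, Finset.sum_congr rfl (hin' e), ← Finset.mul_sum] at h3
      have h4 := G.two_mul_incoming _ (C.dirSrc e)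
      have h5 := G.two_mul_incoming _ (C.dirTgt e)
      linarith)
    (by
      intro e he
      have h3 := (hsum e).2 he
      rw [hsupp, Finset.sum_congr rfl fun x hx => by rw [hin' e x hx]] at h3
      have h4 : ∑ x ∈ edgeSupp (G.Kminus + Z) e,
          x * ((-2 * (G.Kminus + Z) (C.rpt e x) : ℤ) : ℝ) =
          -2 * ∑ x ∈ edgeSupp (G.Kminus + Z) e, x * ((G.Kminus + Z) (C.rpt e x) : ℝ) := by
        rw [Finset.mul_sum]
        exact Finset.sum_congr rfl fun x _ => by push_cast; ring
      rw [h4] at h3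
      have h5 : (2 : ℝ) * ((if Incoming S (C.dirTgt e) then 1 else 0 : ℤ) : ℝ) =
          1 - G.slope _ (C.dirTgt e) := by
        exact_mod_cast G.two_mul_incoming _ (C.dirTgt e)
      have h6 : (G.slope _ (C.dirTgt e) : ℝ) =
          1 - 2 * ((if Incoming S (C.dirTgt e) then 1 else 0 : ℤ) : ℝ) := by linarith
      rw [h6] at h3
      push_cast at h3 ⊢
      linarith)
  rw [abelJacobi_add, hZ.1] at h1
  rw [deg_add, hZ.2] at h2
  constructor
  · rw [eq_sub_of_add_eq h1, map_sub, map_sum C.toJacHom fun v => C.lift p₀ (Pt.vertex v)]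
    congr 1
    have h3 := sum_differential (C := C) (fun v => rdist S (Pt.vertex v) / 2)
    congr 1
    rw [← sub_eq_zero, ← Finset.sum_sub_distrib, ← h3]
    refine Finset.sum_congr rfl fun e _ => ?_
    rw [one_smul]
    module
  · rw [eq_sub_of_add_eq h2]
    simp

end GradientData

end

section

variable {C : TropicalCurve}

/-! ### The class of the gradient divisors is not effective -/

theorem continuousOn_edge {f : C.Pt → ℝ} {m : (p : C.Pt) → C.Dir p → ℤ}
    (hm : ∀ (p : C.Pt) (ξ : C.Dir p), HasSlope f ξ (m p ξ)) (e : C.E) {b : ℝ}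
    (hb : ENNReal.ofReal b ≤ C.len e) :
    ContinuousOn (fun x => f (C.rpt e x)) (Set.Icc 0 b) := by
  obtain ⟨mp, mm, h1, h2, -⟩ := edge_slopes hm e
  exact continuousOn_of_slope
    (fun x hx => ⟨_, h1 x hx.1
      (lt_of_lt_of_le ((ENNReal.ofReal_lt_ofReal_iff (hx.1.trans_lt hx.2)).2 hx.2) hb)⟩)
    (fun x hx => ⟨_, h2 x hx.1 ((ENNReal.ofReal_le_ofReal hx.2).trans hb)⟩)

/-- A lexicographic maximum of two continuous functions on the finite part of the curve. -/
theorem exists_lex_max {f d : C.Pt → ℝ} (b : C.E → ℝ) (hb : ∀ e, 0 < b e)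
    (hbl : ∀ e, ENNReal.ofReal (b e) ≤ C.len e)
    (hf : ∀ e, ContinuousOn (fun x => f (C.rpt e x)) (Set.Icc 0 (b e)))
    (hd : ∀ e, ContinuousOn (fun x => d (C.rpt e x)) (Set.Icc 0 (b e)))
    (hdecr : ∀ e x, ENNReal.ofReal x ≤ C.len e → b e < x → f (C.rpt e x) < f (C.rpt e (b e))) :
    ∃ p, ¬ C.AtInfinity p ∧ (∀ q, ¬ C.AtInfinity q → f q ≤ f p) ∧
      ∀ q, ¬ C.AtInfinity q → f q = f p → d q ≤ d p := by
  let V' := {v : C.V // ¬ C.AtInfinity (Pt.vertex v)}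
  let _ : TopologicalSpace V' := ⊥
  have : DiscreteTopology V' := ⟨rfl⟩
  -- A compact model of the part of the curve where the maximum must lie: finitely many vertices and
  -- closed segments, beyond which `f` is smaller.
  let X := V' ⊕ Σ e : C.E, Set.Icc (0 : ℝ) (b e)
  let π : X → C.Pt := Sum.elim (fun v => Pt.vertex v.1) (fun x => C.rpt x.1 x.2.1)
  have hcont : ∀ g : C.Pt → ℝ, (∀ e, ContinuousOn (fun x => g (C.rpt e x)) (Set.Icc 0 (b e))) →
      Continuous (g ∘ π) := by
    intro g hg
    refine continuous_sum_dom.2 ⟨continuous_of_discreteTopology, continuous_sigma fun e => ?_⟩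
    exact continuousOn_iff_continuous_domRestrict.1 (hg e)
  have hπ : ∀ x, ¬ C.AtInfinity (π x) := by
    rintro (v | ⟨e, x⟩)
    · exact v.2
    · exact not_atInfinity_rpt ((ENNReal.ofReal_le_ofReal x.2.2).trans (hbl e))
  have hcover : ∀ q, ¬ C.AtInfinity q → ∃ x, q = π x ∨ f q < f (π x) := by
    intro q
    refine Pt.cases (P := fun q => ¬ C.AtInfinity q → ∃ x, q = π x ∨ f q < f (π x))
      (fun v hv => ⟨Sum.inl ⟨v, hv⟩, Or.inl rfl⟩) (fun e x hx _ => ?_) q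
    rcases le_or_gt x (b e) with h | h
    · exact ⟨Sum.inr ⟨e, x, hx.1.le, h⟩, Or.inl rfl⟩
    · exact ⟨Sum.inr ⟨e, b e, (hb e).le, le_rfl⟩, Or.inr (hdecr e x hx.2.le h)⟩
  obtain ⟨v, hv⟩ := exists_not_atInfinity (C := C)
  obtain ⟨x₀, -, hx₀⟩ := (isCompact_univ (X := X)).exists_isMaxOn ⟨Sum.inl ⟨v, hv⟩, trivial⟩
    (hcont f hf).continuousOn
  have hx₀ : ∀ x, f (π x) ≤ f (π x₀) := fun x => hx₀ (Set.mem_univ x)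
  have hK : IsCompact {x : X | f (π x) = f (π x₀)} :=
    (isClosed_eq (hcont f hf) continuous_const).isCompact
  obtain ⟨x₁, hx₁, hmax⟩ := hK.exists_isMaxOn ⟨x₀, rfl⟩ (hcont d hd).continuousOn
  have hx₁ : f (π x₁) = f (π x₀) := hx₁
  have hle : ∀ q, ¬ C.AtInfinity q → f q ≤ f (π x₁) := by
    intro q hq
    rw [hx₁]
    obtain ⟨x, rfl | h⟩ := hcover q hq
    · exact hx₀ x
    · exact h.le.trans (hx₀ x)
  refine ⟨π x₁, hπ x₁, hle, fun q hq h => ?_⟩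
  obtain ⟨x, rfl | h'⟩ := hcover q hq
  · exact hmax (show f (π x) = f (π x₀) by rw [h, hx₁])
  · exact absurd (hle _ (hπ x)) (not_le.2 (h ▸ h'))

theorem sum_dir_atInfinity {e : C.E} (h : C.len e = ⊤)
    (m : C.Dir (Pt.vertex (C.tgt e)) → ℤ) : ∑ ξ, m ξ = m (C.dirTgt e) := by
  have h1 : C.AtInfinity (Pt.vertex (C.tgt e)) := atInfinity_vertex.2 ⟨e, h, rfl⟩
  have h2 := Fintype.card_le_one_iff.1 (le_of_eq h1)
  exact Fintype.sum_eq_single _ fun ξ hξ => absurd (h2 _ _) hξ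

namespace GradientData

variable {S : Set C.Pt} (G : GradientData S)

/-- At a point where `f`, and then `d_S`, is maximal, `f` must strictly decrease in each outgoing
direction. Thus `(f) ≤ -val_+` there, leaving a coefficient of at most `-1`. -/
theorem not_isEffective : ¬ C.IsEffective (C.cls G.Kplus) := by
  rintro ⟨D, hD, hcls⟩
  obtain ⟨f, n, hn, hn'⟩ := cls_eq_cls.1 hcls.symm
  have hsum : ∀ p, D p = G.Kplus p + ∑ ξ, n p ξ := fun p => by
    rw [← hn', Finsupp.sub_apply]; ring
  have hb : ∀ e, ∃ b : ℝ, 0 < b ∧ ENNReal.ofReal b ≤ C.len e ∧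
      ∀ x, ENNReal.ofReal x ≤ C.len e → b < x → f (C.rpt e x) < f (C.rpt e b) := by
    intro e
    by_cases hl : C.len e = ⊤
    · have h1 := hsum (Pt.vertex (C.tgt e))
      have h2 : ¬ Outgoing S (C.dirTgt e) := by
        intro h
        obtain ⟨t, ht⟩ := ((Dir.eventually_germ_top _ (show (C.dirTgt e).coord = ⊤ from hl)).1
          h).exists
        have h3 := G.hasSlope _ (C.dirTgt e)
        rcases G.slope_eq _ (C.dirTgt e) with ⟨h4, -⟩ | ⟨-, h5, -⟩
        · rw [h4, hasSlope_tgt_top hl] at h3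
          obtain ⟨c, hc⟩ := h3
          obtain ⟨y, hy, hy'⟩ := (hc.and (eventually_gt_atTop c)).exists
          have := rdist_nonneg (S := S) (C.rpt e y)
          rw [hy] at this
          push_cast at this
          linarith
        · exact h5 h
      -- At an end at infinity `K_S^+` is `-1`, so effectivity forces `f` to have slope at least `1`
      -- away from the end. Hence `f` decreases towards infinity.
      rw [G.Kplus_apply, sum_dir_atInfinity hl, sum_dir_atInfinity hl, if_neg h2] at h1
      have h3 := hD (Pt.vertex (C.tgt e))
      have h4 : (1 : ℝ) ≤ n _ (C.dirTgt e) := by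
        have : 1 ≤ n _ (C.dirTgt e) := by linarith
        exact_mod_cast this
      obtain ⟨c, hc⟩ := (hasSlope_tgt_top hl).1 (hn _ (C.dirTgt e))
      obtain ⟨a, ha⟩ := eventually_atTop.1 hc
      refine ⟨max a 1, lt_max_of_lt_right one_pos, by rw [hl]; exact le_top, fun x _ hx => ?_⟩
      rw [ha x ((le_max_left _ _).trans hx.le), ha _ (le_max_left _ _)]
      nlinarith
    · refine ⟨_, len_toReal_pos hl, (ENNReal.ofReal_toReal hl).le, fun x hx hx' => ?_⟩
      have h1 := ENNReal.toReal_mono hl hx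
      rw [ENNReal.toReal_ofReal (ENNReal.toReal_nonneg.trans hx'.le)] at h1
      exact absurd hx' (not_lt.2 h1)
  choose b hb0 hbl hbd using hb
  obtain ⟨p, hp, hmax, hmax'⟩ := exists_lex_max b hb0 hbl
    (fun e => continuousOn_edge hn e (hbl e))
    (fun e => continuousOn_edge G.hasSlope e (hbl e)) hbd
  have key : ∀ ξ : C.Dir p, n p ξ ≤ -(if Outgoing S ξ then 1 else 0) := by
    intro ξ
    have hc : ξ.coord ≠ ⊤ := fun h => hp (ξ.atInfinity h)
    have h1 := (hasSlope_iff ξ hc _).1 (hn p ξ)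
    have h2 := (hasSlope_iff ξ hc _).1 (G.hasSlope p ξ)
    obtain ⟨t, ⟨⟨h3, h4⟩, h5⟩, h6⟩ := (((h1.and h2).and ((Dir.eventually_valid p ξ hc).filter_mono
      (nhdsWithin_mono _ Set.Ioi_subset_Ici_self))).and self_mem_nhdsWithin).exists
    have h6 : 0 < t := h6
    have hq := not_atInfinity_rpt h5.2
    simp only [ξ.rpt_coord hc] at h3 h4
    have h7 := hmax _ hq
    have h8 : (n p ξ : ℝ) ≤ 0 := by
      by_contra h
      have := mul_pos (not_le.1 h) h6
      linarith
    have h8 : n p ξ ≤ 0 := by exact_mod_cast h8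
    split_ifs with ho
    · have h9 : n p ξ ≠ 0 := by
        intro h9
        rw [h9, Int.cast_zero, zero_mul, add_zero] at h3
        have h10 := hmax' _ hq h3
        rcases G.slope_eq p ξ with ⟨h, -⟩ | ⟨-, h, -⟩
        · rw [h] at h4
          push_cast at h4
          linarith
        · exact h ho
      omega
    · simpa using h8
  have h1 := hsum p
  have h2 := Finset.sum_le_sum fun ξ (_ : ξ ∈ Finset.univ) => key ξ
  rw [Finset.sum_neg_distrib] at h2
  rw [G.Kplus_apply] at h1
  have := hD p
  linarith

end GradientData

/-! ### The non-effective theta characteristic is unique -/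

theorem Dir.eventually_inner {p : C.Pt} (ξ : C.Dir p) :
    ∀ᶠ t in ξ.germ, 0 < t ∧ t < C.len ξ.edge := by
  unfold Dir.germ
  split_ifs with h
  · have h1 := ξ.coord_lt_of_fwd h
    filter_upwards [Ioo_mem_nhdsGT h1] with t ht
    exact ⟨bot_le.trans_lt ht.1, ht.2⟩
  · filter_upwards [Ioo_mem_nhdsLT (ξ.coord_pos_of_not_fwd h)] with t ht
    exact ⟨ht.1, ht.2.trans_le ξ.coord_le⟩

/-- The restriction of a function to the interiors of the edges in `O`. -/
def edgeRestrict (O : Set C.E) (f : C.Pt → ℝ) : C.Pt → ℝ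
  | Pt.vertex _ => 0
  | Pt.inner e t h0 h1 => if e ∈ O then f (Pt.inner e t h0 h1) else 0

/-- Since `f` vanishes at the ends of the edges in `O`, cutting it off there keeps it continuous. -/
theorem hasSlope_edgeRestrict {O : Set C.E} {f : C.Pt → ℝ}
    (hf : ∀ e ∈ O, f (Pt.vertex (C.src e)) = 0 ∧ f (Pt.vertex (C.tgt e)) = 0) {p : C.Pt}
    (ξ : C.Dir p) {n : ℤ} (h : HasSlope f ξ n) :
    HasSlope (edgeRestrict O f) ξ (if ξ.edge ∈ O then n else 0) := by
  have hbase : edgeRestrict O f p = if ξ.edge ∈ O then f p else 0 := by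
    clear h
    refine Dir.cases (P := fun p ξ => edgeRestrict O f p = if ξ.edge ∈ O then f p else 0)
      (fun e => ?_) (fun e => ?_) (fun e x hx b => rfl) p ξ
    · change 0 = if e ∈ O then _ else _
      split_ifs with he
      · exact (hf e he).1.symm
      · rfl
    · change 0 = if e ∈ O then _ else _
      split_ifs with he
      · exact (hf e he).2.symm
      · rfl
  split_ifs with hO
  · refine h.congr ?_ fun _ => by rw [hbase, if_pos hO]
    filter_upwards [ξ.eventually_inner] with t ht
    rw [pt_inner ht.1 ht.2]
    exact if_pos hO
  · refine (hasSlope_zero ξ).congr ?_ fun _ => by rw [hbase, if_neg hO]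
    filter_upwards [ξ.eventually_inner] with t ht
    rw [pt_inner ht.1 ht.2]
    exact if_neg hO

namespace GradientData

variable {S : Set C.Pt} (G : GradientData S)

theorem neg_one_le_Kminus (p : C.Pt) : -1 ≤ G.Kminus p := by
  rw [G.Kminus_apply]
  have : 0 ≤ ∑ ξ : C.Dir p, (if Incoming S ξ then (1 : ℤ) else 0) :=
    Finset.sum_nonneg fun ξ _ => by split_ifs <;> simp
  linarith

theorem Kminus_nonneg {p : C.Pt} (h : ∃ ξ : C.Dir p, Incoming S ξ) : 0 ≤ G.Kminus p := by
  obtain ⟨ξ, hξ⟩ := h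
  rw [G.Kminus_apply]
  have h1 := Finset.single_le_sum (f := fun ξ : C.Dir p => if Incoming S ξ then (1 : ℤ) else 0)
    (fun ξ _ => by split_ifs <;> simp) (Finset.mem_univ ξ)
  simp only [hξ, if_true] at h1
  linarith

theorem slope_of_mem {p : C.Pt} (hp : p ∈ S) (ξ : C.Dir p) (hc : ξ.coord ≠ ⊤) :
    G.slope p ξ = 1 := by
  rcases G.slope_cases p ξ with h | h
  · exact h
  · exfalso
    have h1 := (hasSlope_iff ξ hc _).1 (G.hasSlope p ξ)
    obtain ⟨t, h2, h3⟩ := (h1.and self_mem_nhdsWithin).exists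
    have h3 : 0 < t := h3
    simp only [ξ.rpt_coord hc, rdist_of_mem hp, h] at h2
    have := rdist_nonneg (S := S) (C.rpt ξ.edge (ξ.coord.toReal + ξ.sgn * t))
    rw [h2] at this
    push_cast at this
    linarith

/-- A theta characteristic other than `K₀` differs from it by a nontrivial parity class of edges.
Taking the ends of these edges as a new source set produces an effective representative. -/
theorem unique_thetaChar {a : C.Pic} (ha : C.IsThetaChar a) (hne : ¬ C.IsEffective a) :
    a = C.cls G.Kminus := by
  obtain ⟨⟨D, -, rfl⟩, h2⟩ := ha
  have h3 : C.cls (2 • G.Kminus) = C.cls (2 • D) := by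
    change 2 • C.cls _ = 2 • C.cls _
    rw [h2, G.two_smul_cls]
  obtain ⟨f, n, hn, hn'⟩ := cls_eq_cls.1 h3
  have hn2 : ∀ p, 2 * (D p - G.Kminus p) = ∑ ξ, n p ξ := fun p => by
    rw [← hn', Finsupp.sub_apply, Finsupp.smul_apply, Finsupp.smul_apply]
    simp only [nsmul_eq_mul]; push_cast; ring
  have hpar := slope_parity hn hn' (fun p => by rw [hn', ← hn2]; exact even_two_mul _)
  -- The edges along which `f` has odd slope; `hpar` makes this independent of the point on the
  -- edge.
  let O : Set C.E := {e | ¬ Even (n _ (C.dirSrc e))}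
  by_cases hO : O = ∅
  · have hev : ∀ e, Even (n _ (C.dirSrc e)) := fun e => by
      by_contra h
      have : e ∈ O := h
      rw [hO] at this
      exact this
    have h4 : IsDivisorOf (fun p => f p / 2) (D - G.Kminus) :=
      isDivisorOf_half hn (fun p ξ => (hpar p ξ).2 (hev _))
        (fun p => by rw [Finsupp.sub_apply]; exact hn2 p)
    exact (cls_eq_cls.2 ⟨_, h4⟩).symm
  exfalso
  obtain ⟨e₀, he₀⟩ := Set.nonempty_iff_ne_empty.2 hO
  let S' : Set C.Pt := {p | ∃ e ∈ O, p = Pt.vertex (C.src e) ∨ p = Pt.vertex (C.tgt e)}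
  -- At a 1-valent end the single slope equals the coefficient of the divisor, which is even.
  have hOfin : ∀ e ∈ O, C.len e ≠ ⊤ := by
    intro e he hl
    have h4 := hn2 (Pt.vertex (C.tgt e))
    rw [sum_dir_atInfinity hl] at h4
    exact he ((hpar _ (C.dirTgt e)).1 (h4 ▸ even_two_mul _))
  have hS'v : ∀ p ∈ S', p ∈ Set.range (Pt.vertex : C.V → C.Pt) := by
    rintro p ⟨e, -, rfl | rfl⟩ <;> exact ⟨_, rfl⟩
  have hS'fin : S'.Finite := (Set.finite_range _).subset hS'v
  have hS'inf : ∀ p ∈ S', ¬ C.AtInfinity p := by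
    rintro p ⟨e, he, rfl | rfl⟩
    · exact not_atInfinity_src e
    · exact not_atInfinity_tgt (hOfin e he)
  have hS'ne : S'.Nonempty := ⟨_, e₀, he₀, Or.inl rfl⟩
  obtain ⟨G'⟩ := nonempty_gradientData hS'fin hS'inf hS'ne
  let k : (p : C.Pt) → C.Dir p → ℤ := fun p ξ => if ξ.edge ∈ O then G'.slope p ξ else 0
  have hk : ∀ (p : C.Pt) (ξ : C.Dir p), HasSlope (edgeRestrict O (rdist S')) ξ (k p ξ) :=
    fun p ξ => by
      have h := hasSlope_edgeRestrict (O := O) (f := rdist S') (fun e he =>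
        ⟨rdist_of_mem (S := S') ⟨e, he, Or.inl rfl⟩, rdist_of_mem (S := S') ⟨e, he, Or.inr rfl⟩⟩)
        ξ (G'.hasSlope p ξ)
      by_cases hξ : ξ.edge ∈ O
      · simpa only [k, if_pos hξ] using h
      · simpa only [k, if_neg hξ] using h
  -- On `O` the two terms in `d_{S'}` cancel and odd minus odd is left; off `O` it is even plus odd
  -- minus odd. So all slopes of `F` are even.
  let F : C.Pt → ℝ := f + rdist S' + -rdist S + -edgeRestrict O (rdist S')
  let j : (p : C.Pt) → C.Dir p → ℤ := fun p ξ =>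
    n p ξ + G'.slope p ξ + -G.slope p ξ + -k p ξ
  have hF : ∀ (p : C.Pt) (ξ : C.Dir p), HasSlope F ξ (j p ξ) := fun p ξ =>
    (((hn p ξ).add (G'.hasSlope p ξ)).add (G.hasSlope p ξ).neg).add (hk p ξ).neg
  have hj : ∀ (p : C.Pt) (ξ : C.Dir p), Even (j p ξ) := by
    intro p ξ
    have h5 := G.slope_cases p ξ
    have h6 := G'.slope_cases p ξ
    by_cases hξ : ξ.edge ∈ O
    · have h4 : ¬ Even (n p ξ) := fun h => hξ ((hpar p ξ).1 h)
      simp only [j, k, if_pos hξ]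
      rw [Int.not_even_iff_odd] at h4
      obtain ⟨r, hr⟩ := h4
      rcases h5 with h5 | h5 <;> rw [h5, hr]
      · exact ⟨r, by ring⟩
      · exact ⟨r + 1, by ring⟩
    · have h4 : Even (n p ξ) := by
        by_contra h
        exact hξ fun h' => h ((hpar p ξ).2 h')
      simp only [j, k, if_neg hξ]
      obtain ⟨r, hr⟩ := h4
      rcases h5 with h5 | h5 <;> rcases h6 with h6 | h6 <;> rw [h5, h6, hr]
      · exact ⟨r, by ring⟩
      · exact ⟨r - 1, by ring⟩
      · exact ⟨r + 1, by ring⟩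
      · exact ⟨r, by ring⟩
  have hj2 : ∀ p, ∑ ξ, j p ξ = 2 * (D p - G'.Kminus p) - ∑ ξ, k p ξ := by
    intro p
    have h4 := G.two_mul_Kminus p
    have h5 := G'.two_mul_Kminus p
    have h6 := hn2 p
    simp only [j, Finset.sum_add_distrib, Finset.sum_neg_distrib]
    linarith
  have hfinite := finite_sum_slopes hF
  have hsumeven : ∀ p, 2 * ((∑ ξ, j p ξ) / 2) = ∑ ξ, j p ξ := fun p =>
    Int.mul_ediv_cancel' (Finset.even_sum _ fun ξ _ => hj p ξ).two_dvd
  let N : C.Div := Finsupp.ofSupportFinite (fun p => (∑ ξ, j p ξ) / 2) (hfinite.subset (by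
    intro p hp h
    apply hp
    change (∑ ξ, j p ξ) / 2 = 0
    rw [h]; rfl))
  have hN : IsDivisorOf (fun p => F p / 2) N := isDivisorOf_half hF hj hsumeven
  have hE : ∀ p, 2 * (D - N) p = 2 * G'.Kminus p + ∑ ξ, k p ξ := by
    intro p
    have h4 : 2 * N p = _ := hsumeven p
    rw [hj2] at h4
    rw [Finsupp.sub_apply]
    linarith
  refine hne ⟨D - N, ?_, cls_eq_cls.2 ⟨_, by rwa [sub_sub_cancel]⟩⟩
  -- Away from `S'` and `O` the new divisor equals `K_{S'}^-`, which is nonnegative because some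
  -- direction is incoming.
  have hnot : ∀ p, p ∉ S' → (∀ ξ : C.Dir p, ξ.edge ∉ O) → 0 ≤ (D - N) p := by
    intro p hp hξ
    have h4 := hE p
    rw [Finset.sum_eq_zero fun ξ _ => if_neg (hξ ξ)] at h4
    have h5 := G'.Kminus_nonneg (exists_incoming hS'fin hS'inf hS'ne p hp)
    linarith
  intro p
  refine Pt.cases (P := fun p => 0 ≤ (D - N) p) (fun v => ?_) (fun e x hx => ?_) p
  · by_cases hv : Pt.vertex v ∈ S'
    · have hc : ∀ ξ : C.Dir (Pt.vertex v), ξ.coord ≠ ⊤ := fun ξ h => hS'inf _ hv (ξ.atInfinity h)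
      have h4 := hE (Pt.vertex v)
      have h5 := G'.neg_one_le_Kminus (Pt.vertex v)
      have h6 : ∀ ξ ∈ Finset.univ, 0 ≤ k (Pt.vertex v) ξ := by
        intro ξ _
        simp only [k]
        split_ifs
        · rw [G'.slope_of_mem hv ξ (hc ξ)]; simp
        · exact le_rfl
      have h7 : ∃ ξ : C.Dir (Pt.vertex v), ξ.edge ∈ O := by
        obtain ⟨e, he, h | h⟩ := hv
        · injection h with h
          subst h
          exact ⟨C.dirSrc e, he⟩
        · injection h with h
          subst h
          exact ⟨C.dirTgt e, he⟩
      obtain ⟨ξ, hξ⟩ := h7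
      have h8 := Finset.single_le_sum h6 (Finset.mem_univ ξ)
      have h9 : k (Pt.vertex v) ξ = 1 := by
        simp only [k, if_pos hξ]
        exact G'.slope_of_mem hv ξ (hc ξ)
      -- Twice the coefficient is at least `-2 + 1`, so the coefficient, an integer, is nonnegative.
      omega
    · refine hnot _ hv ?_
      intro ξ hξ
      apply hv
      obtain ⟨e, rfl⟩ | ⟨e, rfl⟩ := ξ
      · exact ⟨e, hξ, Or.inl rfl⟩
      · exact ⟨e, hξ, Or.inr rfl⟩
  · have hx' : C.rpt e x ∉ S' := by
      intro h
      obtain ⟨v, hv⟩ := hS'v _ h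
      rw [hx.rpt] at hv
      cases hv
    by_cases he : e ∈ O
    · have h4 := hE (C.rpt e x)
      have h5 := G'.two_mul_Kminus (C.rpt e x)
      -- Inside an edge of `O` twice the coefficient is `2 K_{S'}^- + (d_{S'})`, that is `K`, which
      -- vanishes.
      have h6 : ∑ ξ, k (C.rpt e x) ξ = ∑ ξ, G'.slope (C.rpt e x) ξ := by
        rw [hx.rpt]
        exact Finset.sum_congr rfl fun ξ _ => if_pos he
      have h7 : C.canonical (C.rpt e x) = 0 := by
        rw [hx.rpt, canonical_apply, valence_eq_sum, sum_dir_inner]; rfl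
      linarith
    · refine hnot _ hx' ?_
      rw [hx.rpt]
      exact fun ξ => he

end GradientData

end

section

variable {C : TropicalCurve}

/-! ### Chains from a base point to the vertices -/

/-- Chains that represent the lifts of the vertices, up to a common constant. -/
structure Frame (p₀ : C.Pt) where
  const : C.FormDual
  base : C.V
  chain : C.V → C.E → ℤ
  boundary_chain : ∀ v, C.boundary (chain v) = Pi.single v 1 - Pi.single base 1
  lift_eq : ∀ v, C.lift p₀ (Pt.vertex v) = C.chainInt (chain v) + const

theorem nonempty_frame (p₀ : C.Pt) : Nonempty (Frame p₀) := by
  choose γ h1 h2 using fun v : C.V => exists_chain_lift p₀ (Pt.vertex v)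
  exact ⟨⟨-offset p₀, anchor p₀, γ, h1, fun v => by rw [h2, offset_vertex]; abel⟩⟩

theorem period_apply (c d : C.cycles) :
    C.period c d = ∑ e, (c.1 e : ℝ) * (C.len e).toReal * d.1 e := chainInt_apply c.1 d

theorem period_comm (c d : C.cycles) : C.period c d = C.period d c := by
  rw [period_apply, period_apply]
  exact Finset.sum_congr rfl fun e _ => by ring

namespace Frame

variable {p₀ : C.Pt} (F : Frame p₀)

/-- The cycle that runs through an edge and returns through the base point. -/
def cyc (e : C.E) : C.cycles :=
  ⟨F.chain (C.src e) + Pi.single e 1 - F.chain (C.tgt e), by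
    rw [LinearMap.mem_ker, map_sub, map_add, F.boundary_chain, F.boundary_chain, boundary_single]
    abel⟩

theorem period_cyc (e : C.E) : C.period (F.cyc e) =
    C.lift p₀ (Pt.vertex (C.src e)) + (C.len e).toReal • C.coeff e -
      C.lift p₀ (Pt.vertex (C.tgt e)) := by
  rw [period_eq, cyc, map_sub, map_add, chainInt_single, F.lift_eq, F.lift_eq]
  abel

/-- The chains to the two ends of the edges, weighted by `ω`, regroup to the boundary of `ω` and
cancel. -/
theorem sum_cyc (ω : C.cycles) : ∑ e, ω.1 e • F.cyc e = ω := by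
  have h := sum_boundary_mul ω.1 F.chain
  rw [LinearMap.mem_ker.1 ω.2] at h
  simp only [Pi.zero_apply, zero_smul, Finset.sum_const_zero] at h
  apply Subtype.ext
  have h1 : ∀ e, (ω.1 e • F.cyc e : C.cycles).1 =
      ω.1 e • (Pi.single e 1 : C.E → ℤ) - ω.1 e • (F.chain (C.tgt e) - F.chain (C.src e)) := by
    intro e
    change ω.1 e • (F.chain (C.src e) + Pi.single e 1 - F.chain (C.tgt e)) = _
    module
  rw [AddSubmonoidClass.coe_finsetSum, Finset.sum_congr rfl fun e _ => h1 e,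
    Finset.sum_sub_distrib, ← h, sub_zero]
  ext e'
  simp [Finset.sum_apply, Pi.single_apply]

/-- Dual to `sum_cyc`: the functionals `coeff e` and the cycles `cyc e` give coordinates, with
redundancy, for functionals. -/
theorem sum_coeff (x : C.FormDual) : ∑ e, x (F.cyc e) • C.coeff e = x := by
  ext ω
  conv_rhs => rw [← F.sum_cyc ω]
  simp [coeff, mul_comm]

end Frame

/-! ### The theta function -/

theorem mul_sub_sq_le {a L : ℝ} (hL : 0 < L) (n : ℝ) :
    a * n - 1 / 2 * (L * n ^ 2) ≤ a ^ 2 / (2 * L) := by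
  rw [le_div_iff₀ (by positivity)]
  nlinarith [sq_nonneg (L * n - a)]

/-- The terms of the theta series with coefficients `a`. -/
def thetaTerm (a : C.E → ℝ) (c : C.cycles) : ℝ :=
  ∑ e, (a e * c.1 e - 1 / 2 * ((C.len e).toReal * (c.1 e : ℝ) ^ 2))

theorem thetaTerm_summand_le {a : C.E → ℝ} {A : ℝ} (ha : ∀ e, |a e| ≤ A) (c : C.cycles) (e : C.E) :
    a e * c.1 e - 1 / 2 * ((C.len e).toReal * (c.1 e : ℝ) ^ 2) ≤
      A ^ 2 / (2 * (C.len e).toReal) := by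
  by_cases hl : C.len e = ⊤
  · simp [cycle_eq_zero hl, hl]
  · have hL := len_toReal_pos hl
    refine (mul_sub_sq_le hL _).trans ?_
    have : a e ^ 2 ≤ A ^ 2 := sq_le_sq' (neg_le_of_abs_le (ha e)) (le_of_abs_le (ha e))
    gcongr

theorem thetaTerm_le {a : C.E → ℝ} {A : ℝ} (ha : ∀ e, |a e| ≤ A) (c : C.cycles) :
    thetaTerm a c ≤ ∑ e, A ^ 2 / (2 * (C.len e).toReal) :=
  Finset.sum_le_sum fun e _ => thetaTerm_summand_le ha c e

/-- A negative definite quadratic form outgrows a bounded linear one. Only these cycles can compete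
with the zero cycle, so the supremum in `theta` is locally over one finite set. -/
theorem finite_thetaTerm_nonneg (A : ℝ) :
    {c : C.cycles | ∃ a : C.E → ℝ, (∀ e, |a e| ≤ A) ∧ 0 ≤ thetaTerm a c}.Finite := by
  let B : ℝ := ∑ e : C.E, A ^ 2 / (2 * (C.len e).toReal)
  have hB : ∀ e : C.E, 0 ≤ A ^ 2 / (2 * (C.len e).toReal) := fun e => by positivity
  have hB0 : 0 ≤ B := Finset.sum_nonneg fun e _ => hB e
  -- If `|c e| > 1`, then `-B ≤ A |c e| - len e * |c e|² / 2` and `B ≤ B |c e|` give `|c e| ≤ 2 (A +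
  -- B) / len e`.
  let N : C.E → ℤ := fun e => ⌈1 + 2 * (A + B) / (C.len e).toReal⌉
  have hfin : ((fun c : C.cycles => c.1) ⁻¹' Set.Icc (-N) N).Finite :=
    (Set.finite_Icc _ _).preimage Subtype.val_injective.injOn
  refine hfin.subset ?_
  rintro c ⟨a, ha, hc⟩
  have habs : ∀ e, |(c.1 e : ℝ)| ≤ N e := by
    intro e
    have hA : 0 ≤ A := (abs_nonneg _).trans (ha e)
    refine le_trans ?_ (Int.le_ceil _)
    by_cases hl : C.len e = ⊤
    · rw [cycle_eq_zero hl]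
      simp [hl]
    have hL := len_toReal_pos hl
    rcases le_or_gt |(c.1 e : ℝ)| 1 with h | h
    · have : 0 ≤ 2 * (A + B) / (C.len e).toReal := by positivity
      linarith
    · have h1 : -B ≤ a e * c.1 e - 1 / 2 * ((C.len e).toReal * (c.1 e : ℝ) ^ 2) := by
        have h2 := Finset.sum_le_sum fun e' (_ : e' ∈ Finset.univ.erase e) =>
          thetaTerm_summand_le ha c e'
        have h3 := Finset.add_sum_erase Finset.univ (fun e' => A ^ 2 / (2 * (C.len e').toReal))
          (Finset.mem_univ e)
        have h4 := Finset.add_sum_erase Finset.univ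
          (fun e' => a e' * c.1 e' - 1 / 2 * ((C.len e').toReal * (c.1 e' : ℝ) ^ 2))
          (Finset.mem_univ e)
        have h5 := hB e
        simp only [thetaTerm] at hc
        simp only [B]
        linarith
      have h2 : a e * c.1 e ≤ A * |(c.1 e : ℝ)| := by
        refine (le_abs_self _).trans ?_
        rw [abs_mul]
        exact mul_le_mul_of_nonneg_right (ha e) (abs_nonneg _)
      rw [← sq_abs] at h1
      have h3 : |(c.1 e : ℝ)| * (C.len e).toReal ≤ 2 * (A + B) := by
        nlinarith
      have h4 : |(c.1 e : ℝ)| ≤ 2 * (A + B) / (C.len e).toReal := by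
        rwa [le_div_iff₀ hL]
      linarith
  constructor <;> intro e
  · have := neg_le_of_abs_le (habs e)
    exact_mod_cast this
  · have := le_of_abs_le (habs e)
    exact_mod_cast this

theorem Frame.term_eq {p₀ : C.Pt} (F : Frame p₀) (x : C.FormDual) (c : C.cycles) :
    x c - 1 / 2 * C.period c c = thetaTerm (fun e => x (F.cyc e)) c := by
  rw [thetaTerm, Finset.sum_sub_distrib, ← Finset.mul_sum, period_apply]
  congr 1
  · conv_lhs => rw [← F.sum_coeff x]
    simp [coeff]
  · congr 1
    exact Finset.sum_congr rfl fun e _ => by ring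

theorem bddAbove_theta (x : C.FormDual) :
    BddAbove (Set.range fun c : C.cycles => x c - 1 / 2 * C.period c c) := by
  obtain ⟨v⟩ := C.nonempty
  obtain ⟨F⟩ := nonempty_frame (C := C) (Pt.vertex v)
  refine ⟨∑ e, (∑ e, |x (F.cyc e)|) ^ 2 / (2 * (C.len e).toReal), ?_⟩
  rintro _ ⟨c, rfl⟩
  simp only [F.term_eq]
  exact thetaTerm_le (fun e => Finset.single_le_sum (f := fun e => |x (F.cyc e)|)
    (fun _ _ => abs_nonneg _) (Finset.mem_univ e)) c

/-- Along a bounded segment, the theta function is a maximum of finitely many affine functions. -/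
theorem exists_theta_eq_max (x : C.FormDual) (e : C.E) (R : ℝ) :
    ∃ G : Finset C.cycles, G.Nonempty ∧ ∀ t : ℝ, |t| ≤ R →
      (∀ c ∈ G, (x c - 1 / 2 * C.period c c) + c.1 e * t ≤ C.theta (x + t • C.coeff e)) ∧
      ∃ c ∈ G, C.theta (x + t • C.coeff e) = (x c - 1 / 2 * C.period c c) + c.1 e * t := by
  obtain ⟨v⟩ := C.nonempty
  obtain ⟨F⟩ := nonempty_frame (C := C) (Pt.vertex v)
  -- A common bound for the coefficients of `x + t • coeff e` over the whole segment `|t| ≤ R`.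
  let A : ℝ := ∑ e', (|x (F.cyc e')| + R * |C.coeff e (F.cyc e')|)
  have hfin := finite_thetaTerm_nonneg (C := C) A
  have hval : ∀ (t : ℝ) (c : C.cycles), (x c - 1 / 2 * C.period c c) + c.1 e * t =
      (x + t • C.coeff e) c - 1 / 2 * C.period c c := by
    intro t c
    simp [coeff]; ring
  have hA : ∀ t, |t| ≤ R → ∀ e', |(x + t • C.coeff e) (F.cyc e')| ≤ A := by
    intro t ht e'
    have hR : 0 ≤ R := (abs_nonneg t).trans ht
    refine le_trans ?_ (Finset.single_le_sum
      (f := fun e' => |x (F.cyc e')| + R * |C.coeff e (F.cyc e')|) (fun _ _ => by positivity)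
      (Finset.mem_univ e'))
    rw [LinearMap.add_apply, LinearMap.smul_apply, smul_eq_mul]
    refine (abs_add_le _ _).trans ?_
    rw [abs_mul]
    gcongr
  by_cases hR : 0 ≤ R
  swap
  · exact ⟨{0}, by simp, fun t ht => absurd ((abs_nonneg t).trans ht) hR⟩
  have h0 : (0 : C.cycles) ∈ hfin.toFinset := by
    rw [hfin.mem_toFinset]
    exact ⟨_, hA 0 (by simpa using hR), by simp [thetaTerm]⟩
  refine ⟨hfin.toFinset, ⟨0, h0⟩, fun t ht => ?_⟩
  simp only [hval]
  have hbdd := bddAbove_theta (x + t • C.coeff e)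
  refine ⟨fun c _ => le_ciSup hbdd c, ?_⟩
  obtain ⟨c, hc, hmax⟩ := hfin.toFinset.exists_max_image
    (fun c => (x + t • C.coeff e) c - 1 / 2 * C.period c c) ⟨0, h0⟩
  refine ⟨c, hc, le_antisymm (ciSup_le fun d => ?_) (le_ciSup hbdd c)⟩
  by_cases hd : d ∈ hfin.toFinset
  · exact hmax d hd
  · have h1 := hmax 0 h0
    simp only [map_zero, mul_zero, sub_zero] at h1
    refine le_trans (le_of_not_ge fun h => hd ?_) h1
    rw [hfin.mem_toFinset]
    exact ⟨_, hA t ht, by rwa [← F.term_eq]⟩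

theorem exists_slope_theta (x : C.FormDual) (e : C.E) (t : ℝ) {σ : ℝ} (hσ : σ = 1 ∨ σ = -1) :
    ∃ n : ℤ, Slope (fun s => C.theta (x + s • C.coeff e)) t σ n := by
  obtain ⟨G, hG, h⟩ := exists_theta_eq_max x e (|t| + 1)
  have hv : ∀ᶠ h in 𝓝[≥] (0 : ℝ), |t + σ * h| ≤ |t| + 1 := by
    filter_upwards [Icc_mem_nhdsGE (zero_lt_one (α := ℝ))] with h hh
    refine (abs_add_le _ _).trans ?_
    have : |σ| = 1 := by rcases hσ with rfl | rfl <;> simp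
    rw [abs_mul, this, abs_of_nonneg hh.1]
    linarith [hh.2]
  obtain ⟨c, -, hs⟩ := exists_slope_of_min (φ := fun s => -C.theta (x + s • C.coeff e)) G hG
    (f := fun c s => -((x c - 1 / 2 * C.period c c) + c.1 e * s)) (x := t) (σ := σ)
    (m := fun c => -(c.1 e * σ)) (fun c _ => Eventually.of_forall fun h => by ring)
    (hv.mono fun s hs c hc => neg_le_neg ((h _ hs).1 c hc))
    (hv.mono fun s hs => by
      obtain ⟨c, hc, h'⟩ := (h _ hs).2
      exact ⟨c, hc, congrArg Neg.neg h'⟩)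
  have h1 := hs.const_mul (-1)
  simp only [neg_mul, one_mul, neg_neg] at h1
  rcases hσ with rfl | rfl
  · exact ⟨c.1 e, by simpa using h1⟩
  · exact ⟨-c.1 e, by simpa using h1⟩

/-- Quasi-periodicity: shift the index of the supremum by `c` and complete the square. -/
theorem theta_add_period (x : C.FormDual) (c : C.cycles) :
    C.theta (x + C.period c) = C.theta x + (x c + 1 / 2 * C.period c c) := by
  unfold theta
  rw [ciSup_add (bddAbove_theta x), ← (Equiv.addRight c).iSup_comp]
  refine iSup_congr fun d => ?_
  simp only [Equiv.coe_addRight, map_add, LinearMap.add_apply]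
  rw [period_comm d c]
  ring

/-- The correction in the quasi-periodicity is affine in `x`, so changing the lift by `c` changes
the slope along `e` by the coefficient of `c` on `e`. -/
theorem Slope.theta_add_period {x : C.FormDual} {e : C.E} {t σ n : ℝ}
    (h : Slope (fun s => C.theta (x + s • C.coeff e)) t σ n) (c : C.cycles) :
    Slope (fun s => C.theta (x + C.period c + s • C.coeff e)) t σ (n + σ * c.1 e) := by
  filter_upwards [h] with s hs
  rw [add_right_comm, TropicalCurve.theta_add_period, hs,
    add_right_comm x (C.period c) (t • C.coeff e), TropicalCurve.theta_add_period]
  simp [coeff]; ring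

theorem slope_translate {φ : ℝ → ℝ} {t σ n : ℝ} :
    Slope (fun s => φ (t + s)) 0 σ n ↔ Slope φ t σ n := by
  simp [Slope]

end

section

variable {C : TropicalCurve}

/-! ### Jacobi inversion -/

theorem Slope.hasDerivWithinAt {φ : ℝ → ℝ} {σ n : ℝ} (h : Slope φ 0 σ n) :
    HasDerivWithinAt (fun t : ℝ => φ (t * σ)) n (Set.Ici 0) 0 := by
  have h1 : HasDerivWithinAt (fun t : ℝ => φ 0 + n * t) n (Set.Ici 0) 0 := by
    simpa using (((hasDerivAt_id (0 : ℝ)).const_mul n).const_add (φ 0)).hasDerivWithinAt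
  refine h1.congr_of_eventuallyEq ?_ (by simp)
  rw [EventuallyEq, ← Set.Ioi_insert, nhdsWithin_insert, eventually_sup]
  refine ⟨by simp, ?_⟩
  filter_upwards [h] with t ht
  rw [mul_comm, ← ht, zero_add]

theorem IsThetaPullback.unique {p₀ : C.Pt} {l : C.FormDual} {D D' : C.Div}
    (h : C.IsThetaPullback p₀ l D) (h' : C.IsThetaPullback p₀ l D') : D = D' := by
  obtain ⟨m, h1, h2⟩ := h
  obtain ⟨n, h3, h4⟩ := h'
  ext p
  rw [h2, h4]
  refine Finset.sum_congr rfl fun ξ _ => ?_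
  have := (uniqueDiffWithinAt_Ici (0 : ℝ)).eq_deriv _ (h1 p ξ) (h3 p ξ)
  exact_mod_cast this

theorem sgn_inner {e : C.E} {t : ENNReal} (h0 : 0 < t) (h1 : t < C.len e) (b : Bool) :
    Dir.sgn (show C.Dir (Pt.inner e t h0 h1) from b) = if b = true then 1 else -1 := rfl

namespace Frame

variable {p₀ : C.Pt} (F : Frame p₀)

theorem exists_thetaPullback (l : C.FormDual) : ∃ D : C.Div, C.IsThetaPullback p₀ l D ∧
    C.abelJacobi p₀ D = C.toJacHom (∑ e, ((F.cyc e).1 e • C.lift p₀ (Pt.vertex (C.tgt e)) -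
      (C.theta (C.lift p₀ (Pt.vertex (C.tgt e)) - l + C.period (F.cyc e)) -
        C.theta (C.lift p₀ (Pt.vertex (C.src e)) - l)) • C.coeff e)) := by
  let y : C.E → C.FormDual := fun e => C.lift p₀ (Pt.vertex (C.src e)) - l
  let φ : C.E → ℝ → ℝ := fun e t => C.theta (y e + t • C.coeff e)
  have hex : ∀ (p : C.Pt) (ξ : C.Dir p), ∃ n : ℤ,
      Slope (fun s => C.theta (C.lift p₀ p - l + s • C.coeff ξ.edge)) 0 ξ.sgn n :=
    fun p ξ => exists_slope_theta _ _ 0 ξ.sgn_eq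
  choose m hm using hex
  choose mp hp using fun (e : C.E) (t : ℝ) => exists_slope_theta (y e) e t (Or.inl rfl)
  choose mm hmm using fun (e : C.E) (t : ℝ) => exists_slope_theta (y e) e t (Or.inr rfl)
  -- On an infinite edge `coeff e = 0`, so `Θ` is constant along it.
  have htop : ∀ e, C.len e = ⊤ → ∀ t, mp e t = 0 ∧ mm e t = 0 := by
    intro e hl t
    have h1 : ∀ σ, Slope (fun s => C.theta (y e + s • C.coeff e)) t σ 0 := fun σ =>
      Eventually.of_forall fun s => by simp [coeff_eq_zero hl]
    have h2 := (hp e t).unique (h1 1)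
    have h3 := (hmm e t).unique (h1 (-1))
    exact ⟨by exact_mod_cast h2, by exact_mod_cast h3⟩
  have hsrc : ∀ e, m _ (C.dirSrc e) = mp e 0 := by
    intro e
    have h1 := hm _ (C.dirSrc e)
    rw [show (C.dirSrc e).sgn = 1 from if_pos rfl] at h1
    have h2 := h1.unique (hp e 0)
    exact_mod_cast h2
  -- The chosen lift of the target and the continuation of the lift of the source along `e` differ
  -- by the period of `cyc e`. This is the source of the jump `k`.
  have htgt : ∀ e, m _ (C.dirTgt e) = mm e (C.len e).toReal + (F.cyc e).1 e := by
    intro e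
    have h1 := hm _ (C.dirTgt e)
    rw [show (C.dirTgt e).sgn = -1 from if_neg (by simp [dirTgt, Dir.fwd])] at h1
    have h2 := h1.theta_add_period (F.cyc e)
    have h3 : C.lift p₀ (Pt.vertex (C.tgt e)) - l + C.period (F.cyc e) =
        y e + (C.len e).toReal • C.coeff e := by
      rw [F.period_cyc]; simp only [y]; abel
    rw [h3] at h2
    have h4 := hmm e (C.len e).toReal
    rw [← slope_translate] at h4
    simp only [add_smul, ← add_assoc] at h4
    have h5 : (m _ (C.dirTgt e) : ℝ) + -1 * (F.cyc e).1 e = mm e (C.len e).toReal := h2.unique h4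
    have h6 : (m _ (C.dirTgt e) : ℝ) = mm e (C.len e).toReal + (F.cyc e).1 e := by linarith
    exact_mod_cast h6
  have hinner : ∀ e x, C.IsInner e x → ∑ ξ, m (C.rpt e x) ξ = mp e x + mm e x := by
    intro e x hx
    obtain ⟨z, hz⟩ := (QuotientAddGroup.eq_zero_iff _).1
      ((map_sub C.toJacHom _ _).trans (sub_eq_zero.2 (toJac_lift_inner p₀ hx)))
    have h0 : C.lift p₀ (C.rpt e x) - l = y e + x • C.coeff e + C.period z := by
      rw [hz]; simp only [y]; abel
    -- Replacing the chosen lift of an interior point by the continuation from the source changes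
    -- the slope by `σ * z e`, which cancels between the two directions.
    have key : ∀ (σ : ℝ) (n k : ℤ),
        Slope (fun s => C.theta (y e + s • C.coeff e)) x σ n →
        Slope (fun s => C.theta (C.lift p₀ (C.rpt e x) - l + s • C.coeff e)) 0 σ k →
        (k : ℝ) = n + σ * z.1 e := by
      intro σ n k h1 h2
      rw [← slope_translate] at h1
      simp only [add_smul, ← add_assoc] at h1
      have h3 := h1.theta_add_period z
      rw [← h0] at h3
      exact h2.unique h3
    have hpt := hx.rpt
    generalize C.rpt e x = p at hpt key ⊢
    subst hpt
    rw [sum_dir_inner]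
    have h1 := hm _ (show C.Dir (Pt.inner e _ (ENNReal.ofReal_pos.2 hx.1) hx.2) from true)
    have h2 := hm _ (show C.Dir (Pt.inner e _ (ENNReal.ofReal_pos.2 hx.1) hx.2) from false)
    rw [sgn_inner, if_pos rfl] at h1
    rw [sgn_inner, if_neg Bool.false_ne_true] at h2
    have h3 := key 1 _ _ (hp e x) h1
    have h4 := key (-1) _ _ (hmm e x) h2
    have h5 : ∀ a b : ℤ, (a : ℝ) = mp e x + 1 * z.1 e → (b : ℝ) = mm e x + -1 * z.1 e →
        a + b = mp e x + mm e x := by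
      intro a b ha hb
      have : (a : ℝ) + b = mp e x + mm e x := by rw [ha, hb]; ring
      exact_mod_cast this
    exact h5 _ _ h3 h4
  have hfinite : {p | ∑ ξ, m p ξ ≠ 0}.Finite := by
    refine finite_of_finite_edges (n := fun p => ∑ ξ, m p ξ) fun e => ?_
    by_cases hl : C.len e = ⊤
    · convert Set.finite_empty
      ext x
      simp only [Set.mem_ofPred_eq, Set.mem_empty_iff_false, iff_false, not_and, not_not]
      intro hx
      rw [hinner e x hx, (htop e hl x).1, (htop e hl x).2, add_zero]
    · refine (finite_breaks (φ := φ e) (a := 0) (b := (C.len e).toReal)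
        (mp := fun x => (mp e x : ℝ)) (mm := fun x => (mm e x : ℝ))
        (fun x _ => hp e x) (fun x _ => hmm e x)).subset ?_
      rintro x ⟨hx, hx'⟩
      rw [hinner e x hx] at hx'
      exact ⟨(isInner_iff hl).1 hx, by exact_mod_cast hx'⟩
  let D : C.Div := Finsupp.ofSupportFinite (fun p => ∑ ξ, m p ξ) hfinite
  have hD : ∀ p, D p = ∑ ξ, m p ξ := fun p => rfl
  have hsum : ∀ e, C.len e ≠ ⊤ →
      ∑ x ∈ edgeSupp D e, D (C.rpt e x) = -mm e (C.len e).toReal - mp e 0 ∧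
      ∑ x ∈ edgeSupp D e, x * (D (C.rpt e x) : ℝ) =
        -((C.len e).toReal * mm e (C.len e).toReal) - (φ e (C.len e).toReal - φ e 0) := by
    intro e hl
    have hin : ∀ x ∈ edgeSupp D e, (D (C.rpt e x) : ℝ) = mp e x + mm e x := fun x hx => by
      rw [hD, hinner e x (mem_edgeSupp.1 hx).1]; push_cast; ring
    obtain ⟨h1, h2⟩ := sum_slopes (φ := φ e) (len_toReal_pos hl)
      (mp := fun x => (mp e x : ℝ)) (mm := fun x => (mm e x : ℝ))
      (fun x _ => hp e x) (fun x _ => hmm e x) (edgeSupp D e)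
      (fun x hx => (isInner_iff hl).1 (mem_edgeSupp.1 hx).1) (fun x hx hx' => by
        have h3 := (isInner_iff hl).2 hx
        have h4 : D (C.rpt e x) = 0 := by
          by_contra h
          exact hx' (mem_edgeSupp.2 ⟨h3, h⟩)
        rw [hD, hinner e x h3] at h4
        exact_mod_cast h4)
    constructor
    · rw [← Finset.sum_congr rfl hin] at h1
      exact_mod_cast h1
    · rw [Finset.sum_congr rfl fun x hx => by rw [hin x hx], h2]
      ring
  have hφ0 : ∀ e, φ e 0 = C.theta (C.lift p₀ (Pt.vertex (C.src e)) - l) := fun e => by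
    simp [φ, y]
  have hφ1 : ∀ e, φ e (C.len e).toReal =
      C.theta (C.lift p₀ (Pt.vertex (C.tgt e)) - l + C.period (F.cyc e)) := fun e => by
    rw [F.period_cyc]
    simp only [φ, y]
    congr 1
    abel
  refine ⟨D, ⟨m, fun p ξ => (hm p ξ).hasDerivWithinAt, hD⟩, ?_⟩
  simp only [← hφ0, ← hφ1]
  refine (abelJacobi_eq p₀ (s₀ := fun e => mp e 0) (s₁ := fun e => -mm e (C.len e).toReal)
    (k := fun e => (F.cyc e).1 e) ?_ ?_ ?_).1
  · intro v
    rw [hD, sum_dir_vertex]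
    simp only [hsrc, htgt]
    rw [sub_eq_add_neg, ← Finset.sum_neg_distrib]
    congr 1
    exact Finset.sum_congr rfl fun e _ => by ring
  · intro e
    by_cases hl : C.len e = ⊤
    · rw [(htop e hl _).1, (htop e hl _).2]
      refine (Finset.sum_eq_zero fun x hx => ?_).trans (by simp)
      rw [hD, hinner e x (mem_edgeSupp.1 hx).1, (htop e hl x).1, (htop e hl x).2, add_zero]
    · exact (hsum e hl).1
  · intro e hl
    rw [(hsum e hl).2]
    push_cast; ring

/-- Half the square of the length of a chain. -/
def energy (γ : C.E → ℤ) : ℝ := 1 / 2 * ∑ e, (γ e : ℝ) ^ 2 * (C.len e).toReal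

theorem energy_cyc (e : C.E) :
    C.lift p₀ (Pt.vertex (C.tgt e)) (F.cyc e) + 1 / 2 * C.period (F.cyc e) (F.cyc e) =
      F.const (F.cyc e) + (energy (F.chain (C.src e)) - energy (F.chain (C.tgt e))) +
        ((F.chain (C.src e) e : ℝ) + 1 / 2) * (C.len e).toReal := by
  have h1 : ∑ e', ((Pi.single e 1 : C.E → ℤ) e' : ℝ) *
      (((F.chain (C.src e) e' : ℝ) + 1 / 2) * (C.len e').toReal) =
      ((F.chain (C.src e) e : ℝ) + 1 / 2) * (C.len e).toReal := by
    rw [Finset.sum_eq_single e]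
    · simp
    · intro e' _ h; simp [h]
    · simp
  have h2 : ∀ e', ((F.cyc e).1 e' : ℝ) = F.chain (C.src e) e' +
      ((Pi.single e 1 : C.E → ℤ) e' : ℝ) - F.chain (C.tgt e) e' := fun e' => by
    simp [cyc]
  have h3 : ∀ e', ((Pi.single e 1 : C.E → ℤ) e' : ℝ) ^ 2 = (Pi.single e 1 : C.E → ℤ) e' :=
    fun e' => by
      rw [Pi.single_apply]
      split_ifs <;> simp
  -- With `a`, `b` the chains to source and target and `u` the edge, `Q(b, a+u-b) + Q(a+u-b,
  -- a+u-b)/2 = Q(a+u, a+u)/2 - Q(b, b)/2`.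
  have h4 : (∑ e', (F.chain (C.tgt e) e' : ℝ) * (C.len e').toReal * (F.cyc e).1 e') +
      1 / 2 * ∑ e', ((F.cyc e).1 e' : ℝ) * (C.len e').toReal * (F.cyc e).1 e' =
      energy (F.chain (C.src e)) - energy (F.chain (C.tgt e)) +
        ∑ e', ((Pi.single e 1 : C.E → ℤ) e' : ℝ) *
          (((F.chain (C.src e) e' : ℝ) + 1 / 2) * (C.len e').toReal) := by
    simp only [energy, Finset.mul_sum, ← Finset.sum_sub_distrib, ← Finset.sum_add_distrib]
    refine Finset.sum_congr rfl fun e' _ => ?_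
    rw [h2]
    linear_combination 1 / 2 * (C.len e').toReal * h3 e'
  rw [F.lift_eq, LinearMap.add_apply, chainInt_apply, period_apply, ← h1]
  linarith

end Frame

end

section

variable {C : TropicalCurve}

/-! ### The Riemann constant -/

namespace Frame

variable {p₀ : C.Pt} (F : Frame p₀)

/-- A lift of the negative of the Riemann constant. -/
def riemannLift : C.FormDual :=
  ∑ e, ((F.cyc e).1 e • C.lift p₀ (Pt.vertex (C.tgt e)) -
    (C.lift p₀ (Pt.vertex (C.tgt e)) (F.cyc e) + 1 / 2 * C.period (F.cyc e) (F.cyc e)) • C.coeff e)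

/-- Jacobi inversion. By quasi-periodicity the increments of `Θ` are a differential, which drops
out, plus terms affine in `l`; by `sum_coeff` their linear part sums to `l`. -/
theorem exists_thetaPullback_riemannLift (l : C.FormDual) : ∃ D : C.Div,
    C.IsThetaPullback p₀ l D ∧ C.abelJacobi p₀ D = C.toJacHom (F.riemannLift + l) := by
  obtain ⟨D, hD, h⟩ := F.exists_thetaPullback l
  refine ⟨D, hD, h.trans (congrArg _ ?_)⟩
  have h1 := sum_differential fun v => C.theta (C.lift p₀ (Pt.vertex v) - l)
  have h2 := F.sum_coeff l
  rw [riemannLift, ← sub_zero (_ + l), ← h1]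
  conv_rhs =>
    enter [1, 2]
    rw [← h2]
  rw [← Finset.sum_add_distrib, ← Finset.sum_sub_distrib]
  refine Finset.sum_congr rfl fun e _ => ?_
  rw [theta_add_period, LinearMap.sub_apply]
  module

/-- In `energy_cyc` the energies form a differential and sum to zero, while the constant of the
frame is recovered by `sum_coeff`. -/
theorem riemannLift_eq : F.riemannLift =
    ∑ e, ((F.cyc e).1 e • C.lift p₀ (Pt.vertex (C.tgt e)) -
      (((F.chain (C.src e) e : ℝ) + 1 / 2) * (C.len e).toReal) • C.coeff e) - F.const := by
  have h1 := sum_differential fun v => energy (F.chain v)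
  have h2 := F.sum_coeff F.const
  conv_rhs =>
    arg 2
    rw [← h2]
  rw [riemannLift, ← add_zero (_ - _), ← h1, ← Finset.sum_sub_distrib, ← Finset.sum_add_distrib]
  refine Finset.sum_congr rfl fun e _ => ?_
  rw [F.energy_cyc]
  module

/-- Collect the terms at each vertex `v`: the coefficient is the boundary of `chain v` evaluated at
`v` itself. -/
theorem sum_chain_smul (P : C.V → C.FormDual) :
    ∑ e, (F.chain (C.tgt e) e • P (C.tgt e) - F.chain (C.src e) e • P (C.src e)) =
      ∑ v, P v - P F.base := by
  rw [Finset.sum_sub_distrib, ← sum_fiber_smul C.tgt (fun e => F.chain (C.tgt e) e),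
    ← sum_fiber_smul C.src (fun e => F.chain (C.src e) e), ← Finset.sum_sub_distrib]
  have h : ∀ v, (∑ e with C.tgt e = v, F.chain (C.tgt e) e) • P v -
      (∑ e with C.src e = v, F.chain (C.src e) e) • P v =
      P v - (Pi.single F.base 1 : C.V → ℤ) v • P v := by
    intro v
    have h1 := congrFun (F.boundary_chain v) v
    rw [boundary_apply, Pi.sub_apply, Pi.single_eq_same] at h1
    rw [← sub_smul, Finset.sum_congr (g := F.chain v) rfl fun e he => by
        rw [(Finset.mem_filter.1 he).2],
      Finset.sum_congr (g := F.chain v) (s₁ := {e | C.src e = v}) rfl fun e he => by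
        rw [(Finset.mem_filter.1 he).2], h1, sub_smul, one_smul]
  rw [Finset.sum_congr rfl fun v _ => h v, Finset.sum_sub_distrib,
    Finset.sum_eq_single (f := fun v => (Pi.single F.base 1 : C.V → ℤ) v • P v) F.base]
  · simp
  · intro v _ hv; simp [hv]
  · simp

/-- The coefficients of the chains are integers, so all terms that depend on the choice of chains
collect into a period. -/
theorem toJacHom_riemannLift : C.toJacHom F.riemannLift =
    C.toJacHom (∑ e, (C.lift p₀ (Pt.vertex (C.tgt e)) - ((C.len e).toReal / 2) • C.coeff e) -
      ∑ v, C.lift p₀ (Pt.vertex v)) := by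
  have hbase : C.boundary (F.chain F.base) = 0 := by rw [F.boundary_chain, sub_self]
  have h1 := F.sum_chain_smul fun v => C.lift p₀ (Pt.vertex v)
  have h2 := F.lift_eq F.base
  have h3 : F.riemannLift =
      ∑ e, (C.lift p₀ (Pt.vertex (C.tgt e)) - ((C.len e).toReal / 2) • C.coeff e) -
        ∑ v, C.lift p₀ (Pt.vertex v) + C.chainInt (F.chain F.base) -
        C.period (∑ e, F.chain (C.src e) e • F.cyc e) := by
    have h4 : ∑ v, C.lift p₀ (Pt.vertex v) - C.chainInt (F.chain F.base) =
        ∑ e, (F.chain (C.tgt e) e • C.lift p₀ (Pt.vertex (C.tgt e)) -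
          F.chain (C.src e) e • C.lift p₀ (Pt.vertex (C.src e))) + F.const := by
      rw [h1, h2]; abel
    rw [riemannLift_eq, sub_add, h4, map_sum, ← sub_sub, sub_right_comm,
      ← Finset.sum_sub_distrib, ← Finset.sum_sub_distrib]
    congr 1
    refine Finset.sum_congr rfl fun e _ => ?_
    have h5 : (F.cyc e).1 e = F.chain (C.src e) e + 1 - F.chain (C.tgt e) e := by simp [cyc]
    rw [map_zsmul, F.period_cyc, h5]
    module
  rw [h3, map_sub, map_add, toJacHom_chainInt hbase, toJacHom_period, add_zero, sub_zero]

end Frame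

/-- The pull-back divisor is unique, so the case `l = 0` already determines `κ`; Jacobi inversion
shows that this value works for every `l`. -/
theorem GradientData.isRiemannConstant_iff {S : Set C.Pt} (G : GradientData S) (p₀ : C.Pt)
    (κ : C.Jac) : C.IsRiemannConstant p₀ κ ↔ κ = -C.abelJacobi p₀ G.Kminus := by
  obtain ⟨F⟩ := nonempty_frame p₀
  have hF : C.toJacHom F.riemannLift = C.abelJacobi p₀ G.Kminus := by
    rw [F.toJacHom_riemannLift, (G.abelJacobi_Kminus p₀).1]
  constructor
  · intro h
    obtain ⟨D, hD, h1⟩ := h 0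
    obtain ⟨D', hD', h2⟩ := F.exists_thetaPullback_riemannLift 0
    rw [hD.unique hD', h2, add_zero, hF, toJac_eq, map_zero] at h1
    exact eq_neg_of_add_eq_zero_right h1
  · rintro rfl l
    obtain ⟨D, hD, h⟩ := F.exists_thetaPullback_riemannLift l
    exact ⟨D, hD, by rw [h, map_add, hF, toJac_eq]; abel⟩

theorem abelJacobi_eq_of_cls_eq {D D' : C.Div} (h : C.cls D = C.cls D') (p₀ : C.Pt) :
    C.abelJacobi p₀ D = C.abelJacobi p₀ D' := by
  obtain ⟨f, hf⟩ := cls_eq_cls.1 h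
  rw [← sub_add_cancel D' D, abelJacobi_add, (hf.abelJacobi_eq_zero p₀).1, zero_add]

theorem deg_eq_of_cls_eq {D D' : C.Div} (h : C.cls D = C.cls D') : C.deg D = C.deg D' := by
  obtain ⟨f, hf⟩ := cls_eq_cls.1 h
  obtain ⟨v⟩ := C.nonempty
  rw [← sub_add_cancel D' D, deg_add, (hf.abelJacobi_eq_zero (Pt.vertex v)).2, zero_add]

theorem GradientData.deg_Kminus {S : Set C.Pt} (G : GradientData S) :
    C.deg G.Kminus = (C.genus : ℤ) - 1 := by
  obtain ⟨v⟩ := C.nonempty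
  have h := genus_add_card (C := C)
  rw [(G.abelJacobi_Kminus (Pt.vertex v)).2]
  lia

end

end

end TropicalCurve

/-! ### Proof of the theorem -/

theorem mainTheorem3 (C : TropicalCurve) :
    ∃ K₀ : C.Pic,
      -- `K₀` is the unique non-effective theta characteristic
      (C.IsThetaChar K₀ ∧ ¬ C.IsEffective K₀ ∧
        ∀ a : C.Pic, C.IsThetaChar a → ¬ C.IsEffective a → a = K₀) ∧
      -- `K₀ = -κ`, where `κ` is the universal constant of Jacobi inversion
      (∀ p₀ : C.Pt, (∃! κ : C.Jac, C.IsRiemannConstant p₀ κ) ∧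
        ∀ κ : C.Jac, C.IsRiemannConstant p₀ κ →
          ∀ D : C.Div, C.cls D = K₀ → C.abelJacobi p₀ D = -κ) ∧
      -- the moderators of all `S` represent `K₀`
      ∀ S : Set C.Pt, S.Finite → S.Nonempty → (∀ p ∈ S, ¬ C.AtInfinity p) →
        ∃ Kplus Kminus : C.Div,
          (∀ p, Kplus p = (C.valPlus S p : ℤ) - 1) ∧
          (∀ p, Kminus p = (C.valMinus S p : ℤ) - 1) ∧
          C.deg Kplus = (C.genus : ℤ) - 1 ∧ C.deg Kminus = (C.genus : ℤ) - 1 ∧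
          Kplus + Kminus = C.canonical ∧
          TropicalCurve.IsDivisorOf (fun p => (C.distSet S p).toReal) (Kplus - Kminus) ∧
          C.cls Kplus = K₀ ∧ C.cls Kminus = K₀ := by
  -- Any admissible `S` defines the class `K₀`; a single vertex not at infinity serves.
  obtain ⟨v, hv⟩ := TropicalCurve.exists_not_atInfinity (C := C)
  obtain ⟨G₀⟩ := TropicalCurve.nonempty_gradientData
    (Set.finite_singleton (TropicalCurve.Pt.vertex v))
    (by simpa using hv) (Set.singleton_nonempty _)
  refine ⟨C.cls G₀.Kminus, ⟨⟨⟨_, G₀.deg_Kminus, rfl⟩, G₀.two_smul_cls⟩,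
    G₀.cls_Kplus ▸ G₀.not_isEffective, fun a ha hne => G₀.unique_thetaChar ha hne⟩,
    fun p₀ => ⟨?_, fun κ hκ D hD => ?_⟩, fun S hfin hne hS => ?_⟩
  · simp only [G₀.isRiemannConstant_iff]
    exact ⟨_, rfl, fun _ h => h⟩
  · rw [(G₀.isRiemannConstant_iff p₀ κ).1 hκ, neg_neg,
      TropicalCurve.abelJacobi_eq_of_cls_eq hD]
  · obtain ⟨G⟩ := TropicalCurve.nonempty_gradientData hfin hS hne
    exact ⟨G.Kplus, G.Kminus,
      fun p => by rw [TropicalCurve.valPlus_eq, G.Kplus_apply],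
      fun p => by rw [TropicalCurve.valMinus_eq, G.Kminus_apply],
      (TropicalCurve.deg_eq_of_cls_eq G.cls_Kplus).trans G.deg_Kminus, G.deg_Kminus,
      G.Kplus_add_Kminus, G.isDivisorOf, G.cls_Kplus.trans (G.cls_Kminus_eq G₀),
      G.cls_Kminus_eq G₀⟩
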